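/- **Setting.** Let $\mathbb X,\mathbb Y$ be locally compact second countable Hausdorff spaces with their Borel $\sigma$-algebras, $\mathbf N_{\mathbb X}$ the space of $\sigma$-finite counting measures on $\mathbb X$ and $\widehat{\mathbf N}_{\mathbb Y}$ the space of finite counting measures on $\mathbb Y$, both with the $\sigma$-algebra generated by the evaluations $\omega\mapsto\omega(B)$, and $\mathcal F$ the family of closed subsets of $\mathbb X$ with the $\sigma$-algebra generated by the sets $\{F\in\mathcal F: F\cap K\neq\emptyset\}$, $K$ compact. For measures put $d_{TV}(\mu,\nu)=\sup|\mu(A)-\nu(A)|$, the supremum being over measurable $A$ with $\mu(A),\nu(A)<\infty$. For finite point processes $\xi,\zeta$ on $\mathbb Y$ let $\mathbf{d_{KR}}(\xi,\zeta)=\sup_h|\mathbb E h(\xi)-\mathbb E h(\zeta)|$, the supremum being over measurable $h:\widehat{\mathbf N}_{\mathbb Y}\to\mathbb R$ with $|h(\omega_1)-h(\omega_2)|\le d_{TV}(\omega_1,\omega_2)$ for all $\omega_1,\omega_2$. Let $f:\mathbb X\times\mathbf N_{\mathbb X}\to\mathbb Y$, $g:\mathbb X\times\mathbf N_{\mathbb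 X}\to\{0,1\}$, $\mathcal S:\mathbb X\times\mathbf N_{\mathbb X}\to\mathcal F$ be measurable. Assume that $f,g$ are localized to $\mathcal S$: for all $\omega\in\mathbf N_{\mathbb X}$, all points $x$ of $\omega$ and all measurable $B\supseteq\mathcal S(x,\omega)$, $g(x,\omega)=g(x,\omega\cap B)$, and $f(x,\omega)=f(x,\omega\cap B)$ if $g(x,\omega)=1$. Let $\mathbf Q$ be a probability measure on $\mathbb X$, and let $x\mapsto S_x$ be a measurable map from $\mathbb X$ to $\mathcal F$ with $x\in S_x$ and $\mathbf Q(S_x)<1$ for all $x$. Assume that $\mathcal S$ is a stopping set: for every $x$, $$\{\omega:\mathcal S(x,\omega)\subseteq B\}=\{\omega:\mathcal S(x,\omega\cap B)\subseteq B\}$$ for every compact $B\subseteq\mathbb X$ and for $B=S_x$ (the latter follows from the former if $S_x$ is compact or if $\mathcal S$ has compact values). For $m\ge0$ let $\beta_m$ be a binomial process of $m$ independent points with law $\mathbf Q$, and $\widetilde\beta_{x,m}$ one of $m$ independent points with law $\mathbf Q_x(\cdot)=\mathbf Q(\cdot\cap S_x^c)/\mathbf Q(S_x^c)$; expectations that involve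 a binomial process with a negative number of points are read as $0$. Let $n\in\mathbb N_0$, let $\xi=\sum_{x\in\beta_n}g(x,\beta_n)\,\delta_{f(x,\beta_n)}$ (points counted with multiplicity) with intensity measure $\mathbf L$, let $\zeta$ be a Poisson process on $\mathbb Y$ with finite intensity measure $\mathbf M$, and let $\tilde g(x,\omega)=g(x,\omega)\mathbf 1\{\mathcal S(x,\omega)\subseteq S_x\}$. **Theorem.** $$\mathbf{d_{KR}}(\xi,\zeta)\le d_{TV}(\mathbf L,\mathbf M)+E_1+E_2+E_3+E_4+E_5+E_6,$$ where $$E_1=2n\int\mathbb E\big[g(x,\beta_{n-1}+\delta_x)\mathbf 1\{\mathcal S(x,\beta_{n-1}+\delta_x)\not\subseteq S_x\}\big]\,\mathbf Q(dx),$$ $$E_2=2n^2\int\mathbf 1\{S_x\cap S_y\ne\emptyset\}\,\mathbb E[\tilde g(x,\beta_{n-1}+\delta_x)]\,\mathbb E[\tilde g(y,\beta_{n-1}+\delta_y)]\,\mathbf Q^2(d(x,y)),$$ $$E_3=2n^2\int\mathbf 1\{S_x\cap S_y\ne\emptyset\}\,\mathbb E[\tilde g(x,\beta_{n-2}+\delta_x+\delta_y)\,\tilde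 g(y,\beta_{n-2}+\delta_x+\delta_y)]\,\mathbf Q^2(d(x,y)),$$ $$\begin{aligned}E_4=2n\int&\Big((1+n\mathbf Q(S_x))\,\mathbb E[\tilde g(x,\beta_{n-1}+\delta_x)]+n\int_{S_x}\mathbb E[\tilde g(x,\beta_{n-2}+\delta_x+\delta_z)]\,\mathbf Q(dz)\Big)\\ \times&\Big(\int\mathbf 1\{S_x\cap S_y=\emptyset\}\,\mathbb E[\tilde g(y,\widetilde\beta_{x,n-1}+\delta_y)]\,\mathbf Q_x(dy)\\ &+n\int\mathbf 1\{S_x\cap S_{y_1}=\emptyset,\ y_2\in S_{y_1}\}\,\mathbb E[\tilde g(y_1,\widetilde\beta_{x,n-2}+\delta_{y_1}+\delta_{y_2})]\,\mathbf Q_x^2(d(y_1,y_2))\Big)\,\mathbf Q(dx),\end{aligned}$$ $$E_5=2n^3\int\mathbf 1\{S_x\cap S_y=\emptyset\}\,\mathbb E[\tilde g(x,\beta_{n-1}+\delta_x)]\,\mathbb E[\tilde g(y,\beta_{n-2}+\delta_y)]\,\mathbf Q(S_x)\,\mathbf Q_x(S_y)\,\mathbf Q^2(d(x,y)),$$ $$\begin{aligned}E_6={}&2n^2\int\mathbf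 1\{S_x\cap S_y=\emptyset\}\,\mathbb E[\tilde g(x,\beta_{n-2}+\delta_x)\,\tilde g(y,\beta_{n-2}+\delta_y)]\,\mathbf Q_x(S_y)\,\mathbf Q^2(d(x,y))\\ &+2n^3\int\int_{S_x}\mathbf 1\{S_x\cap S_y=\emptyset\}\,\mathbb E[\tilde g(x,\beta_{n-3}+\delta_x+\delta_z)\,\tilde g(y,\beta_{n-3}+\delta_y)]\,\mathbf Q_x(S_y)\,\mathbf Q(dz)\,\mathbf Q^2(d(x,y)).\end{aligned}$$ -/

import Mathlib

open MeasureTheory ProbabilityTheory TopologicalSpace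
open scoped ENNReal NNReal

noncomputable section

namespace PoissonApprox

/-- A measure is a counting measure if it takes values in `{0, 1, 2, …, ∞}` on measurable sets. -/
def IsCounting {α : Type*} [MeasurableSpace α] (ω : Measure α) : Prop :=
  ∀ B, MeasurableSet B → ∃ k : ℕ∞, ω B = (k : ℝ≥0∞)

theorem IsCounting.add {α : Type*} [MeasurableSpace α] {μ ν : Measure α}
    (hμ : IsCounting μ) (hν : IsCounting ν) : IsCounting (μ + ν) := by
  intro B hB
  obtain ⟨k, hk⟩ := hμ B hB
  obtain ⟨l, hl⟩ := hν B hB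
  exact ⟨k + l, by simp [hk, hl]⟩

theorem IsCounting.restrict {α : Type*} [MeasurableSpace α] {μ : Measure α}
    (hμ : IsCounting μ) (S : Set α) : IsCounting (μ.restrict S) := by
  intro B hB
  obtain ⟨k, hk⟩ := hμ _ (measurableSet_toMeasurable μ (B ∩ S))
  exact ⟨k, by rw [Measure.restrict_apply hB, ← measure_toMeasurable, hk]⟩

theorem isCounting_dirac {α : Type*} [MeasurableSpace α] (x : α) :
    IsCounting (Measure.dirac x) := by
  intro B hB
  by_cases h : x ∈ B
  · exact ⟨1, by simp [Measure.dirac_apply' x hB, h]⟩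
  · exact ⟨0, by simp [Measure.dirac_apply' x hB, h]⟩

theorem isCounting_sum_smul_dirac {α : Type*} [MeasurableSpace α] {m : ℕ}
    (c : Fin m → ℕ) (p : Fin m → α) :
    IsCounting (∑ i, c i • Measure.dirac (p i)) := by
  intro B hB
  choose k hk using fun i => isCounting_dirac (p i) B hB
  refine ⟨∑ i, (c i : ℕ∞) * k i, ?_⟩
  rw [Measure.finsetSum_apply]
  have h : ∀ i, (c i • Measure.dirac (p i)) B = ((c i : ℕ∞) * k i : ℕ∞) := fun i => by
    rw [Measure.smul_apply, hk]
    simp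
  simp only [h]
  exact (map_sum ENat.toENNRealRingHom _ _).symm

/-- The space of `σ`-finite counting measures on `X`. Its `σ`-algebra is the one induced by the
evaluations `ω ↦ ω B`, `B` measurable. -/
def Config (X : Type*) [MeasurableSpace X] : Type _ :=
  {ω : Measure X // SigmaFinite ω ∧ IsCounting ω}

instance (X : Type*) [MeasurableSpace X] : MeasurableSpace (Config X) :=
  inferInstanceAs (MeasurableSpace {ω : Measure X // SigmaFinite ω ∧ IsCounting ω})

/-- The space of finite counting measures on `Y`, with the `σ`-algebra induced by the
evaluations. -/
def FinConfig (Y : Type*) [MeasurableSpace Y] : Type _ :=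
  {ω : Measure Y // IsFiniteMeasure ω ∧ IsCounting ω}

instance (Y : Type*) [MeasurableSpace Y] : MeasurableSpace (FinConfig Y) :=
  inferInstanceAs (MeasurableSpace {ω : Measure Y // IsFiniteMeasure ω ∧ IsCounting ω})

section Configurations

variable {X Y : Type*} [MeasurableSpace X] [MeasurableSpace Y]

/-- `ω + δ_x`. -/
def Config.add (ω : Config X) (x : X) : Config X :=
  ⟨ω.1 + Measure.dirac x, by
    have := ω.2.1
    exact ⟨inferInstance, ω.2.2.add (isCounting_dirac x)⟩⟩

/-- The restriction `ω ∩ S`. -/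
def Config.inter (ω : Config X) (S : Set X) : Config X :=
  ⟨ω.1.restrict S, by
    have := ω.2.1
    exact ⟨inferInstance, ω.2.2.restrict S⟩⟩

/-- The configuration `∑ i, δ_{p i}` of `m` points. -/
def ofPoints {m : ℕ} (p : Fin m → X) : Config X :=
  ⟨∑ i, Measure.dirac (p i), by
    refine ⟨?_, by simpa using isCounting_sum_smul_dirac (fun _ => 1) p⟩
    have : IsFiniteMeasure (∑ i, Measure.dirac (p i)) := inferInstance
    infer_instance⟩

/-- `ξ[ω] = ∑_{x ∈ ω} g(x, ω) δ_{f(x, ω)}` for the finite configuration `ω = ∑ i, δ_{p i}`; points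
are counted with multiplicity. -/
def xi (f : X → Config X → Y) (g : X → Config X → ℕ) {m : ℕ} (p : Fin m → X) : FinConfig Y :=
  ⟨∑ i, g (p i) (ofPoints p) • Measure.dirac (f (p i) (ofPoints p)), by
    refine ⟨⟨?_⟩, isCounting_sum_smul_dirac _ _⟩
    simp only [Measure.finsetSum_apply, Measure.smul_apply, nsmul_eq_mul]
    exact ENNReal.sum_lt_top.2 fun i _ =>
      ENNReal.mul_lt_top (ENNReal.natCast_lt_top _) (measure_lt_top _ _)⟩

/-- The law of a binomial point process of `m` independent points with distribution `Q`. The index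
is an integer: for `m < 0`, where there is no such process, this is the zero measure, so that all
expectations with respect to it vanish. -/
def binomialLaw (Q : Measure X) (m : ℤ) : Measure (Config X) :=
  if 0 ≤ m then (Measure.pi fun _ : Fin m.toNat => Q).map ofPoints else 0

end Configurations

section Distances

variable {Y : Type*} [MeasurableSpace Y]

/-- Total variation distance of measures:
`sup {|μ A - ν A| : A measurable, μ A < ∞, ν A < ∞}`. -/
def dTV (μ ν : Measure Y) : ℝ≥0∞ :=
  ⨆ (A : Set Y) (_ : MeasurableSet A ∧ μ A < ∞ ∧ ν A < ∞),
    ENNReal.ofReal |(μ A).toReal - (ν A).toReal|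

/-- Measurable functionals on finite counting measures which are `1`-Lipschitz for the total
variation distance. -/
def IsLip (h : FinConfig Y → ℝ) : Prop :=
  Measurable h ∧ ∀ ω₁ ω₂ : FinConfig Y, ENNReal.ofReal |h ω₁ - h ω₂| ≤ dTV ω₁.1 ω₂.1

/-- Kantorovich-Rubinstein distance of (the distributions of) two finite point processes, which may
live on different probability spaces. -/
def dKR {Ω Ω' : Type*} [MeasurableSpace Ω] [MeasurableSpace Ω'] (P : Measure Ω)
    (ξ : Ω → FinConfig Y) (P' : Measure Ω') (ζ : Ω' → FinConfig Y) : ℝ≥0∞ :=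
  ⨆ (h : FinConfig Y → ℝ) (_ : IsLip h),
    ENNReal.ofReal |(∫ ω, h (ξ ω) ∂P) - ∫ ω, h (ζ ω) ∂P'|

/-- `L` is the intensity measure of `ξ`. -/
def HasIntensity {Ω : Type*} [MeasurableSpace Ω] (P : Measure Ω) (ξ : Ω → FinConfig Y)
    (L : Measure Y) : Prop :=
  ∀ B, MeasurableSet B → L B = ∫⁻ ω, (ξ ω).1 B ∂P

/-- `ζ` is a Poisson process with (finite) intensity measure `M`: the number of points in `B` is
Poisson distributed with mean `M B`, and the numbers of points in finitely many pairwise disjoint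
sets are independent. -/
structure IsPoissonProcess {Ω : Type*} [MeasurableSpace Ω] (P : Measure Ω) (ζ : Ω → FinConfig Y)
    (M : Measure Y) : Prop where
  measurable : Measurable ζ
  count : ∀ B, MeasurableSet B →
    P.map (fun ω => (ζ ω).1 B) =
      (poissonMeasure (M B).toNNReal).map (fun k : ℕ => (k : ℝ≥0∞))
  indep : ∀ (m : ℕ) (B : Fin m → Set Y), (∀ i, MeasurableSet (B i)) →
    Pairwise (fun i j => Disjoint (B i) (B j)) →
    iIndepFun (fun i ω => (ζ ω).1 (B i)) P

end Distances

section Localization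

variable {X Y : Type*} [TopologicalSpace X] [MeasurableSpace X]

/-- The `σ`-algebra on the closed subsets of `X` generated by the sets `{F | F ∩ K ≠ ∅}` with `K`
compact. -/
@[reducible] def fellSigma (X : Type*) [TopologicalSpace X] : MeasurableSpace (Closeds X) :=
  MeasurableSpace.generateFrom
    {𝒜 | ∃ K : Set X, IsCompact K ∧ 𝒜 = {F : Closeds X | ((F : Set X) ∩ K).Nonempty}}

/-- `f` and `g` are localized to `𝒮`: for all `ω`, all points `x` of `ω` and all measurable
`B ⊇ 𝒮(x, ω)`, `g(x, ω) = g(x, ω ∩ B)`, and `f(x, ω) = f(x, ω ∩ B)` if `g(x, ω) = 1`. -/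
def IsLocalized (f : X → Config X → Y) (g : X → Config X → ℕ)
    (𝒮 : X → Config X → Closeds X) : Prop :=
  ∀ (ω : Config X) (x : X), ω.1 {x} ≠ 0 → ∀ B : Set X, MeasurableSet B →
    (𝒮 x ω : Set X) ⊆ B →
      g x ω = g x (ω.inter B) ∧ (g x ω = 1 → f x ω = f x (ω.inter B))

/-- The stopping property of `𝒮(x, ·)` at `B`:
`{ω | 𝒮(x, ω) ⊆ B} = {ω | 𝒮(x, ω ∩ B) ⊆ B}`. -/
def StoppingAt (𝒮 : X → Config X → Closeds X) (x : X) (B : Set X) : Prop :=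
  {ω : Config X | (𝒮 x ω : Set X) ⊆ B} = {ω : Config X | (𝒮 x (ω.inter B) : Set X) ⊆ B}

open Classical in
/-- The truncated functional `g̃(x, ω) = g(x, ω) 1{𝒮(x, ω) ⊆ S_x}`. -/
def trunc (g : X → Config X → ℕ) (𝒮 : X → Config X → Closeds X) (S : X → Closeds X)
    (x : X) (ω : Config X) : ℝ≥0∞ :=
  if (𝒮 x ω : Set X) ⊆ S x then (g x ω : ℝ≥0∞) else 0

open Classical in
/-- The complementary functional `g(x, ω) 1{𝒮(x, ω) ⊄ S_x}`. -/
def excess (g : X → Config X → ℕ) (𝒮 : X → Config X → Closeds X) (S : X → Closeds X)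
    (x : X) (ω : Config X) : ℝ≥0∞ :=
  if (𝒮 x ω : Set X) ⊆ S x then 0 else (g x ω : ℝ≥0∞)

end Localization

section Bounds

variable {X : Type*} [TopologicalSpace X] [MeasurableSpace X]

open Classical in
/-- `1{S_x ∩ S_y ≠ ∅}`. -/
def meet (S : X → Closeds X) (x y : X) : ℝ≥0∞ :=
  if ((S x : Set X) ∩ S y).Nonempty then 1 else 0

open Classical in
/-- `1{S_x ∩ S_y = ∅}`. -/
def apart (S : X → Closeds X) (x y : X) : ℝ≥0∞ :=
  if ((S x : Set X) ∩ S y).Nonempty then 0 else 1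

open Classical in
/-- `1{y ∈ S_x}`. -/
def inside (S : X → Closeds X) (x y : X) : ℝ≥0∞ :=
  if y ∈ (S x : Set X) then 1 else 0

/-- `Q_x = Q(· ∩ S_xᶜ) / Q(S_xᶜ)`. -/
def offLaw (Q : Measure X) (S : X → Closeds X) (x : X) : Measure X :=
  (Q (S x : Set X)ᶜ)⁻¹ • Q.restrict (S x : Set X)ᶜ

/- The six terms of the bound. Here `n - 1`, `n - 2`, `n - 3` are integers, and the index `β` of an
inner integral is a binomial process of that many points. -/

variable (Q : Measure X) (n : ℕ) (g : X → Config X → ℕ)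
  (𝒮 : X → Config X → Closeds X) (S : X → Closeds X)

def E₁ : ℝ≥0∞ :=
  2 * n * ∫⁻ x, (∫⁻ β, excess g 𝒮 S x (β.add x) ∂binomialLaw Q (n - 1)) ∂Q

def E₂ : ℝ≥0∞ :=
  2 * n ^ 2 * ∫⁻ z : X × X, meet S z.1 z.2
      * (∫⁻ β, trunc g 𝒮 S z.1 (β.add z.1) ∂binomialLaw Q (n - 1))
      * (∫⁻ β, trunc g 𝒮 S z.2 (β.add z.2) ∂binomialLaw Q (n - 1)) ∂(Q.prod Q)

def E₃ : ℝ≥0∞ :=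
  2 * n ^ 2 * ∫⁻ z : X × X, meet S z.1 z.2
      * (∫⁻ β, trunc g 𝒮 S z.1 ((β.add z.1).add z.2) * trunc g 𝒮 S z.2 ((β.add z.1).add z.2)
          ∂binomialLaw Q (n - 2)) ∂(Q.prod Q)

def E₄ : ℝ≥0∞ :=
  2 * n * ∫⁻ x,
      ((1 + n * Q (S x)) * (∫⁻ β, trunc g 𝒮 S x (β.add x) ∂binomialLaw Q (n - 1))
        + n * ∫⁻ z in (S x : Set X),
            (∫⁻ β, trunc g 𝒮 S x ((β.add x).add z) ∂binomialLaw Q (n - 2)) ∂Q)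
      * ((∫⁻ y, apart S x y
            * (∫⁻ β, trunc g 𝒮 S y (β.add y) ∂binomialLaw (offLaw Q S x) (n - 1))
            ∂offLaw Q S x)
        + n * ∫⁻ y : X × X, apart S x y.1 * inside S y.1 y.2
            * (∫⁻ β, trunc g 𝒮 S y.1 ((β.add y.1).add y.2)
                ∂binomialLaw (offLaw Q S x) (n - 2))
            ∂((offLaw Q S x).prod (offLaw Q S x))) ∂Q

def E₅ : ℝ≥0∞ :=
  2 * n ^ 3 * ∫⁻ z : X × X, apart S z.1 z.2
      * (∫⁻ β, trunc g 𝒮 S z.1 (β.add z.1) ∂binomialLaw Q (n - 1))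
      * (∫⁻ β, trunc g 𝒮 S z.2 (β.add z.2) ∂binomialLaw Q (n - 2))
      * Q (S z.1) * offLaw Q S z.1 (S z.2) ∂(Q.prod Q)

def E₆ : ℝ≥0∞ :=
  2 * n ^ 2 * (∫⁻ z : X × X, apart S z.1 z.2
      * (∫⁻ β, trunc g 𝒮 S z.1 (β.add z.1) * trunc g 𝒮 S z.2 (β.add z.2)
          ∂binomialLaw Q (n - 2))
      * offLaw Q S z.1 (S z.2) ∂(Q.prod Q))
  + 2 * n ^ 3 * ∫⁻ z : X × X, (∫⁻ w in (S z.1 : Set X), apart S z.1 z.2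
      * (∫⁻ β, trunc g 𝒮 S z.1 ((β.add z.1).add w) * trunc g 𝒮 S z.2 (β.add z.2)
          ∂binomialLaw Q (n - 3))
      * offLaw Q S z.1 (S z.2) ∂Q) ∂(Q.prod Q)

end Bounds

end PoissonApprox

end

/-!
The bound is proved by Stein's method for Poisson processes, in the form of an interpolation, and a
coupling that resamples the points inside `S_x`.

*Interpolation.* Let `h` be a Lipschitz functional, `ξ'` a finite point process and `M` the
intensity measure of the Poisson process `ζ`. The superposition of an independent `t`-thinning of
`ξ'` and of a Poisson process with intensity measure `(1 - t) M` interpolates between `ζ` and `ξ'`.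
By the mean value theorem there is a `t` for which `E h(ξ') - E h(ζ)` is the derivative of the
expectation of `h` along this path. This derivative is
`E [∑ z ∈ ξ', F z (ξ' - δ_z) - ∫ F z ξ' M(dz)]`, where `F z η` is the expected effect on `h` of an
additional point at `z` (`hasDerivAt_interpolation`, `exists_stein_function`). The function `F` is
bounded by `1`, its values at two points `z`, `z'` differ by at most `1`, and a change of a single
point of `η` changes it by at most `2`. With `G z = E [F z ξ']` the derivative splits into the
difference of the integrals of `G` with respect to the intensity measure of `ξ'` and to `M`, which
is at most their total variation distance, and into one term
`E [1{z ∈ ξ'} (F z (ξ' - δ_z) - G z)]` for each point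
(`exists_ofReal_abs_integral_sub_poissonLaw_le`). That `ζ` is a Poisson process in the sense of
counts over disjoint sets determines its law, by exponential moments (`IsPoissonProcess.map_eq`).

*Truncation.* This is applied to the process `ξ'` with weights `g̃` in place of `g`. The
replacement of `ξ` by `ξ'` costs half of `E₁` in the expectation of `h` and another half in the
intensity measure (`ofReal_abs_integral_xi_sub_le`, `dTV_intensity_le`). By localization and the
stopping property at `S_x`, the value `g̃(x, ω)` and the mark of a contributing point `x` depend
only on the points of `ω` in `S_x` (`truncNat_congr`).

*Coupling.* Fix one of the `n` points at `x`. If every point inside `S_x` is replaced by an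
independent point with law `Q_x`, then the new configuration consists of `n` independent points with
law `Q_x` and is independent of the points inside `S_x`, in particular of the weight and the mark of
`x` (`measurePreserving_resample_update`). In the new configuration, only the points `y` with `S_y`
disjoint from `S_x` are retained. The same resampling applied to an independent copy of the process
has the same outcome, hence `E [1{z ∈ ξ'} (F z (ξ' - δ_z) - G z)]` is bounded by twice the expected
number of points changed by the two resamplings (`ofReal_abs_integral_shift_le`). A point `y` changes
only if `S_y` meets `S_x` (terms `E₂`, `E₃`), if a replaced point lands in `S_y` (terms `E₅`, `E₆`),
or if `y` contributes to the new configuration and is itself a replaced point or has a replaced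
point in `S_y` (term `E₄`); see `one_le_cost_of_mismatch`. The expected numbers of changed points
are computed in `lintegral_cost_le` and `lintegral_cost_update_le`.
-/

noncomputable section

namespace PoissonApprox

/-! ### Measurability of relations between random closed sets -/

section Fell

variable {X : Type*} [TopologicalSpace X] {T : Type*} [MeasurableSpace T]

theorem measurableSet_hit_compact {F : T → Closeds X}
    (hF : Measurable[inferInstance, fellSigma X] F)
    {K : Set X} (hK : IsCompact K) : MeasurableSet {t | ((F t : Set X) ∩ K).Nonempty} :=
  hF (MeasurableSpace.measurableSet_generateFrom ⟨K, hK, rfl⟩)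

variable [LocallyCompactSpace X] [SecondCountableTopology X]

theorem measurableSet_hit_open {F : T → Closeds X} (hF : Measurable[inferInstance, fellSigma X] F)
    {U : Set X} (hU : IsOpen U) : MeasurableSet {t | ((F t : Set X) ∩ U).Nonempty} := by
  have hσ : IsSigmaCompact U := by
    have := hU.locallyCompactSpace
    exact isSigmaCompact_iff_sigmaCompactSpace.2 inferInstance
  obtain ⟨K, hK, rfl⟩ := hσ
  simp only [Set.inter_iUnion, Set.nonempty_iUnion, Set.ofPred_exists]
  exact MeasurableSet.iUnion fun i => measurableSet_hit_compact hF (hK i)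

theorem measurableSet_closeds_subset {F G : T → Closeds X}
    (hF : Measurable[inferInstance, fellSigma X] F)
    (hG : Measurable[inferInstance, fellSigma X] G) :
    MeasurableSet {t | (F t : Set X) ⊆ G t} := by
  have h : {t | (F t : Set X) ⊆ G t} = ⋂ U ∈ countableBasis X,
      ({t | ((F t : Set X) ∩ U).Nonempty}ᶜ ∪ {t | ((G t : Set X) ∩ U).Nonempty}) := by
    ext t
    simp only [Set.mem_ofPred_eq, Set.mem_iInter, Set.mem_union, Set.mem_compl_iff]
    constructor
    · intro h U _
      by_cases hU : ((F t : Set X) ∩ U).Nonempty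
      · exact Or.inr (hU.mono (Set.inter_subset_inter_left _ h))
      · exact Or.inl hU
    · intro h x hx
      rw [← (G t).isClosed.closure_eq, (isBasis_countableBasis X).mem_closure_iff]
      intro U hU hxU
      rw [Set.inter_comm]
      exact (h U hU).resolve_left fun h' => h' ⟨x, hx, hxU⟩
  rw [h]
  refine MeasurableSet.biInter (countable_countableBasis X) fun U hU => ?_
  have hUo := isOpen_of_mem_countableBasis hU
  exact (measurableSet_hit_open hF hUo).compl.union (measurableSet_hit_open hG hUo)

theorem measurableSet_mem_closeds [MeasurableSpace X] [BorelSpace X] {F : T → Closeds X}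
    (hF : Measurable[inferInstance, fellSigma X] F) {y : T → X} (hy : Measurable y) :
    MeasurableSet {t | y t ∈ F t} := by
  have h : {t | y t ∈ F t} = ⋂ U ∈ countableBasis X,
      ((y ⁻¹' U)ᶜ ∪ {t | ((F t : Set X) ∩ U).Nonempty}) := by
    ext t
    simp only [Set.mem_ofPred_eq, Set.mem_iInter, Set.mem_union, Set.mem_compl_iff,
      Set.mem_preimage]
    constructor
    · intro h U _
      by_cases hU : y t ∈ U
      · exact Or.inr ⟨y t, h, hU⟩
      · exact Or.inl hU
    · intro h
      change y t ∈ (F t : Set X)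
      rw [← (F t).isClosed.closure_eq, (isBasis_countableBasis X).mem_closure_iff]
      intro U hU hxU
      rw [Set.inter_comm]
      exact (h U hU).resolve_left fun h' => h' hxU
  rw [h]
  refine MeasurableSet.biInter (countable_countableBasis X) fun U hU => ?_
  have hUo := isOpen_of_mem_countableBasis hU
  exact (hy hUo.measurableSet).compl.union (measurableSet_hit_open hF hUo)

/-- Disjointness inside a compact set `K` is witnessed by a finite union `U` of basic open sets that
covers `G ∩ K` and whose closure misses `F ∩ K`; there are countably many such unions. -/
theorem measurableSet_closeds_meet [T2Space X] {F G : T → Closeds X}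
    (hF : Measurable[inferInstance, fellSigma X] F)
    (hG : Measurable[inferInstance, fellSigma X] G) :
    MeasurableSet {t | ((F t : Set X) ∩ G t).Nonempty} := by
  have hloc : ∀ K : Set X, IsCompact K →
      MeasurableSet {t | ((F t : Set X) ∩ G t ∩ K).Nonempty} := by
    intro K hK
    have h : {t | ((F t : Set X) ∩ G t ∩ K).Nonempty}ᶜ =
        ⋃ s ∈ {s : Set (Set X) | s.Finite ∧ s ⊆ countableBasis X},
          ({t | ((F t : Set X) ∩ (K ∩ closure (⋃₀ s))).Nonempty}ᶜ ∩
            {t | ((G t : Set X) ∩ (K \ ⋃₀ s)).Nonempty}ᶜ) := by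
      ext t
      simp only [Set.mem_compl_iff, Set.mem_ofPred_eq, Set.mem_iUnion, Set.mem_inter_iff,
        Set.not_nonempty_iff_eq_empty, exists_prop]
      constructor
      · intro h
        have hd : Disjoint (K ∩ (G t : Set X)) (K ∩ (F t : Set X)) := by
          rw [Set.disjoint_iff_inter_eq_empty, ← h]
          ext x; simp only [Set.mem_inter_iff]; tauto
        obtain ⟨U, V, hU, hV, hGU, hFV, hUV⟩ :=
          SeparatedNhds.of_isCompact_isCompact (hK.inter_right (G t).isClosed)
            (hK.inter_right (F t).isClosed) hd
        obtain ⟨s, hs, hGs, hsU⟩ : ∃ s : Set (Set X), (s.Finite ∧ s ⊆ countableBasis X) ∧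
            K ∩ (G t : Set X) ⊆ ⋃₀ s ∧ ⋃₀ s ⊆ U := by
          obtain ⟨S', hS', hUS⟩ := (isBasis_countableBasis X).open_eq_sUnion hU
          obtain ⟨s, hsS, hfin, hcov⟩ := (hK.inter_right (G t).isClosed).elim_finite_subcover_image
            (b := S') (c := id) (fun V hV => isOpen_of_mem_countableBasis (hS' hV))
            (by simpa [← Set.sUnion_eq_biUnion, ← hUS] using hGU)
          refine ⟨s, ⟨hfin, hsS.trans hS'⟩, ?_, hUS ▸ Set.sUnion_subset_sUnion hsS⟩
          simpa [Set.sUnion_eq_biUnion] using hcov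
        refine ⟨s, hs, ?_, ?_⟩
        · rw [Set.eq_empty_iff_forall_notMem]
          rintro x ⟨hxF, hxK, hxc⟩
          have := (hUV.mono_left hsU).closure_left hV
          exact Set.disjoint_left.1 this hxc (hFV ⟨hxK, hxF⟩)
        · rw [Set.eq_empty_iff_forall_notMem]
          rintro x ⟨hxG, hxK, hxs⟩
          exact hxs (hGs ⟨hxK, hxG⟩)
      · rintro ⟨s, -, h1, h2⟩
        rw [Set.eq_empty_iff_forall_notMem] at h1 h2 ⊢
        rintro x ⟨⟨hxF, hxG⟩, hxK⟩
        by_cases hxs : x ∈ ⋃₀ s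
        · exact h1 x ⟨hxF, hxK, subset_closure hxs⟩
        · exact h2 x ⟨hxG, hxK, hxs⟩
    rw [← MeasurableSet.compl_iff, h]
    refine MeasurableSet.biUnion
      (Set.countable_ofPred_finite_subset (countable_countableBasis X))
      fun s hs => ?_
    have hso : IsOpen (⋃₀ s) :=
      isOpen_sUnion fun V hV => isOpen_of_mem_countableBasis (hs.2 hV)
    exact (measurableSet_hit_compact hF (hK.inter_right isClosed_closure)).compl.inter
      (measurableSet_hit_compact hG (hK.diff hso)).compl
  have : {t | ((F t : Set X) ∩ G t).Nonempty} =
      ⋃ i : ℕ, {t | ((F t : Set X) ∩ G t ∩ compactCovering X i).Nonempty} := by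
    ext t
    simp only [Set.mem_ofPred_eq, Set.mem_iUnion, ← Set.nonempty_iUnion, ← Set.inter_iUnion,
      iUnion_compactCovering, Set.inter_univ]
  rw [this]
  exact MeasurableSet.iUnion fun i => hloc _ (isCompact_compactCovering X i)

end Fell

/-! ### Finite point configurations -/

section FiniteConfigurations

variable {Y : Type*} [MeasurableSpace Y]

instance (ω : FinConfig Y) : IsFiniteMeasure ω.1 := ω.2.1

/-- The finite configuration `∑ i, c i • δ_{y i}`. -/
def weighted {m : ℕ} (c : Fin m → ℕ) (y : Fin m → Y) : FinConfig Y :=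
  ⟨∑ i, c i • Measure.dirac (y i), by
    refine ⟨⟨?_⟩, isCounting_sum_smul_dirac _ _⟩
    simp only [Measure.finsetSum_apply, Measure.smul_apply, nsmul_eq_mul]
    exact ENNReal.sum_lt_top.2 fun i _ =>
      ENNReal.mul_lt_top (ENNReal.natCast_lt_top _) (measure_lt_top _ _)⟩

/-- The superposition of two finite configurations. -/
def FinConfig.sup (ω η : FinConfig Y) : FinConfig Y :=
  ⟨ω.1 + η.1, inferInstance, ω.2.2.add η.2.2⟩

/-- The finite configuration `∑ i, δ_{y i}`. -/
def points {m : ℕ} (y : Fin m → Y) : FinConfig Y := weighted (fun _ => 1) y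

/-- The configuration with the single point `y`. -/
def single (y : Y) : FinConfig Y := ⟨Measure.dirac y, inferInstance, isCounting_dirac y⟩

theorem FinConfig.ext {ω η : FinConfig Y} (h : ∀ B, MeasurableSet B → ω.1 B = η.1 B) : ω = η :=
  Subtype.ext (Measure.ext h)

theorem weighted_apply {m : ℕ} (c : Fin m → ℕ) (y : Fin m → Y) {B : Set Y}
    (hB : MeasurableSet B) :
    (weighted c y).1 B = ∑ i, (c i : ℝ≥0∞) * B.indicator 1 (y i) := by
  simp [weighted, Measure.finsetSum_apply, Measure.dirac_apply' _ hB]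

theorem FinConfig.sup_apply (ω η : FinConfig Y) (B : Set Y) : (ω.sup η).1 B = ω.1 B + η.1 B := by
  simp [FinConfig.sup]

theorem single_apply (y : Y) {B : Set Y} (hB : MeasurableSet B) :
    (single y).1 B = B.indicator 1 y := Measure.dirac_apply' _ hB

theorem FinConfig.sup_assoc (ω η θ : FinConfig Y) : (ω.sup η).sup θ = ω.sup (η.sup θ) :=
  Subtype.ext (add_assoc _ _ _)

theorem measurable_finConfig_iff {T : Type*} [MeasurableSpace T] {F : T → FinConfig Y} :
    Measurable F ↔ ∀ B, MeasurableSet B → Measurable fun t => (F t).1 B := by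
  constructor
  · intro h B hB
    exact (Measure.measurable_coe hB).comp (measurable_subtype_coe.comp h)
  · intro h
    exact Measurable.subtype_mk (Measure.measurable_of_measurable_coe _ h)

theorem measurable_finConfig_apply {B : Set Y} (hB : MeasurableSet B) :
    Measurable fun ω : FinConfig Y => ω.1 B :=
  measurable_finConfig_iff.1 measurable_id B hB

@[fun_prop]
theorem Measurable.finConfig_sup {T : Type*} [MeasurableSpace T] {F G : T → FinConfig Y}
    (hF : Measurable F) (hG : Measurable G) : Measurable fun t => (F t).sup (G t) := by
  rw [measurable_finConfig_iff]
  intro B hB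
  simp only [FinConfig.sup_apply]
  exact (measurable_finConfig_iff.1 hF B hB).add (measurable_finConfig_iff.1 hG B hB)

@[fun_prop]
theorem measurable_single : Measurable (single : Y → FinConfig Y) := by
  rw [measurable_finConfig_iff]
  intro B hB
  simp only [single_apply _ hB]
  exact measurable_one.indicator hB

@[fun_prop]
theorem Measurable.weighted {T : Type*} [MeasurableSpace T] {m : ℕ} {c : T → Fin m → ℕ}
    {y : T → Fin m → Y} (hc : Measurable c) (hy : Measurable y) :
    Measurable fun t => weighted (c t) (y t) := by
  rw [measurable_finConfig_iff]
  intro B hB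
  simp only [weighted_apply _ _ hB]
  refine Finset.measurable_fun_sum _ fun i _ => Measurable.mul ?_ ?_
  · exact measurable_from_nat.comp ((measurable_pi_apply i).comp hc)
  · exact (measurable_one.indicator hB).comp ((measurable_pi_apply i).comp hy)

@[fun_prop]
theorem measurable_points {m : ℕ} : Measurable (points : (Fin m → Y) → FinConfig Y) :=
  Measurable.weighted measurable_const measurable_id

/-- Finite measures on the space of finite configurations are determined by the joint laws of the
numbers of points in finitely many sets. -/
theorem finConfig_measure_ext {μ ν : Measure (FinConfig Y)} [IsFiniteMeasure μ] [IsFiniteMeasure ν]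
    (h : ∀ J : Finset {B : Set Y // MeasurableSet B},
      μ.map (fun ω (B : J) => (ω.1 B.1.1).toReal) = ν.map (fun ω (B : J) => (ω.1 B.1.1).toReal)) :
    μ = ν := by
  let e : FinConfig Y → ({B : Set Y // MeasurableSet B} → ℝ) := fun ω B => (ω.1 B.1).toReal
  have he : Measurable e := measurable_pi_lambda _ fun B =>
    (measurable_finConfig_apply B.2).ennreal_toReal
  have hmap : μ.map e = ν.map e := by
    refine IsProjectiveLimit.unique (P := fun J => (μ.map e).map J.restrict) (fun _ => rfl) ?_
    intro J
    change (ν.map e).map J.restrict = (μ.map e).map J.restrict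
    have hJ : Measurable (J.restrict : ({B : Set Y // MeasurableSet B} → ℝ) → _) := by fun_prop
    rw [Measure.map_map hJ he, Measure.map_map hJ he]
    exact (h J).symm
  ext A hA
  have hle : (inferInstance : MeasurableSpace (FinConfig Y)) ≤ MeasurableSpace.comap e inferInstance := by
    have h1 : Measurable[MeasurableSpace.comap e inferInstance] (fun ω : FinConfig Y => ω.1) := by
      refine @Measure.measurable_of_measurable_coe _ _ _ (_) _ fun B hB => ?_
      have h2 : (fun ω : FinConfig Y => ω.1 B) =
          (fun v : {B : Set Y // MeasurableSet B} → ℝ => ENNReal.ofReal (v ⟨B, hB⟩)) ∘ e := by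
        funext ω
        exact (ENNReal.ofReal_toReal (measure_ne_top _ _)).symm
      rw [h2]
      exact (ENNReal.measurable_ofReal.comp (measurable_pi_apply _)).comp (comap_measurable e)
    exact h1.comap_le
  obtain ⟨C, hC, rfl⟩ := hle A hA
  rw [← Measure.map_apply he hC, ← Measure.map_apply he hC, hmap]

/-- Finite measures on the space of finite configurations are determined by the joint
characteristic functions of the numbers of points in finitely many sets. -/
theorem finConfig_measure_ext_of_exp {μ ν : Measure (FinConfig Y)} [IsFiniteMeasure μ]
    [IsFiniteMeasure ν]
    (h : ∀ (J : Finset {B : Set Y // MeasurableSet B}) (t : J → ℝ),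
      ∫ ω, Complex.exp ((∑ B : J, t B * (ω.1 B.1.1).toReal : ℝ) * Complex.I) ∂μ =
      ∫ ω, Complex.exp ((∑ B : J, t B * (ω.1 B.1.1).toReal : ℝ) * Complex.I) ∂ν) :
    μ = ν := by
  refine finConfig_measure_ext fun J => ?_
  have he : Measurable fun (ω : FinConfig Y) (B : J) => (ω.1 B.1.1).toReal :=
    measurable_pi_lambda _ fun B => (measurable_finConfig_apply B.1.2).ennreal_toReal
  refine Measure.ext_of_charFunDual ?_
  funext Λ
  rw [charFunDual_apply, charFunDual_apply, integral_map he.aemeasurable (by fun_prop),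
    integral_map he.aemeasurable (by fun_prop)]
  obtain ⟨a, ha⟩ : ∃ a : J → ℝ, ∀ v : J → ℝ, Λ v = ∑ B : J, a B * v B := by
    refine ⟨fun B => Λ (Pi.single B 1), fun v => ?_⟩
    have := LinearMap.pi_apply_eq_sum_univ (Λ : (J → ℝ) →ₗ[ℝ] ℝ) v
    simp only [ContinuousLinearMap.coe_coe, smul_eq_mul] at this
    rw [this]
    refine Finset.sum_congr rfl fun B _ => ?_
    rw [mul_comm]
    congr 2
    funext B'
    simp [Pi.single_apply, eq_comm]
  simp only [ha]
  exact h J a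

/-! ### The law of a Poisson process -/

/-- The law of the Poisson process with intensity measure `M`, as a mixture over the number of
points: `∑ k, e^{-m} / k! • law of (y ↦ ∑ i, δ_{y i}) under M^k`, with `m = M univ`. No
normalisation of `M` is needed, since `M^k` has total mass `m^k`. -/
def poissonLaw (M : Measure Y) : Measure (FinConfig Y) :=
  Measure.sum fun k : ℕ => ENNReal.ofReal (Real.exp (-M.real Set.univ) / k.factorial) •
    (Measure.pi fun _ : Fin k => M).map points

variable (M : Measure Y)

/-- The integral of `h` with respect to the law of the Poisson process, as a series over the number
of points. -/
theorem hasSum_integral_poissonLaw {E : Type*} [NormedAddCommGroup E] [NormedSpace ℝ E]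
    [CompleteSpace E] {h : FinConfig Y → E} (hm : StronglyMeasurable h)
    (hi : Integrable h (poissonLaw M)) :
    HasSum (fun k : ℕ => (Real.exp (-M.real Set.univ) / k.factorial) •
      ∫ y, h (points y) ∂(Measure.pi fun _ : Fin k => M)) (∫ ω, h ω ∂poissonLaw M) := by
  have hs := hasSum_integral_measure hi
  simp only [integral_smul_measure, integral_map measurable_points.aemeasurable
    hm.aestronglyMeasurable] at hs
  have hw : ∀ k : ℕ, (ENNReal.ofReal (Real.exp (-M.real Set.univ) / k.factorial)).toReal =
      Real.exp (-M.real Set.univ) / k.factorial :=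
    fun k => ENNReal.toReal_ofReal (by positivity)
  simp only [hw] at hs
  exact hs

variable [IsFiniteMeasure M]

theorem measureReal_pi_univ (k : ℕ) :
    (Measure.pi fun _ : Fin k => M).real Set.univ = M.real Set.univ ^ k := by
  rw [Measure.real, Measure.pi_univ, Finset.prod_const, Finset.card_univ, Fintype.card_fin,
    ENNReal.toReal_pow, Measure.real]

instance : IsFiniteMeasure (poissonLaw M) := by
  constructor
  have h : ∀ k : ℕ, (ENNReal.ofReal (Real.exp (-M.real Set.univ) / k.factorial) •
      (Measure.pi fun _ : Fin k => M).map points) (Set.univ : Set (FinConfig Y)) =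
      ENNReal.ofReal (Real.exp (-M.real Set.univ) * (M.real Set.univ ^ k / k.factorial)) := by
    intro k
    rw [Measure.smul_apply, Measure.map_apply measurable_points MeasurableSet.univ,
      Set.preimage_univ, smul_eq_mul, ← ENNReal.ofReal_toReal (measure_ne_top _ Set.univ),
      ← Measure.real, measureReal_pi_univ, ← ENNReal.ofReal_mul (by positivity)]
    congr 1
    ring
  rw [poissonLaw, Measure.sum_apply _ MeasurableSet.univ]
  simp only [h]
  rw [← ENNReal.ofReal_tsum_of_nonneg (fun _ => by positivity)
    ((Real.summable_pow_div_factorial _).mul_left _)]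
  exact ENNReal.ofReal_lt_top

theorem integrable_poissonLaw {E : Type*} [NormedAddCommGroup E]
    {h : FinConfig Y → E} (hm : StronglyMeasurable h) {C : ℝ}
    (hb : ∀ (k : ℕ) (y : Fin k → Y), ‖h (points y)‖ ≤ C + k) :
    Integrable h (poissonLaw M) := by
  have hbound : ∀ k : ℕ, ∀ᵐ y ∂(Measure.pi fun _ : Fin k => M), ‖‖h (points y)‖‖ ≤ C + k :=
    fun k => Filter.Eventually.of_forall fun y => by simpa using hb k y
  refine integrable_sum_measure (fun k => ?_) ?_
  · refine Integrable.smul_measure ?_ ENNReal.ofReal_ne_top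
    rw [integrable_map_measure hm.aestronglyMeasurable measurable_points.aemeasurable]
    exact Integrable.of_bound (hm.comp_measurable measurable_points).aestronglyMeasurable (C + k)
      (Filter.Eventually.of_forall fun y => hb k y)
  · have hs : Summable fun k : ℕ => Real.exp (-M.real Set.univ) *
        (C * (M.real Set.univ ^ k / k.factorial) +
          k * (M.real Set.univ ^ k / k.factorial)) := by
      refine Summable.mul_left _ (((Real.summable_pow_div_factorial _).mul_left _).add ?_)
      rw [← summable_nat_add_iff 1]
      refine ((Real.summable_pow_div_factorial (M.real Set.univ)).mul_left
        (M.real Set.univ)).congr fun k => ?_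
      have : ((k : ℝ) + 1) ≠ 0 := by positivity
      rw [Nat.factorial_succ]
      push_cast
      rw [pow_succ]
      field_simp
    refine Summable.of_nonneg_of_le (fun _ => integral_nonneg fun _ => norm_nonneg _) (fun k => ?_) hs
    rw [integral_smul_measure, integral_map measurable_points.aemeasurable
      hm.norm.aestronglyMeasurable, ENNReal.toReal_ofReal (by positivity), smul_eq_mul]
    have h1 := norm_integral_le_of_norm_le_const (hbound k)
    rw [measureReal_pi_univ] at h1
    have h2 := (le_abs_self _).trans h1
    calc _ ≤ Real.exp (-M.real Set.univ) / k.factorial * ((C + k) * M.real Set.univ ^ k) := by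
          gcongr
      _ = _ := by ring

/-- The linear statistic `∑ B, t B • ω B` of a configuration `∑ i, δ_{y i}`. -/
theorem sum_points_eq (J : Finset {B : Set Y // MeasurableSet B}) (t : J → ℝ) {k : ℕ}
    (y : Fin k → Y) :
    (∑ B : J, t B * ((points y).1 B.1.1).toReal : ℝ) =
      ∑ i, ∑ B : J, t B * B.1.1.indicator 1 (y i) := by
  rw [Finset.sum_comm]
  refine Finset.sum_congr rfl fun B _ => ?_
  rw [points, weighted_apply _ _ B.1.2, ENNReal.toReal_sum fun i _ => by
    by_cases h : y i ∈ B.1.1 <;> simp [h], Finset.mul_sum]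
  refine Finset.sum_congr rfl fun i _ => ?_
  by_cases h : y i ∈ B.1.1 <;> simp [h]

theorem integral_exp_poissonLaw (J : Finset {B : Set Y // MeasurableSet B}) (t : J → ℝ) :
    ∫ ω, Complex.exp ((∑ B : J, t B * (ω.1 B.1.1).toReal : ℝ) * Complex.I) ∂poissonLaw M =
      Complex.exp (∫ y, (Complex.exp ((∑ B : J, t B * B.1.1.indicator 1 y : ℝ) * Complex.I) - 1)
        ∂M) := by
  have hm : StronglyMeasurable fun ω : FinConfig Y =>
      Complex.exp ((∑ B : J, t B * (ω.1 B.1.1).toReal : ℝ) * Complex.I) := by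
    refine Measurable.stronglyMeasurable ?_
    have : Measurable fun ω : FinConfig Y => (∑ B : J, t B * (ω.1 B.1.1).toReal : ℝ) :=
      Finset.measurable_fun_sum _ fun B _ =>
        (measurable_finConfig_apply B.1.2).ennreal_toReal.const_mul _
    fun_prop
  have hi := integrable_poissonLaw M hm (C := 1) (fun k y => by
    rw [Complex.norm_exp_ofReal_mul_I]; simp)
  have hs := hasSum_integral_poissonLaw M hm hi
  set ψ : Y → ℂ := fun y => Complex.exp ((∑ B : J, t B * B.1.1.indicator 1 y : ℝ) * Complex.I)
    with hψ
  have hψm : Measurable ψ := by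
    have : Measurable fun y : Y => (∑ B : J, t B * B.1.1.indicator 1 y : ℝ) :=
      Finset.measurable_fun_sum _ fun B _ => (measurable_one.indicator B.1.2).const_mul _
    fun_prop
  have hψi : Integrable ψ M := Integrable.of_bound hψm.aestronglyMeasurable 1
    (Filter.Eventually.of_forall fun y => by rw [hψ, Complex.norm_exp_ofReal_mul_I])
  have hk : ∀ k : ℕ, ∫ y : Fin k → Y, Complex.exp
      ((∑ B : J, t B * ((points y).1 B.1.1).toReal : ℝ) * Complex.I)
        ∂(Measure.pi fun _ : Fin k => M) = (∫ y, ψ y ∂M) ^ k := by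
    intro k
    have := integral_fintype_prod_eq_pow (ι := Fin k) (μ := M) ψ
    rw [Fintype.card_fin] at this
    rw [← this]
    refine integral_congr_ae (Filter.Eventually.of_forall fun y => ?_)
    simp only [sum_points_eq, hψ]
    rw [← Complex.exp_sum]
    push_cast
    rw [Finset.sum_mul]
  simp only [hk] at hs
  rw [← hs.tsum_eq]
  have hexp : ∫ y, (ψ y - 1) ∂M = -(M.real Set.univ : ℂ) + ∫ y, ψ y ∂M := by
    rw [integral_sub hψi (integrable_const _)]
    simp
    ring
  rw [hexp, Complex.exp_add]
  have h2 := (NormedSpace.expSeries_div_hasSum_exp (𝔸 := ℂ) (∫ y, ψ y ∂M)).mul_left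
    (Complex.exp (-(M.real Set.univ : ℂ)))
  rw [← Complex.exp_eq_exp_ℂ] at h2
  rw [← h2.tsum_eq]
  refine tsum_congr fun k => ?_
  rw [Complex.real_smul]
  push_cast
  ring

/-- For a Poisson process, the same formula follows by splitting the space into the atoms of the
finite algebra generated by the sets `B ∈ J`. -/
theorem integral_exp_isPoissonProcess {Ω : Type*} [MeasurableSpace Ω] (P : Measure Ω)
    [IsProbabilityMeasure P] {ζ : Ω → FinConfig Y} (hζ : IsPoissonProcess P ζ M)
    (J : Finset {B : Set Y // MeasurableSet B}) (t : J → ℝ) :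
    ∫ ω, Complex.exp ((∑ B : J, t B * ((ζ ω).1 B.1.1).toReal : ℝ) * Complex.I) ∂P =
      Complex.exp (∫ y, (Complex.exp ((∑ B : J, t B * B.1.1.indicator 1 y : ℝ) * Complex.I) - 1)
        ∂M) := by
  classical
  let N := Fintype.card (J → Bool)
  let e : Fin N ≃ (J → Bool) := (Fintype.equivFin _).symm
  let A : Fin N → Set Y := fun i => {y | ∀ B : J, (y ∈ B.1.1 ↔ e i B = true)}
  let τ : Fin N → ℝ := fun i => ∑ B : J, t B * (if e i B then 1 else 0)
  have hA : ∀ i, MeasurableSet (A i) := by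
    intro i
    have : A i = ⋂ B : J, (if e i B then B.1.1 else B.1.1ᶜ) := by
      ext y
      simp only [A, Set.mem_ofPred_eq, Set.mem_iInter]
      refine forall_congr' fun B => ?_
      by_cases h : e i B = true <;> simp [h]
    rw [this]
    refine MeasurableSet.iInter fun B => ?_
    split_ifs
    · exact B.1.2
    · exact B.1.2.compl
  have hdisj : Pairwise fun i j => Disjoint (A i) (A j) := by
    intro i j hij
    rw [Set.disjoint_left]
    intro y hi hj
    refine hij (e.injective (funext fun B => ?_))
    have := (hi B).symm.trans (hj B)
    exact Bool.eq_iff_iff.2 this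
  have hcover : ∀ y, ∃ i, y ∈ A i := fun y =>
    ⟨e.symm fun B => decide (y ∈ B.1.1), fun B => by simp⟩
  have hB : ∀ (ω : FinConfig Y) (B : J),
      (ω.1 B.1.1).toReal = ∑ i, (if e i B then 1 else 0) * (ω.1 (A i)).toReal := by
    intro ω B
    have h1 : B.1.1 = ⋃ i ∈ Finset.univ.filter (fun i => e i B = true), A i := by
      ext y
      simp only [Finset.mem_filter, Finset.mem_univ, true_and, Set.mem_iUnion, exists_prop]
      constructor
      · intro hy
        obtain ⟨i, hi⟩ := hcover y
        exact ⟨i, (hi B).1 hy, hi⟩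
      · rintro ⟨i, hi, hy⟩
        exact (hy B).2 hi
    conv_lhs => rw [h1]
    rw [measure_biUnion_finset (fun i _ j _ hij => hdisj hij) fun i _ => hA i,
      ENNReal.toReal_sum fun i _ => measure_ne_top _ _, Finset.sum_filter]
    exact Finset.sum_congr rfl fun i _ => by split_ifs <;> simp
  have hsum : ∀ ω : FinConfig Y, (∑ B : J, t B * (ω.1 B.1.1).toReal : ℝ) =
      ∑ i, τ i * (ω.1 (A i)).toReal := by
    intro ω
    simp only [hB, τ, Finset.mul_sum, Finset.sum_mul]
    rw [Finset.sum_comm]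
    exact Finset.sum_congr rfl fun i _ => Finset.sum_congr rfl fun B _ => by ring
  have hζm : ∀ i, Measurable fun ω => (ζ ω).1 (A i) := fun i =>
    measurable_finConfig_iff.1 hζ.measurable _ (hA i)
  have hfm : ∀ i, Measurable fun r : ℝ≥0∞ => Complex.exp ((τ i * r.toReal : ℝ) * Complex.I) := by
    intro i
    have : Measurable fun r : ℝ≥0∞ => τ i * r.toReal := measurable_id.ennreal_toReal.const_mul _
    fun_prop
  have hprod := (hζ.indep N A hA hdisj).integral_fun_prod_comp
    (f := fun i (r : ℝ≥0∞) => Complex.exp ((τ i * r.toReal : ℝ) * Complex.I))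
    (fun i => (hζm i).aemeasurable) (fun i => (hfm i).aestronglyMeasurable)
  have hL : ∀ ω, Complex.exp ((∑ B : J, t B * ((ζ ω).1 B.1.1).toReal : ℝ) * Complex.I) =
      ∏ i, Complex.exp ((τ i * ((ζ ω).1 (A i)).toReal : ℝ) * Complex.I) := by
    intro ω
    rw [hsum, ← Complex.exp_sum]
    push_cast
    rw [Finset.sum_mul]
  simp only [hL]
  rw [hprod]
  have hone : ∀ i, ∫ ω, Complex.exp ((τ i * ((ζ ω).1 (A i)).toReal : ℝ) * Complex.I) ∂P =
      Complex.exp ((M.real (A i) : ℂ) * (Complex.exp (τ i * Complex.I) - 1)) := by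
    intro i
    have h1 := integral_map (μ := P) (hζm i).aemeasurable
      (f := fun r : ℝ≥0∞ => Complex.exp ((τ i * r.toReal : ℝ) * Complex.I))
      (hfm i).aestronglyMeasurable
    rw [← h1, hζ.count _ (hA i), integral_map (measurable_from_nat).aemeasurable
      (hfm i).aestronglyMeasurable]
    have h2 := charFun_map_cast_poissonMeasure (M (A i)).toNNReal (τ i)
    rw [charFun_apply, integral_map .of_discrete (by fun_prop)] at h2
    simp only [Real.inner_apply] at h2
    have h3 : (((M (A i)).toNNReal : ℝ) : ℂ) = (M.real (A i) : ℂ) := rfl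
    rw [← h3]
    refine Eq.trans ?_ h2
    refine integral_congr_ae (Filter.Eventually.of_forall fun k => ?_)
    simp [mul_comm]
  rw [Finset.prod_congr rfl fun i _ => hone i, ← Complex.exp_sum]
  congr 1
  have hpt : ∀ y, Complex.exp ((∑ B : J, t B * B.1.1.indicator 1 y : ℝ) * Complex.I) - 1 =
      ∑ i, (A i).indicator (fun _ => Complex.exp (τ i * Complex.I) - 1) y := by
    intro y
    obtain ⟨i, hi⟩ := hcover y
    rw [Finset.sum_eq_single i]
    · rw [Set.indicator_of_mem hi]
      congr 3
      norm_cast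
      refine Finset.sum_congr rfl fun B _ => ?_
      by_cases h : e i B = true
      · simp [h, (hi B).2 h]
      · have : y ∉ B.1.1 := fun h' => h ((hi B).1 h')
        simp [h, this]
    · intro j _ hj
      exact Set.indicator_of_notMem (fun h => Set.disjoint_left.1 (hdisj hj) h hi) _
    · simp
  simp only [hpt]
  rw [integral_finsetSum _ fun i _ => (integrable_const _).indicator (hA i)]
  refine Finset.sum_congr rfl fun i _ => ?_
  rw [integral_indicator (hA i), setIntegral_const, Complex.real_smul]

/-- The law of a Poisson process is determined by its intensity measure. -/
theorem IsPoissonProcess.map_eq {Ω : Type*} [MeasurableSpace Ω] {P : Measure Ω}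
    [IsProbabilityMeasure P] {ζ : Ω → FinConfig Y} (hζ : IsPoissonProcess P ζ M) :
    P.map ζ = poissonLaw M := by
  have : IsFiniteMeasure (P.map ζ) := inferInstance
  refine finConfig_measure_ext_of_exp fun J t => ?_
  rw [integral_exp_poissonLaw, ← integral_exp_isPoissonProcess M P hζ,
    integral_map hζ.measurable.aemeasurable]
  refine Measurable.aestronglyMeasurable ?_
  have : Measurable fun ω : FinConfig Y => (∑ B : J, t B * (ω.1 B.1.1).toReal : ℝ) :=
    Finset.measurable_fun_sum _ fun B _ =>
      (measurable_finConfig_apply B.1.2).ennreal_toReal.const_mul _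
  fun_prop

end FiniteConfigurations

/-! ### Poisson averages of sequences -/

section PoissonAverage

/-- The Poisson average `e^{-s m} ∑ k, s^k / k! a_k` of a sequence. If `a_k` is the integral of a
function of `k` points against `M^k` and `m = M univ`, then this is the expectation of that function
for a Poisson process with intensity measure `s M`. -/
def poissonAvg (m : ℝ) (a : ℕ → ℝ) (s : ℝ) : ℝ :=
  Real.exp (-(s * m)) * ∑' k : ℕ, s ^ k / k.factorial * a k

variable {m C R r s : ℝ} {a b : ℕ → ℝ}

theorem summable_poissonAvg (ha : ∀ k, |a k| ≤ C * R ^ k) (s : ℝ) :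
    Summable fun k : ℕ => s ^ k / k.factorial * a k := by
  refine Summable.of_norm_bounded ((Real.summable_pow_div_factorial (|s| * R)).mul_left C)
    fun k => ?_
  rw [Real.norm_eq_abs, abs_mul, abs_div, abs_pow, Nat.abs_cast]
  calc |s| ^ k / k.factorial * |a k| ≤ |s| ^ k / k.factorial * (C * R ^ k) := by gcongr; exact ha k
    _ = _ := by rw [mul_pow]; ring

theorem poissonAvg_sub (ha : ∀ k, |a k| ≤ C * R ^ k) {C' R' : ℝ} (hb : ∀ k, |b k| ≤ C' * R' ^ k)
    (s : ℝ) : poissonAvg m a s - poissonAvg m b s = poissonAvg m (fun k => a k - b k) s := by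
  rw [poissonAvg, poissonAvg, poissonAvg, ← mul_sub,
    ← (summable_poissonAvg ha s).tsum_sub (summable_poissonAvg hb s)]
  congr 1
  exact tsum_congr fun k => by ring

theorem abs_poissonAvg_le (ha : ∀ k, |a k| ≤ r * m ^ k) (hs : 0 ≤ s) : |poissonAvg m a s| ≤ r := by
  have hr : HasSum (fun k : ℕ => s ^ k / k.factorial * (r * m ^ k)) (r * Real.exp (s * m)) := by
    have h := (NormedSpace.expSeries_div_hasSum_exp (𝔸 := ℝ) (s * m)).mul_left r
    rw [← Real.exp_eq_exp_ℝ] at h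
    refine h.congr_fun fun k => ?_
    rw [mul_pow]; ring
  have h2 : ‖∑' k : ℕ, s ^ k / k.factorial * a k‖ ≤ r * Real.exp (s * m) := by
    refine tsum_of_norm_bounded hr fun k => ?_
    rw [Real.norm_eq_abs, abs_mul, abs_of_nonneg (by positivity)]
    gcongr
    exact ha k
  rw [poissonAvg, abs_mul, Real.abs_exp, Real.exp_neg]
  rw [Real.norm_eq_abs] at h2
  calc _ ≤ (Real.exp (s * m))⁻¹ * (r * Real.exp (s * m)) := by gcongr
    _ = r := by field_simp

theorem hasDerivAt_poissonAvg (ha : ∀ k, |a k| ≤ C * R ^ k) (s : ℝ) :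
    HasDerivAt (poissonAvg m a) (poissonAvg m (fun k => a (k + 1) - m * a k) s) s := by
  have ha' : ∀ k, |a (k + 1)| ≤ C * R * R ^ k := fun k => (ha (k + 1)).trans (by rw [pow_succ]; linarith)
  have hser : HasDerivAt (fun s : ℝ => ∑' k : ℕ, s ^ k / k.factorial * a k)
      (∑' k : ℕ, s ^ k / k.factorial * a (k + 1)) s := by
    let u : ℕ → ℝ := fun k => k * (|s| + 1) ^ (k - 1) / k.factorial * (C * R ^ k)
    have hfac : ∀ (k : ℕ) (x : ℝ), ((k + 1 : ℕ) : ℝ) * x / (k + 1).factorial =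
        x / k.factorial := by
      intro k x
      rw [Nat.factorial_succ]
      push_cast
      field_simp
    have hu : Summable u := by
      rw [← summable_nat_add_iff 1]
      refine ((Real.summable_pow_div_factorial ((|s| + 1) * R)).mul_left (C * R)).congr fun k => ?_
      simp only [u, hfac, Nat.add_sub_cancel]
      rw [mul_pow]
      ring
    have h := hasDerivAt_tsum_of_isPreconnected (t := Metric.ball (0 : ℝ) (|s| + 1)) (y₀ := s)
      (g := fun (k : ℕ) (s : ℝ) => s ^ k / k.factorial * a k)
      (g' := fun (k : ℕ) (s : ℝ) => k * s ^ (k - 1) / k.factorial * a k) hu Metric.isOpen_ball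
      (convex_ball _ _).isPreconnected (fun k x _ => ((hasDerivAt_pow k x).div_const _).mul_const _)
      (fun k x hx => by
        have hx' : |x| ≤ |s| + 1 := by simpa using (Metric.mem_ball.1 hx).le
        rw [Real.norm_eq_abs, abs_mul, abs_div, abs_mul, abs_pow, Nat.abs_cast, Nat.abs_cast]
        simp only [u]
        gcongr
        exact ha k) (by simp) (summable_poissonAvg ha s) (y := s) (by simp)
    refine h.congr_deriv ?_
    have hs : Summable fun k : ℕ => (k : ℝ) * s ^ (k - 1) / k.factorial * a k := by
      rw [← summable_nat_add_iff 1]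
      simp only [hfac, Nat.add_sub_cancel]
      exact summable_poissonAvg ha' s
    rw [hs.tsum_eq_zero_add]
    simp only [Nat.cast_zero, zero_mul, zero_div, zero_add, hfac, Nat.add_sub_cancel]
  have hexp : HasDerivAt (fun s : ℝ => Real.exp (-(s * m))) (Real.exp (-(s * m)) * (-m)) s := by
    have := ((hasDerivAt_id s).mul_const m).neg.exp
    simpa using this
  have h := hexp.mul hser
  refine h.congr_deriv ?_
  have hs : ∑' k : ℕ, s ^ k / k.factorial * (a (k + 1) - m * a k) =
      ∑' k : ℕ, s ^ k / k.factorial * a (k + 1) - m * ∑' k : ℕ, s ^ k / k.factorial * a k := by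
    rw [← tsum_mul_left, ← (summable_poissonAvg ha' s).tsum_sub
      ((summable_poissonAvg ha s).mul_left m)]
    exact tsum_congr fun k => by ring
  rw [poissonAvg, hs]
  ring

theorem measurable_poissonAvg {T : Type*} [MeasurableSpace T] {a : T → ℕ → ℝ}
    (ham : ∀ k, Measurable fun t => a t k) {C : T → ℝ} (ha : ∀ t k, |a t k| ≤ C t * R ^ k) (s : ℝ) :
    Measurable fun t => poissonAvg m (a t) s := by
  refine Measurable.const_mul ?_ _
  refine measurable_of_tendsto_metrizable (f := fun N t =>
    ∑ k ∈ Finset.range N, s ^ k / k.factorial * a t k) (fun N => ?_) ?_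
  · exact Finset.measurable_fun_sum _ fun k _ => (ham k).const_mul _
  · rw [tendsto_pi_nhds]
    exact fun t => (summable_poissonAvg (ha t) s).hasSum.tendsto_sum_nat

theorem integral_poissonAvg {T : Type*} [MeasurableSpace T] {μ : Measure T} [IsFiniteMeasure μ]
    {a : T → ℕ → ℝ} (ham : ∀ k, Measurable fun t => a t k)
    (ha : ∀ t k, |a t k| ≤ C * R ^ k) (s : ℝ) :
    ∫ t, poissonAvg m (a t) s ∂μ = poissonAvg m (fun k => ∫ t, a t k ∂μ) s := by
  have hi : ∀ k : ℕ, Integrable (fun t => s ^ k / k.factorial * a t k) μ := fun k =>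
    (Integrable.of_bound (ham k).aestronglyMeasurable (C * R ^ k)
      (Filter.Eventually.of_forall fun t => ha t k)).const_mul _
  have hb : ∀ k : ℕ, ∀ᵐ t ∂μ, ‖‖s ^ k / k.factorial * a t k‖‖ ≤
      C * ((|s| * R) ^ k / k.factorial) := fun k => Filter.Eventually.of_forall fun t => by
    rw [norm_norm, Real.norm_eq_abs, abs_mul, abs_div, abs_pow, Nat.abs_cast]
    calc |s| ^ k / k.factorial * |a t k| ≤ |s| ^ k / k.factorial * (C * R ^ k) := by
          gcongr; exact ha t k
      _ = _ := by rw [mul_pow]; ring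
  have hsum : Summable fun k : ℕ => ∫ t, ‖s ^ k / k.factorial * a t k‖ ∂μ := by
    refine Summable.of_nonneg_of_le (fun k => integral_nonneg fun _ => norm_nonneg _)
      (fun k => (le_abs_self _).trans (norm_integral_le_of_norm_le_const (hb k)))
      (((Real.summable_pow_div_factorial _).mul_left _).mul_right _)
  have h := hasSum_integral_of_summable_integral_norm hi hsum
  simp only [poissonAvg, integral_const_mul] at h ⊢
  rw [h.tsum_eq]

end PoissonAverage

/-! ### Random thinning of a finite index set -/

section Thinning

variable {n : ℕ}

/-- The probability that the random subset of `Fin n` that contains every index independently with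
probability `t` equals `A`. -/
def thinWeight (t : ℝ) (A : Finset (Fin n)) : ℝ := ∏ i, if i ∈ A then t else 1 - t

theorem thinWeight_nonneg {t : ℝ} (h0 : 0 ≤ t) (h1 : t ≤ 1) (A : Finset (Fin n)) :
    0 ≤ thinWeight t A :=
  Finset.prod_nonneg fun i _ => by split_ifs <;> linarith

theorem sum_thinWeight (t : ℝ) : ∑ A : Finset (Fin n), thinWeight t A = 1 := by
  have h := Finset.prod_add (fun _ : Fin n => t) (fun _ => 1 - t) Finset.univ
  simp only [add_sub_cancel, Finset.prod_const_one, Finset.powerset_univ] at h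
  rw [h]
  refine Finset.sum_congr rfl fun A _ => ?_
  rw [thinWeight, Finset.prod_ite]
  congr 2 <;> ext <;> simp

theorem thinWeight_one (A : Finset (Fin n)) :
    thinWeight 1 A = if A = Finset.univ then 1 else 0 := by
  split_ifs with h
  · simp [thinWeight, h]
  · obtain ⟨i, hi⟩ : ∃ i, i ∉ A := by
      by_contra! h'
      exact h (Finset.eq_univ_iff_forall.2 h')
    exact Finset.prod_eq_zero (Finset.mem_univ i) (by simp [hi])

theorem thinWeight_zero (A : Finset (Fin n)) :
    thinWeight 0 A = if A = ∅ then 1 else 0 := by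
  split_ifs with h
  · simp [thinWeight, h]
  · obtain ⟨i, hi⟩ := Finset.nonempty_iff_ne_empty.2 h
    exact Finset.prod_eq_zero (Finset.mem_univ i) (by simp [hi])

/-- Derivative of the thinning probabilities, summed against an arbitrary function of the random
set. For every `i`, both sides are compared on the pairs of sets that differ exactly in `i`. -/
theorem sum_deriv_thinWeight (t : ℝ) (b : Finset (Fin n) → ℝ) :
    ∑ A, (∑ i, (∏ j ∈ Finset.univ.erase i, if j ∈ A then t else 1 - t) *
      (if i ∈ A then 1 else -1)) * b A =
    ∑ i, ∑ A, thinWeight t A * (b (insert i A) - b (A.erase i)) := by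
  simp only [Finset.sum_mul]
  rw [Finset.sum_comm]
  refine Finset.sum_congr rfl fun i _ => ?_
  let v : Finset (Fin n) → ℝ := fun A => ∏ j ∈ Finset.univ.erase i, if j ∈ A then t else 1 - t
  let e : Equiv.Perm (Finset (Fin n)) := Function.Involutive.toPerm (fun A => symmDiff A {i})
    (fun A => by simp)
  have he : ∀ A j, j ∈ e A ↔ (if j = i then j ∉ A else j ∈ A) := by
    intro A j
    change j ∈ symmDiff A {i} ↔ _
    rw [Finset.mem_symmDiff, Finset.mem_singleton]
    split_ifs <;> tauto
  have hv : ∀ A, v (e A) = v A := fun A => Finset.prod_congr rfl fun j hj => by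
    simp only [he, Finset.ne_of_mem_erase hj, if_false]
  have hw : ∀ A, thinWeight t A = (if i ∈ A then t else 1 - t) * v A := fun A =>
    (Finset.mul_prod_erase _ _ (Finset.mem_univ i)).symm
  have hi : ∀ A, insert i (e A) = insert i A := fun A => by
    ext j; simp only [Finset.mem_insert, he]; split_ifs <;> tauto
  have hr : ∀ A, (e A).erase i = A.erase i := fun A => by
    ext j; simp only [Finset.mem_erase, he]; split_ifs <;> tauto
  have h1 := Equiv.sum_comp e fun A => v A * (if i ∈ A then 1 else -1) * b A
  have h2 := Equiv.sum_comp e fun A => thinWeight t A * (b (insert i A) - b (A.erase i))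
  have h3 : ∑ A, (v (e A) * (if i ∈ e A then 1 else -1) * b (e A) +
      v A * (if i ∈ A then 1 else -1) * b A) =
      ∑ A, (thinWeight t (e A) * (b (insert i (e A)) - b ((e A).erase i)) +
        thinWeight t A * (b (insert i A) - b (A.erase i))) := by
    refine Finset.sum_congr rfl fun A _ => ?_
    rw [hw, hw, hi, hr, hv]
    by_cases h : i ∈ A
    · have h' : i ∉ e A := by simp [he, h]
      have hA : insert i A = A := Finset.insert_eq_of_mem h
      have hA' : e A = A.erase i := by rw [← hr, Finset.erase_eq_of_notMem h']
      rw [if_pos h, if_neg h', if_pos h, if_neg h', hA, hA']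
      ring
    · have h' : i ∈ e A := by simp [he, h]
      have hA : A.erase i = A := Finset.erase_eq_of_notMem h
      have hA' : e A = insert i A := by rw [← hi, Finset.insert_eq_of_mem h']
      rw [if_neg h, if_pos h', if_neg h, if_pos h', hA, hA']
      ring
  rw [Finset.sum_add_distrib, Finset.sum_add_distrib, h1, h2] at h3
  change ∑ A, v A * (if i ∈ A then 1 else -1) * b A = _
  linarith

theorem hasDerivAt_thinWeight (t : ℝ) (A : Finset (Fin n)) :
    HasDerivAt (fun t => thinWeight t A)
      (∑ i, (∏ j ∈ Finset.univ.erase i, if j ∈ A then t else 1 - t) *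
        (if i ∈ A then 1 else -1)) t := by
  exact HasDerivAt.fun_finsetProd (u := Finset.univ) (x := t)
    (f := fun (i : Fin n) t => if i ∈ A then t else 1 - t)
    (f' := fun i => if i ∈ A then 1 else -1) (fun i _ => by
      by_cases hi : i ∈ A
      · simpa only [hi, if_true] using hasDerivAt_id' t
      · simpa only [hi, if_false] using (hasDerivAt_id' t).const_sub 1)
end Thinning

/-! ### Interpolation between a finite point process and a Poisson process -/

section Interpolation

variable {Y : Type*} [MeasurableSpace Y]

theorem IsLip.abs_sub_le {h : FinConfig Y → ℝ} (hh : IsLip h) {ω η : FinConfig Y} {r : ℝ}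
    (hr : 0 ≤ r) (hB : ∀ B, MeasurableSet B → |(ω.1 B).toReal - (η.1 B).toReal| ≤ r) :
    |h ω - h η| ≤ r := by
  have h1 := hh.2 ω η
  have h2 : dTV ω.1 η.1 ≤ ENNReal.ofReal r :=
    iSup₂_le fun B hB' => ENNReal.ofReal_le_ofReal (hB B hB'.1)
  exact (ENNReal.ofReal_le_ofReal_iff hr).1 (h1.trans h2)

theorem toReal_sup_apply (ω η : FinConfig Y) (B : Set Y) :
    ((ω.sup η).1 B).toReal = (ω.1 B).toReal + (η.1 B).toReal := by
  rw [FinConfig.sup_apply, ENNReal.toReal_add (measure_ne_top _ _) (measure_ne_top _ _)]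

theorem toReal_weighted_apply {m : ℕ} (c : Fin m → ℕ) (y : Fin m → Y) {B : Set Y}
    (hB : MeasurableSet B) :
    ((weighted c y).1 B).toReal = ∑ i, (c i : ℝ) * B.indicator 1 (y i) := by
  classical
  rw [weighted_apply _ _ hB, ENNReal.toReal_sum fun i _ => by
    by_cases h : y i ∈ B <;> simp [h]]
  exact Finset.sum_congr rfl fun i _ => by by_cases h : y i ∈ B <;> simp [h]

theorem toReal_single_apply (y : Y) {B : Set Y} (hB : MeasurableSet B) :
    ((single y).1 B).toReal = B.indicator 1 y := by
  classical
  rw [single_apply _ hB]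
  by_cases h : y ∈ B <;> simp [h]

theorem indicator_one_mem_Icc {Y : Type*} (B : Set Y) (y : Y) :
    B.indicator (1 : Y → ℝ) y ∈ Set.Icc (0 : ℝ) 1 := by
  classical
  by_cases h : y ∈ B <;> simp [h]

variable (M : Measure Y) (h : FinConfig Y → ℝ)

/-- The integral of `h (ω + ∑ i, δ_{y i})` over `k` points `y i` with respect to `M^k`. -/
def superposeAvg (ω : FinConfig Y) (k : ℕ) : ℝ :=
  ∫ y, h (ω.sup (points y)) ∂(Measure.pi fun _ : Fin k => M)

/-- The expectation of `h (ω + η)`, where `η` is a Poisson process with intensity measure `s M`. -/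
def poissonShift (ω : FinConfig Y) (s : ℝ) : ℝ :=
  poissonAvg (M.real Set.univ) (superposeAvg M h ω) s

variable {M h}

theorem poissonShift_zero (ω : FinConfig Y) : poissonShift M h ω 0 = h ω := by
  have h0 : superposeAvg M h ω 0 = h ω := by
    have : ∀ y : Fin 0 → Y, ω.sup (points y) = ω := fun y => FinConfig.ext fun B hB => by
      rw [FinConfig.sup_apply, points, weighted_apply _ _ hB]
      simp
    simp only [superposeAvg, this]
    simp [measureReal_def]
  rw [poissonShift, poissonAvg, tsum_eq_single 0 fun k hk => by simp [hk]]
  simp [h0]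


theorem IsLip.abs_sup_points_sub_le (hh : IsLip h) (ω : FinConfig Y) {k : ℕ} (y : Fin k → Y) :
    |h (ω.sup (points y)) - h ω| ≤ k := by
  refine hh.abs_sub_le (by positivity) fun B hB => ?_
  rw [toReal_sup_apply, add_sub_cancel_left, points, toReal_weighted_apply _ _ hB,
    abs_of_nonneg (Finset.sum_nonneg fun i _ => by
      simpa using (indicator_one_mem_Icc B (y i)).1)]
  calc _ ≤ ∑ i : Fin k, (1 : ℝ) := Finset.sum_le_sum fun i _ => by
        simpa using (indicator_one_mem_Icc B (y i)).2
    _ = k := by simp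

theorem IsLip.abs_sup_points_le (hh : IsLip h) (ω : FinConfig Y) {k : ℕ} (y : Fin k → Y) :
    |h (ω.sup (points y))| ≤ |h ω| + k := by
  have h1 := hh.abs_sup_points_sub_le ω y
  have h2 := abs_sub_abs_le_abs_sub (h (ω.sup (points y))) (h ω)
  linarith

theorem IsLip.measurable_sup_points (hh : IsLip h) (ω : FinConfig Y) (k : ℕ) :
    Measurable fun y : Fin k → Y => h (ω.sup (points y)) :=
  hh.1.comp (by fun_prop)

variable [IsFiniteMeasure M]

theorem IsLip.integrable_sup_points (hh : IsLip h) (ω : FinConfig Y) (k : ℕ) :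
    Integrable (fun y : Fin k → Y => h (ω.sup (points y))) (Measure.pi fun _ : Fin k => M) :=
  Integrable.of_bound (hh.measurable_sup_points ω k).aestronglyMeasurable (|h ω| + k)
    (Filter.Eventually.of_forall fun y => hh.abs_sup_points_le ω y)

theorem measurable_superposeAvg (hh : IsLip h) (k : ℕ) :
    Measurable fun ω => superposeAvg M h ω k := by
  have : Measurable fun p : FinConfig Y × (Fin k → Y) => h (p.1.sup (points p.2)) :=
    hh.1.comp (by fun_prop)
  exact (this.stronglyMeasurable.integral_prod_right (ν := Measure.pi fun _ : Fin k => M)).measurable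

theorem abs_superposeAvg_sub_le (hh : IsLip h) {ω η : FinConfig Y} {r : ℝ} (hr : 0 ≤ r)
    (hB : ∀ B, MeasurableSet B → |(ω.1 B).toReal - (η.1 B).toReal| ≤ r) (k : ℕ) :
    |superposeAvg M h ω k - superposeAvg M h η k| ≤ r * M.real Set.univ ^ k := by
  rw [superposeAvg, superposeAvg, ← integral_sub (hh.integrable_sup_points ω k)
    (hh.integrable_sup_points η k), ← measureReal_pi_univ M, ← Real.norm_eq_abs]
  refine norm_integral_le_of_norm_le_const (μ := Measure.pi fun _ : Fin k => M)
    (Filter.Eventually.of_forall fun y => ?_)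
  refine hh.abs_sub_le hr fun B hB' => ?_
  rw [toReal_sup_apply, toReal_sup_apply, add_sub_add_right_eq_sub]
  exact hB B hB'

theorem abs_superposeAvg_le (hh : IsLip h) (ω : FinConfig Y) (k : ℕ) :
    |superposeAvg M h ω k| ≤ (|h ω| + 1) * (2 * M.real Set.univ) ^ k := by
  have h1 : |superposeAvg M h ω k| ≤ (|h ω| + k) * M.real Set.univ ^ k := by
    rw [superposeAvg, ← measureReal_pi_univ M]
    exact norm_integral_le_of_norm_le_const (μ := Measure.pi fun _ : Fin k => M)
      (f := fun y => h (ω.sup (points y)))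
      (Filter.Eventually.of_forall fun y => hh.abs_sup_points_le ω y)
  have h2 : (k : ℝ) + 1 ≤ 2 ^ k := by exact_mod_cast Nat.lt_two_pow_self
  have h3 : |h ω| + k ≤ (|h ω| + 1) * 2 ^ k := by
    have := abs_nonneg (h ω)
    have h4 : (1 : ℝ) ≤ 2 ^ k := one_le_pow₀ (by norm_num)
    nlinarith
  calc _ ≤ (|h ω| + k) * M.real Set.univ ^ k := h1
    _ ≤ ((|h ω| + 1) * 2 ^ k) * M.real Set.univ ^ k := by gcongr
    _ = _ := by rw [mul_pow]; ring

theorem superposeAvg_succ (hh : IsLip h) (ω : FinConfig Y) (k : ℕ) :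
    superposeAvg M h ω (k + 1) = ∫ z, superposeAvg M h (ω.sup (single z)) k ∂M := by
  have hmp := (measurePreserving_piFinSuccAbove (fun _ : Fin (k + 1) => M) 0).symm
  have hpt : ∀ (z : Y) (y : Fin k → Y),
      ω.sup (points (Fin.insertNth (α := fun _ => Y) 0 z y)) =
        (ω.sup (single z)).sup (points y) := by
    intro z y
    rw [FinConfig.sup_assoc]
    congr 1
    refine FinConfig.ext fun B hB => ?_
    rw [FinConfig.sup_apply, points, points, weighted_apply _ _ hB, weighted_apply _ _ hB,
      single_apply _ hB, Fin.sum_univ_succ]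
    simp
  rw [superposeAvg, ← hmp.integral_comp']
  have hi : Integrable (fun p : Y × (Fin k → Y) => h ((ω.sup (single p.1)).sup (points p.2)))
      (M.prod (Measure.pi fun _ : Fin k => M)) := by
    refine Integrable.of_bound (hh.1.comp (by fun_prop)).aestronglyMeasurable (|h ω| + (k + 1 : ℕ))
      (Filter.Eventually.of_forall fun p => ?_)
    rw [← hpt]
    exact hh.abs_sup_points_le ω _
  refine Eq.trans ?_ (integral_prod _ hi)
  refine integral_congr_ae (Filter.Eventually.of_forall fun p => ?_)
  exact congrArg h (hpt p.1 p.2)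

theorem measurable_poissonShift (hh : IsLip h) (s : ℝ) : Measurable fun ω => poissonShift M h ω s :=
  measurable_poissonAvg (measurable_superposeAvg hh) (abs_superposeAvg_le hh) s

theorem abs_poissonShift_sub_le (hh : IsLip h) {ω η : FinConfig Y} {r s : ℝ} (hr : 0 ≤ r)
    (hs : 0 ≤ s)
    (hB : ∀ B, MeasurableSet B → |(ω.1 B).toReal - (η.1 B).toReal| ≤ r) :
    |poissonShift M h ω s - poissonShift M h η s| ≤ r := by
  rw [poissonShift, poissonShift,
    poissonAvg_sub (abs_superposeAvg_le hh ω) (abs_superposeAvg_le hh η)]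
  exact abs_poissonAvg_le (abs_superposeAvg_sub_le hh hr hB) hs

theorem abs_poissonShift_single_sub_le (hh : IsLip h) (ω : FinConfig Y) (z : Y) {s : ℝ}
    (hs : 0 ≤ s) :
    |poissonShift M h (ω.sup (single z)) s - poissonShift M h ω s| ≤ 1 := by
  refine abs_poissonShift_sub_le hh zero_le_one hs fun B hB => ?_
  rw [toReal_sup_apply, add_sub_cancel_left, toReal_single_apply _ hB]
  have := indicator_one_mem_Icc B z
  rw [abs_of_nonneg this.1]
  exact this.2

theorem abs_poissonShift_single_sub_single_le (hh : IsLip h) (ω : FinConfig Y) (z z' : Y) {s : ℝ}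
    (hs : 0 ≤ s) :
    |poissonShift M h (ω.sup (single z)) s - poissonShift M h (ω.sup (single z')) s| ≤ 1 := by
  refine abs_poissonShift_sub_le hh zero_le_one hs fun B hB => ?_
  rw [toReal_sup_apply, toReal_sup_apply, add_sub_add_left_eq_sub, toReal_single_apply _ hB,
    toReal_single_apply _ hB]
  have h1 := indicator_one_mem_Icc B z
  have h2 := indicator_one_mem_Icc B z'
  rw [abs_le]
  constructor <;> linarith [h1.1, h1.2, h2.1, h2.2]

theorem poissonShift_empty (hh : IsLip h) {ω : FinConfig Y}
    (hω : ∀ B, MeasurableSet B → ω.1 B = 0) :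
    poissonShift M h ω 1 = ∫ η, h η ∂poissonLaw M := by
  have hsup : ∀ η : FinConfig Y, ω.sup η = η := fun η => FinConfig.ext fun B hB => by
    rw [FinConfig.sup_apply, hω B hB, zero_add]
  have hi : Integrable h (poissonLaw M) := integrable_poissonLaw M hh.1.stronglyMeasurable
    (C := |h ω|) fun k y => by
      have := hh.abs_sup_points_le ω y
      rwa [hsup] at this
  rw [← (hasSum_integral_poissonLaw M hh.1.stronglyMeasurable hi).tsum_eq, poissonShift, poissonAvg,
    ← tsum_mul_left]
  refine tsum_congr fun k => ?_
  simp only [superposeAvg, hsup, smul_eq_mul]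
  ring_nf

theorem hasDerivAt_poissonShift (hh : IsLip h) (ω : FinConfig Y) (s : ℝ) :
    HasDerivAt (poissonShift M h ω)
      (∫ z, (poissonShift M h (ω.sup (single z)) s - poissonShift M h ω s) ∂M) s := by
  have h1 := hasDerivAt_poissonAvg (m := M.real Set.univ)
    (abs_superposeAvg_le (M := M) hh ω) s
  refine h1.congr_deriv ?_
  have hpt : ∀ z, poissonShift M h (ω.sup (single z)) s - poissonShift M h ω s =
      poissonAvg (M.real Set.univ)
        (fun k => superposeAvg M h (ω.sup (single z)) k - superposeAvg M h ω k) s := fun z =>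
    poissonAvg_sub (abs_superposeAvg_le hh _) (abs_superposeAvg_le hh ω) s
  have hm : ∀ k, Measurable fun z => superposeAvg M h (ω.sup (single z)) k := fun k =>
    (measurable_superposeAvg hh k).comp (by fun_prop)
  simp only [hpt]
  rw [integral_poissonAvg (C := 1) (R := M.real Set.univ) (fun k => (hm k).sub_const _)
    (fun z k => abs_superposeAvg_sub_le hh zero_le_one (fun B hB => by
      rw [toReal_sup_apply, add_sub_cancel_left, toReal_single_apply _ hB]
      have := indicator_one_mem_Icc B z
      rw [abs_of_nonneg this.1]
      exact this.2) k)]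
  congr 1
  funext k
  have hi : Integrable (fun z => superposeAvg M h (ω.sup (single z)) k) M := by
    refine Integrable.of_bound (hm k).aestronglyMeasurable
      (|superposeAvg M h ω k| + 1 * M.real Set.univ ^ k) (Filter.Eventually.of_forall fun z => ?_)
    have h2 := abs_superposeAvg_sub_le (M := M) (ω := ω.sup (single z)) (η := ω) hh zero_le_one
      (fun B hB => by
        rw [toReal_sup_apply, add_sub_cancel_left, toReal_single_apply _ hB]
        have := indicator_one_mem_Icc B z
        rw [abs_of_nonneg this.1]
        exact this.2) k
    have h3 := abs_sub_abs_le_abs_sub (superposeAvg M h (ω.sup (single z)) k) (superposeAvg M h ω k)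
    rw [Real.norm_eq_abs]
    linarith
  rw [integral_sub hi (integrable_const _), superposeAvg_succ hh]
  simp

end Interpolation

section SteinFunction

variable {Y : Type*} [MeasurableSpace Y] {n : ℕ}

/-- The configuration `∑ i ∈ A, c i • δ_{y i}`. -/
def thinned (A : Finset (Fin n)) (c : Fin n → ℕ) (y : Fin n → Y) : FinConfig Y :=
  weighted (fun i => if i ∈ A then c i else 0) y

theorem measurable_thinned (A : Finset (Fin n)) :
    Measurable fun p : (Fin n → ℕ) × (Fin n → Y) => thinned A p.1 p.2 := by
  refine Measurable.weighted (measurable_pi_lambda _ fun i => ?_) measurable_snd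
  by_cases hi : i ∈ A
  · simp only [hi, if_true]
    exact (measurable_pi_apply i).comp measurable_fst
  · simp only [hi, if_false]
    exact measurable_const

/-- The `i`-th atoms of `∑ i, c i • δ_{y i}` and `∑ i, c' i • δ_{y' i}` differ. -/
def Mismatch (c : Fin n → ℕ) (y : Fin n → Y) (c' : Fin n → ℕ) (y' : Fin n → Y) (i : Fin n) :
    Prop := ¬(c i = c' i ∧ (c i = 0 ∨ y i = y' i))

open Classical in
theorem abs_thinned_sub_le (A : Finset (Fin n)) {c c' : Fin n → ℕ} {y y' : Fin n → Y}
    (hc : ∀ i, c i ≤ 1) (hc' : ∀ i, c' i ≤ 1) {B : Set Y} (hB : MeasurableSet B) :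
    |((thinned A c y).1 B).toReal - ((thinned A c' y').1 B).toReal| ≤
      ∑ i, if Mismatch c y c' y' i then (1 : ℝ) else 0 := by
  rw [thinned, thinned, toReal_weighted_apply _ _ hB, toReal_weighted_apply _ _ hB,
    ← Finset.sum_sub_distrib]
  refine (Finset.abs_sum_le_sum_abs _ _).trans (Finset.sum_le_sum fun i _ => ?_)
  split_ifs with hA hm hm
  · have hr : ∀ d : ℕ, d ≤ 1 → ∀ z : Y, 0 ≤ (d : ℝ) * B.indicator 1 z ∧
        (d : ℝ) * B.indicator 1 z ≤ 1 := by
      intro d hd z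
      have h1 : (d : ℝ) ≤ 1 := by exact_mod_cast hd
      have h2 := indicator_one_mem_Icc B z
      exact ⟨mul_nonneg (by positivity) h2.1, mul_le_one₀ h1 h2.1 h2.2⟩
    have h1 := hr _ (hc i) (y i)
    have h2 := hr _ (hc' i) (y' i)
    rw [abs_le]
    constructor <;> linarith
  · rw [Mismatch, not_not] at hm
    obtain ⟨h1, h2 | h2⟩ := hm
    · rw [← h1, h2]; simp
    · rw [← h1, h2]; simp
  · simp
  · simp

variable (M : Measure Y) (h : FinConfig Y → ℝ)

/-- The interpolation at time `t` between `h (∑ i, c i • δ_{y i})` and the expectation of `h` for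
the Poisson process with intensity measure `M`: the expectation of `h` for the superposition of an
independent `t`-thinning of `∑ i, c i • δ_{y i}` and of a Poisson process with intensity measure
`(1 - t) M`. -/
def interpolation (c : Fin n → ℕ) (y : Fin n → Y) (t : ℝ) : ℝ :=
  ∑ A, thinWeight t A * poissonShift M h (thinned A c y) (1 - t)

/-- The expected effect of an additional point at `z` on the interpolation at time `t`. -/
def addPointCost (t : ℝ) (z : Y) (c : Fin n → ℕ) (y : Fin n → Y) : ℝ :=
  ∑ A, thinWeight t A * (poissonShift M h ((thinned A c y).sup (single z)) (1 - t) -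
    poissonShift M h (thinned A c y) (1 - t))

variable {M h}

theorem abs_sum_thinWeight_mul_le {t r : ℝ} (h0 : 0 ≤ t) (h1 : t ≤ 1) {b : Finset (Fin n) → ℝ}
    (hb : ∀ A, |b A| ≤ r) : |∑ A, thinWeight t A * b A| ≤ r := by
  calc |∑ A, thinWeight t A * b A| ≤ ∑ A, |thinWeight t A * b A| :=
        Finset.abs_sum_le_sum_abs _ _
    _ ≤ ∑ A, thinWeight t A * r := Finset.sum_le_sum fun A _ => by
        rw [abs_mul, abs_of_nonneg (thinWeight_nonneg h0 h1 A)]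
        exact mul_le_mul_of_nonneg_left (hb A) (thinWeight_nonneg h0 h1 A)
    _ = r := by rw [← Finset.sum_mul, sum_thinWeight, one_mul]

theorem interpolation_one (c : Fin n → ℕ) (y : Fin n → Y) :
    interpolation M h c y 1 = h (weighted c y) := by
  simp only [interpolation, thinWeight_one, sub_self, poissonShift_zero]
  simp [thinned]

theorem poissonShift_insert_sub_erase {c : Fin n → ℕ} {y : Fin n → Y} (hc : ∀ i, c i ≤ 1) (s : ℝ)
    (i : Fin n) (A : Finset (Fin n)) :
    poissonShift M h (thinned (insert i A) c y) s - poissonShift M h (thinned (A.erase i) c y) s =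
      c i * (poissonShift M h ((thinned A (Function.update c i 0) y).sup (single (y i))) s -
        poissonShift M h (thinned A (Function.update c i 0) y) s) := by
  have he : thinned (A.erase i) c y = thinned A (Function.update c i 0) y := by
    rw [thinned, thinned]
    congr 1
    funext j
    by_cases hj : j = i
    · subst hj; simp
    · simp [hj]
  rw [he]
  rcases Nat.le_one_iff_eq_zero_or_eq_one.1 (hc i) with h0 | h1
  · have : thinned (insert i A) c y = thinned A (Function.update c i 0) y := by
      rw [thinned, thinned]
      congr 1
      funext j
      by_cases hj : j = i
      · subst hj; simp [h0]
      · simp [hj]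
    rw [this, h0]
    simp
  · have : thinned (insert i A) c y =
        (thinned A (Function.update c i 0) y).sup (single (y i)) := by
      refine FinConfig.ext fun B hB => ?_
      rw [FinConfig.sup_apply, thinned, thinned, weighted_apply _ _ hB, weighted_apply _ _ hB,
        single_apply _ hB, ← Finset.add_sum_erase _ _ (Finset.mem_univ i),
        ← Finset.add_sum_erase _ _ (Finset.mem_univ i)]
      simp only [Finset.mem_insert_self, if_true, h1, Nat.cast_one, one_mul, Function.update_self,
        ite_self, Nat.cast_zero, zero_mul, zero_add]
      rw [add_comm]
      congr 1
      refine Finset.sum_congr rfl fun j hj => ?_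
      have := Finset.ne_of_mem_erase hj
      simp [this]
    rw [this, h1]
    simp

variable [IsFiniteMeasure M]

theorem measurable_addPointCost (hh : IsLip h) (t : ℝ) :
    Measurable fun p : Y × (Fin n → ℕ) × (Fin n → Y) => addPointCost M h t p.1 p.2.1 p.2.2 := by
  refine Finset.measurable_fun_sum _ fun A _ => Measurable.const_mul (Measurable.sub ?_ ?_) _
  · exact (measurable_poissonShift hh _).comp (Measurable.finConfig_sup
      ((measurable_thinned A).comp measurable_snd) (measurable_single.comp measurable_fst))
  · exact (measurable_poissonShift hh _).comp ((measurable_thinned A).comp measurable_snd)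

theorem abs_addPointCost_le (hh : IsLip h) {t : ℝ} (h0 : 0 ≤ t) (h1 : t ≤ 1) (z : Y)
    (c : Fin n → ℕ) (y : Fin n → Y) : |addPointCost M h t z c y| ≤ 1 :=
  abs_sum_thinWeight_mul_le h0 h1 fun _ => abs_poissonShift_single_sub_le hh _ _ (by linarith)

theorem abs_addPointCost_sub_le_one (hh : IsLip h) {t : ℝ} (h0 : 0 ≤ t) (h1 : t ≤ 1) (z z' : Y)
    (c : Fin n → ℕ) (y : Fin n → Y) :
    |addPointCost M h t z c y - addPointCost M h t z' c y| ≤ 1 := by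
  rw [addPointCost, addPointCost, ← Finset.sum_sub_distrib]
  simp only [← mul_sub, sub_sub_sub_cancel_right]
  exact abs_sum_thinWeight_mul_le h0 h1 fun _ =>
    abs_poissonShift_single_sub_single_le hh _ _ _ (by linarith)

/-- The second difference of a Lipschitz functional is bounded by two first differences, so every
atom in which the two configurations differ contributes at most `2`. -/
theorem ofReal_abs_addPointCost_sub_le (hh : IsLip h) {t : ℝ} (h0 : 0 ≤ t) (h1 : t ≤ 1) (z : Y)
    {c c' : Fin n → ℕ} {y y' : Fin n → Y} (hc : ∀ i, c i ≤ 1) (hc' : ∀ i, c' i ≤ 1)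
    {d : Fin n → ℝ≥0∞} (hd : ∀ i, Mismatch c y c' y' i → 1 ≤ d i) :
    ENNReal.ofReal |addPointCost M h t z c y - addPointCost M h t z c' y'| ≤ 2 * ∑ i, d i := by
  classical
  set r : ℝ := ∑ i, if Mismatch c y c' y' i then (1 : ℝ) else 0 with hr
  have hr0 : 0 ≤ r := Finset.sum_nonneg fun i _ => by split_ifs <;> norm_num
  have hs : (0 : ℝ) ≤ 1 - t := by linarith
  have hle : |addPointCost M h t z c y - addPointCost M h t z c' y'| ≤ 2 * r := by
    rw [addPointCost, addPointCost, ← Finset.sum_sub_distrib]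
    simp only [← mul_sub]
    refine abs_sum_thinWeight_mul_le h0 h1 fun A => ?_
    have h2 := abs_poissonShift_sub_le (M := M) (ω := thinned A c y) (η := thinned A c' y') hh hr0 hs
      fun B hB => abs_thinned_sub_le A hc hc' hB
    have h3 := abs_poissonShift_sub_le (M := M) (ω := (thinned A c y).sup (single z))
      (η := (thinned A c' y').sup (single z)) hh hr0 hs fun B hB => by
        rw [toReal_sup_apply, toReal_sup_apply, add_sub_add_right_eq_sub]
        exact abs_thinned_sub_le A hc hc' hB
    rw [abs_le] at h2 h3 ⊢
    constructor <;> linarith [h2.1, h2.2, h3.1, h3.2]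
  refine (ENNReal.ofReal_le_ofReal hle).trans ?_
  rw [ENNReal.ofReal_mul (by norm_num), hr, ENNReal.ofReal_sum_of_nonneg fun i _ => by
    split_ifs <;> norm_num]
  rw [ENNReal.ofReal_ofNat]
  gcongr with i
  split_ifs with hm
  · simpa using hd i hm
  · simp

theorem interpolation_zero (hh : IsLip h) (c : Fin n → ℕ) (y : Fin n → Y) :
    interpolation M h c y 0 = ∫ η, h η ∂poissonLaw M := by
  simp only [interpolation, thinWeight_zero, sub_zero, ite_mul, one_mul, zero_mul]
  rw [Finset.sum_ite_eq' Finset.univ ∅, if_pos (Finset.mem_univ _)]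
  refine poissonShift_empty hh fun B hB => ?_
  rw [thinned, weighted_apply _ _ hB]
  simp

theorem integrable_poissonShift_single_sub (hh : IsLip h) (ω : FinConfig Y) {s : ℝ} (hs : 0 ≤ s) :
    Integrable (fun z => poissonShift M h (ω.sup (single z)) s - poissonShift M h ω s) M :=
  Integrable.of_bound (((measurable_poissonShift hh s).comp (by fun_prop)).sub_const
    _).aestronglyMeasurable 1
    (Filter.Eventually.of_forall fun z => abs_poissonShift_single_sub_le hh ω z hs)

/-- The derivative of the interpolation: thinning out fewer points adds the points of
`∑ i, c i • δ_{y i}`, and decreasing the intensity removes points distributed according to `M`. -/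
theorem hasDerivAt_interpolation (hh : IsLip h) {c : Fin n → ℕ} {y : Fin n → Y}
    (hc : ∀ i, c i ≤ 1) {t : ℝ} (ht : t ≤ 1) :
    HasDerivAt (interpolation M h c y)
      (∑ i, c i * addPointCost M h t (y i) (Function.update c i 0) y -
        ∫ z, addPointCost M h t z c y ∂M) t := by
  have hb : ∀ A : Finset (Fin n), HasDerivAt
      (fun t => thinWeight t A * poissonShift M h (thinned A c y) (1 - t)) _ t := fun A =>
    (hasDerivAt_thinWeight t A).mul
      (HasDerivAt.comp_const_sub 1 t (hasDerivAt_poissonShift (M := M) hh (thinned A c y) (1 - t)))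
  have h1 := HasDerivAt.fun_sum (u := Finset.univ) fun A _ => hb A
  refine h1.congr_deriv ?_
  rw [Finset.sum_add_distrib, sum_deriv_thinWeight]
  refine (congrArg₂ (· + ·) ?_ ?_).trans (sub_eq_add_neg _ _).symm
  · refine Finset.sum_congr rfl fun i _ => ?_
    simp only [poissonShift_insert_sub_erase hc, addPointCost, Finset.mul_sum]
    exact Finset.sum_congr rfl fun A _ => by ring
  · simp only [addPointCost, mul_neg, Finset.sum_neg_distrib]
    rw [integral_finsetSum _ fun A _ =>
      (integrable_poissonShift_single_sub hh _ (by linarith)).const_mul _]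
    simp only [integral_const_mul]

variable (M h) in
/-- The derivative at time `t` of the interpolation. -/
def interpolationDeriv (t : ℝ) (c : Fin n → ℕ) (y : Fin n → Y) : ℝ :=
  ∑ i, c i * addPointCost M h t (y i) (Function.update c i 0) y - ∫ z, addPointCost M h t z c y ∂M

theorem measurable_interpolationDeriv (hh : IsLip h) (t : ℝ) :
    Measurable fun p : (Fin n → ℕ) × (Fin n → Y) => interpolationDeriv M h t p.1 p.2 := by
  have hF := measurable_addPointCost (n := n) (M := M) hh t
  simp only [interpolationDeriv]
  generalize addPointCost M h t = F at hF ⊢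
  refine Measurable.sub (Finset.measurable_fun_sum _ fun i _ => Measurable.mul ?_ ?_) ?_
  · exact measurable_from_nat.comp ((measurable_pi_apply i).comp measurable_fst)
  · have hu : Measurable fun p : (Fin n → ℕ) × (Fin n → Y) => Function.update p.1 i 0 := by
      refine measurable_pi_lambda _ fun j => ?_
      by_cases hj : j = i
      · subst hj; simp only [Function.update_self]; exact measurable_const
      · simp only [Function.update_of_ne hj]
        exact (measurable_pi_apply j).comp measurable_fst
    have hG : Measurable fun p : (Fin n → ℕ) × (Fin n → Y) =>
        (p.2 i, Function.update p.1 i 0, p.2) :=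
      ((measurable_pi_apply i).comp measurable_snd).prodMk (hu.prodMk measurable_snd)
    exact hF.comp hG
  · exact (hF.comp measurable_swap).stronglyMeasurable.integral_prod_right'.measurable

theorem abs_interpolationDeriv_le (hh : IsLip h) {t : ℝ} (h0 : 0 ≤ t) (h1 : t ≤ 1)
    {c : Fin n → ℕ} (hc : ∀ i, c i ≤ 1) (y : Fin n → Y) :
    |interpolationDeriv M h t c y| ≤ n + M.real Set.univ := by
  have hcr : ∀ i, (c i : ℝ) ≤ 1 := fun i => by exact_mod_cast hc i
  refine (abs_sub _ _).trans (add_le_add ?_ ?_)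
  · calc _ ≤ ∑ i, |c i * addPointCost M h t (y i) (Function.update c i 0) y| :=
          Finset.abs_sum_le_sum_abs _ _
      _ ≤ ∑ i : Fin n, (1 : ℝ) := Finset.sum_le_sum fun i _ => by
          rw [abs_mul, Nat.abs_cast]
          exact mul_le_one₀ (hcr i) (abs_nonneg _) (abs_addPointCost_le hh h0 h1 _ _ _)
      _ = n := by simp
  · have := norm_integral_le_of_norm_le_const (μ := M) (C := 1)
      (f := fun z => addPointCost M h t z c y)
      (Filter.Eventually.of_forall fun z => abs_addPointCost_le hh h0 h1 z c y)
    simpa using this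

theorem abs_interpolation_sub_le (hh : IsLip h) {c : Fin n → ℕ} (y : Fin n → Y)
    (hc : ∀ i, c i ≤ 1) {t : ℝ} (h0 : 0 ≤ t) (h1 : t ≤ 1) :
    |interpolation M h c y t - poissonShift M h (thinned ∅ c y) (1 - t)| ≤ n := by
  have : poissonShift M h (thinned ∅ c y) (1 - t) =
      ∑ A : Finset (Fin n), thinWeight t A * poissonShift M h (thinned ∅ c y) (1 - t) := by
    rw [← Finset.sum_mul, sum_thinWeight, one_mul]
  rw [this, interpolation, ← Finset.sum_sub_distrib]
  simp only [← mul_sub]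
  refine abs_sum_thinWeight_mul_le h0 h1 fun A => ?_
  refine abs_poissonShift_sub_le hh (by positivity) (by linarith) fun B hB => ?_
  rw [thinned, thinned, toReal_weighted_apply _ _ hB, toReal_weighted_apply _ _ hB]
  simp only [Finset.notMem_empty, if_false, Nat.cast_zero, zero_mul, Finset.sum_const_zero, sub_zero]
  refine (Finset.abs_sum_le_sum_abs _ _).trans ((Finset.sum_le_card_nsmul _ _ 1 fun i _ => ?_).trans
    (by simp))
  have h2 := indicator_one_mem_Icc B (y i)
  have h3 : ((if i ∈ A then c i else 0 : ℕ) : ℝ) ≤ 1 := by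
    split_ifs
    · exact_mod_cast hc i
    · simp
  rw [abs_of_nonneg (mul_nonneg (by positivity) h2.1)]
  exact mul_le_one₀ h3 h2.1 h2.2

/-- Mean value theorem for an integral that depends on a parameter. -/
theorem exists_integral_deriv_eq {Ω : Type*} [MeasurableSpace Ω] {μ : Measure Ω}
    [IsFiniteMeasure μ] {I D : ℝ → Ω → ℝ} (hI : ∀ t, Measurable (I t)) (hD : ∀ t, Measurable (D t))
    {C C' : ℝ} (hC : ∀ t ∈ Set.Icc (0 : ℝ) 1, ∀ ω, |I t ω| ≤ C)
    (hC' : ∀ t ∈ Set.Icc (0 : ℝ) 1, ∀ ω, |D t ω| ≤ C')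
    (hderiv : ∀ ω, ∀ t ∈ Set.Icc (0 : ℝ) 1, HasDerivAt (fun t => I t ω) (D t ω) t) :
    ∃ t ∈ Set.Ioo (0 : ℝ) 1, ∫ ω, I 1 ω ∂μ - ∫ ω, I 0 ω ∂μ = ∫ ω, D t ω ∂μ := by
  have hcont : ContinuousOn (fun t => ∫ ω, I t ω ∂μ) (Set.Icc 0 1) :=
    continuousOn_of_dominated (bound := fun _ => C) (fun t _ => (hI t).aestronglyMeasurable)
      (fun t ht => Filter.Eventually.of_forall fun ω => hC t ht ω) (integrable_const _)
      (Filter.Eventually.of_forall fun ω t ht =>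
        (hderiv ω t ht).continuousAt.continuousWithinAt)
  have hφ : ∀ t ∈ Set.Ioo (0 : ℝ) 1,
      HasDerivAt (fun t => ∫ ω, I t ω ∂μ) (∫ ω, D t ω ∂μ) t := by
    intro t ht
    exact (hasDerivAt_integral_of_dominated_loc_of_deriv_le (F' := D)
      (bound := fun _ => C') (Ioo_mem_nhds ht.1 ht.2)
      (Filter.Eventually.of_forall fun t => (hI t).aestronglyMeasurable)
      (Integrable.of_bound (hI t).aestronglyMeasurable C
        (Filter.Eventually.of_forall fun ω => hC t ⟨ht.1.le, ht.2.le⟩ ω))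
      (hD t).aestronglyMeasurable
      (Filter.Eventually.of_forall fun ω s hs => hC' s ⟨hs.1.le, hs.2.le⟩ ω)
      (integrable_const _)
      (Filter.Eventually.of_forall fun ω s hs => hderiv ω s ⟨hs.1.le, hs.2.le⟩)).2
  obtain ⟨t, ht, hslope⟩ := exists_hasDerivAt_eq_slope _ _ zero_lt_one hcont hφ
  exact ⟨t, ht, by rw [hslope, sub_zero, div_one]⟩

/-- The interpolation takes the expected values of `h` at its two ends, so the mean value theorem
produces a time at which its expected derivative is their difference. -/
theorem exists_integral_interpolationDeriv_eq {Ω : Type*} [MeasurableSpace Ω] (μ : Measure Ω)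
    [IsProbabilityMeasure μ] {c : Ω → Fin n → ℕ} {y : Ω → Fin n → Y} (hcm : Measurable c)
    (hym : Measurable y) (hc : ∀ ω i, c ω i ≤ 1) (hh : IsLip h) :
    ∃ t ∈ Set.Ioo (0 : ℝ) 1, ∫ ω, h (weighted (c ω) (y ω)) ∂μ - ∫ η, h η ∂poissonLaw M =
      ∫ ω, interpolationDeriv M h t (c ω) (y ω) ∂μ := by
  have hmeas : ∀ t, Measurable fun ω => interpolation M h (c ω) (y ω) t := by
    intro t
    simp only [interpolation]
    exact Finset.measurable_fun_sum _ fun A _ => ((measurable_poissonShift hh _).comp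
      ((measurable_thinned A).comp (hcm.prodMk hym))).const_mul _
  have hmeas' : ∀ t, Measurable ((fun t ω => interpolation M h (c ω) (y ω) t) t) := hmeas
  obtain ⟨C, hC⟩ : ∃ C : ℝ, ∀ t ∈ Set.Icc (0 : ℝ) 1, ∀ ω,
      |interpolation M h (c ω) (y ω) t| ≤ C := by
    obtain hn | ⟨⟨ω₀⟩⟩ := isEmpty_or_nonempty Ω
    · exact ⟨0, fun _ _ ω => (hn.false ω).elim⟩
    have hcont : ContinuousOn (fun t : ℝ => poissonShift M h (thinned ∅ (c ω₀) (y ω₀)) (1 - t))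
        (Set.Icc 0 1) := fun t _ => (HasDerivAt.comp_const_sub 1 t
      (hasDerivAt_poissonShift (M := M) hh _ (1 - t))).continuousAt.continuousWithinAt
    obtain ⟨C, hC⟩ := isCompact_Icc.exists_bound_of_continuousOn hcont
    refine ⟨C + n, fun t ht ω => ?_⟩
    have h1 := abs_interpolation_sub_le (M := M) hh (y ω) (hc ω) ht.1 ht.2
    have h2 := hC t ht
    have h3 : thinned ∅ (c ω) (y ω) = thinned ∅ (c ω₀) (y ω₀) := FinConfig.ext fun B hB => by
      rw [thinned, thinned, weighted_apply _ _ hB, weighted_apply _ _ hB]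
      simp
    rw [h3] at h1
    have h4 := abs_sub_abs_le_abs_sub (interpolation M h (c ω) (y ω) t)
      (poissonShift M h (thinned ∅ (c ω₀) (y ω₀)) (1 - t))
    rw [Real.norm_eq_abs] at h2
    linarith
  have hDm : ∀ t, Measurable fun ω => interpolationDeriv M h t (c ω) (y ω) := by
    intro t
    have h1 := measurable_interpolationDeriv (n := n) (M := M) hh t
    generalize interpolationDeriv M h t = D at h1 ⊢
    exact h1.comp (hcm.prodMk hym)
  have hDb : ∀ t ∈ Set.Icc (0 : ℝ) 1, ∀ ω, |interpolationDeriv M h t (c ω) (y ω)| ≤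
      n + M.real Set.univ := fun t ht ω =>
    abs_interpolationDeriv_le (M := M) hh ht.1 ht.2 (hc ω) (y ω)
  have hderiv : ∀ ω, ∀ t ∈ Set.Icc (0 : ℝ) 1, HasDerivAt (interpolation M h (c ω) (y ω))
      (interpolationDeriv M h t (c ω) (y ω)) t := fun ω t ht =>
    hasDerivAt_interpolation (M := M) hh (hc ω) ht.2
  obtain ⟨t, ht, h1⟩ := exists_integral_deriv_eq (μ := μ) hmeas' hDm hC hDb hderiv
  refine ⟨t, ht, ?_⟩
  simpa only [interpolation_one, interpolation_zero hh, integral_const, probReal_univ,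
    one_smul] using h1

/-- **Interpolation identity.** For a functional `h` that is Lipschitz for the total variation
distance, the difference of the expectations of `h` for a finite point process and for a Poisson
process equals the defect in the Mecke identity for a function `F` with bounded differences. -/
theorem exists_stein_function {Ω : Type*} [MeasurableSpace Ω] (μ : Measure Ω)
    [IsProbabilityMeasure μ] {c : Ω → Fin n → ℕ} {y : Ω → Fin n → Y} (hcm : Measurable c)
    (hym : Measurable y) (hc : ∀ ω i, c ω i ≤ 1) (hh : IsLip h) :
    ∃ F : Y → (Fin n → ℕ) → (Fin n → Y) → ℝ,
      (Measurable fun p : Y × (Fin n → ℕ) × (Fin n → Y) => F p.1 p.2.1 p.2.2) ∧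
      (∀ z c y, |F z c y| ≤ 1) ∧ (∀ z z' c y, |F z c y - F z' c y| ≤ 1) ∧
      (∀ (z : Y) (c c' : Fin n → ℕ) (y y' : Fin n → Y) (d : Fin n → ℝ≥0∞), (∀ i, c i ≤ 1) →
        (∀ i, c' i ≤ 1) → (∀ i, Mismatch c y c' y' i → 1 ≤ d i) →
        ENNReal.ofReal |F z c y - F z c' y'| ≤ 2 * ∑ i, d i) ∧
      ∫ ω, h (weighted (c ω) (y ω)) ∂μ - ∫ η, h η ∂poissonLaw M =
        ∫ ω, (∑ i, c ω i * F (y ω i) (Function.update (c ω) i 0) (y ω) -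
          ∫ z, F z (c ω) (y ω) ∂M) ∂μ := by
  obtain ⟨t, ht, hint⟩ := exists_integral_interpolationDeriv_eq (M := M) μ hcm hym hc hh
  exact ⟨addPointCost M h t, measurable_addPointCost hh t,
    abs_addPointCost_le hh ht.1.le ht.2.le, abs_addPointCost_sub_le_one hh ht.1.le ht.2.le,
    fun z c c' y y' d h1 h2 h3 => ofReal_abs_addPointCost_sub_le hh ht.1.le ht.2.le z h1 h2 h3,
    hint⟩

end SteinFunction

/-! ### The total variation distance -/

section TotalVariation

variable {Y : Type*} [MeasurableSpace Y]

theorem ofReal_abs_sub_le_dTV (L M : Measure Y) [IsFiniteMeasure L] [IsFiniteMeasure M] {A : Set Y}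
    (hA : MeasurableSet A) : ENNReal.ofReal |L.real A - M.real A| ≤ dTV L M :=
  le_iSup₂_of_le A ⟨hA, measure_lt_top _ _, measure_lt_top _ _⟩ le_rfl

/-- A function with values in an interval `[a, a + 1]`, `-1 ≤ a ≤ 0`, is integrated against the
positive part of `L - M` with weight at most `a + 1` and against its negative part with weight at
most `-a`; these weights add up to `1`. -/
theorem integral_sub_le_of_real_le (L M : Measure Y) [IsFiniteMeasure L] [IsFiniteMeasure M]
    {D : ℝ} (hD : ∀ A, MeasurableSet A → |L.real A - M.real A| ≤ D) {u : Y → ℝ}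
    (hu : Measurable u) (h1 : ∀ z, |u z| ≤ 1) (h2 : ∀ z z', |u z - u z'| ≤ 1) :
    ∫ z, u z ∂L - ∫ z, u z ∂M ≤ D := by
  obtain hY | hY := isEmpty_or_nonempty Y
  · have hL : L = 0 := Measure.eq_zero_of_isEmpty L
    have hM : M = 0 := Measure.eq_zero_of_isEmpty M
    rw [hL, hM]
    simpa using (abs_nonneg _).trans (hD ∅ MeasurableSet.empty)
  obtain ⟨a, ha1, ha0, hau, hua⟩ : ∃ a : ℝ, -1 ≤ a ∧ a ≤ 0 ∧ (∀ z, a ≤ u z) ∧ ∀ z, u z ≤ a + 1 := by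
    have hbdd : BddBelow (Set.range u) := ⟨-1, by rintro _ ⟨z, rfl⟩; exact (abs_le.1 (h1 z)).1⟩
    refine ⟨min 0 (⨅ z, u z), le_min (by norm_num) (le_ciInf fun z => (abs_le.1 (h1 z)).1),
      min_le_left _ _, fun z => (min_le_right _ _).trans (ciInf_le hbdd z), fun z => ?_⟩
    rw [← min_add_add_right]
    refine le_min (by simpa using (abs_le.1 (h1 z)).2) ?_
    rw [← sub_le_iff_le_add]
    refine le_ciInf fun z' => ?_
    have := (abs_le.1 (h2 z z')).2
    linarith
  obtain ⟨s, hs, hsL, hsM⟩ := hahn_decomposition L M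
  have hui : ∀ μ : Measure Y, IsFiniteMeasure μ → Integrable u μ := fun μ _ =>
    Integrable.of_bound hu.aestronglyMeasurable 1 (Filter.Eventually.of_forall h1)
  have hle1 : M.restrict s ≤ L.restrict s := by
    refine Measure.le_iff.2 fun t ht => ?_
    rw [Measure.restrict_apply ht, Measure.restrict_apply ht]
    exact hsL _ (ht.inter hs) Set.inter_subset_right
  have hle2 : L.restrict sᶜ ≤ M.restrict sᶜ := by
    refine Measure.le_iff.2 fun t ht => ?_
    rw [Measure.restrict_apply ht, Measure.restrict_apply ht]
    exact hsM _ (ht.inter hs.compl) Set.inter_subset_right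
  have e1 : ∫ z in s, (a + 1 - u z) ∂M ≤ ∫ z in s, (a + 1 - u z) ∂L :=
    integral_mono_measure hle1 (Filter.Eventually.of_forall fun z => sub_nonneg.2 (hua z))
      ((integrable_const _).sub (hui _ inferInstance))
  have e2 : ∫ z in sᶜ, (u z - a) ∂L ≤ ∫ z in sᶜ, (u z - a) ∂M :=
    integral_mono_measure hle2 (Filter.Eventually.of_forall fun z => sub_nonneg.2 (hau z))
      ((hui _ inferInstance).sub (integrable_const _))
  rw [integral_sub (integrable_const _) (hui _ inferInstance),
    integral_sub (integrable_const _) (hui _ inferInstance), setIntegral_const, setIntegral_const,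
    smul_eq_mul, smul_eq_mul] at e1
  rw [integral_sub (hui _ inferInstance) (integrable_const _),
    integral_sub (hui _ inferInstance) (integrable_const _), setIntegral_const, setIntegral_const,
    smul_eq_mul, smul_eq_mul] at e2
  rw [← integral_add_compl hs (hui L inferInstance), ← integral_add_compl hs (hui M inferInstance)]
  have d1 := (abs_le.1 (hD s hs)).2
  have d2 := (abs_le.1 (hD sᶜ hs.compl)).1
  nlinarith

theorem ofReal_abs_integral_sub_le_dTV (L M : Measure Y) [IsFiniteMeasure L] [IsFiniteMeasure M]
    {u : Y → ℝ} (hu : Measurable u) (h1 : ∀ z, |u z| ≤ 1) (h2 : ∀ z z', |u z - u z'| ≤ 1) :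
    ENNReal.ofReal |∫ z, u z ∂L - ∫ z, u z ∂M| ≤ dTV L M := by
  by_cases htop : dTV L M = ∞
  · rw [htop]; exact le_top
  have hD : ∀ A, MeasurableSet A → |L.real A - M.real A| ≤ (dTV L M).toReal := fun A hA =>
    (ENNReal.ofReal_le_iff_le_toReal htop).1 (ofReal_abs_sub_le_dTV L M hA)
  rw [ENNReal.ofReal_le_iff_le_toReal htop, abs_le]
  have e1 := integral_sub_le_of_real_le L M hD hu h1 h2
  have e2 := integral_sub_le_of_real_le M L (fun A hA => abs_sub_comm (M.real A) _ ▸ hD A hA) hu h1 h2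
  constructor <;> linarith

theorem dTV_triangle (K L M : Measure Y) [IsFiniteMeasure L] : dTV K M ≤ dTV K L + dTV L M := by
  refine iSup₂_le fun A hA => ?_
  calc ENNReal.ofReal |(K A).toReal - (M A).toReal|
      ≤ ENNReal.ofReal (|(K A).toReal - (L A).toReal| + |(L A).toReal - (M A).toReal|) :=
        ENNReal.ofReal_le_ofReal (abs_sub_le _ _ _)
    _ = ENNReal.ofReal |(K A).toReal - (L A).toReal| +
        ENNReal.ofReal |(L A).toReal - (M A).toReal| :=
        ENNReal.ofReal_add (abs_nonneg _) (abs_nonneg _)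
    _ ≤ _ := add_le_add (le_iSup₂_of_le A ⟨hA.1, hA.2.1, measure_lt_top _ _⟩ le_rfl)
        (le_iSup₂_of_le A ⟨hA.1, measure_lt_top _ _, hA.2.2⟩ le_rfl)

end TotalVariation

/-! ### Point configurations and binomial processes -/

section Binomial

variable {X : Type*} [MeasurableSpace X]

theorem measurable_config_iff {T : Type*} [MeasurableSpace T] {F : T → Config X} :
    Measurable F ↔ ∀ B, MeasurableSet B → Measurable fun t => (F t).1 B := by
  constructor
  · intro h B hB
    exact (Measure.measurable_coe hB).comp (measurable_subtype_coe.comp h)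
  · intro h
    exact Measurable.subtype_mk (Measure.measurable_of_measurable_coe _ h)

theorem Measurable.config_add {T : Type*} [MeasurableSpace T] {F : T → Config X} {x : T → X}
    (hF : Measurable F) (hx : Measurable x) : Measurable fun t => (F t).add (x t) := by
  rw [measurable_config_iff]
  intro B hB
  have h : ∀ t, ((F t).add (x t)).1 B = (F t).1 B + B.indicator 1 (x t) := fun t => by
    simp [Config.add, Measure.dirac_apply' _ hB]
  simp only [h]
  exact (measurable_config_iff.1 hF B hB).add ((measurable_one.indicator hB).comp hx)

variable {n : ℕ}

/-- The configuration `∑ j ∉ J, δ_{p j}`. -/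
def partialPoints (J : Finset (Fin n)) (p : Fin n → X) : Config X :=
  ⟨∑ j ∈ Jᶜ, Measure.dirac (p j), by
    refine ⟨?_, ?_⟩
    · have : IsFiniteMeasure (∑ j ∈ Jᶜ, Measure.dirac (p j)) := inferInstance
      infer_instance
    · have h := isCounting_sum_smul_dirac (fun j => if j ∈ J then 0 else 1) p
      convert h using 1
      simp only [ite_smul, zero_smul, one_smul]
      rw [Finset.sum_ite, Finset.sum_const_zero, zero_add]
      congr 1
      ext j
      simp⟩

theorem partialPoints_empty (p : Fin n → X) : partialPoints ∅ p = ofPoints p := by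
  refine Subtype.ext ?_
  simp [partialPoints, ofPoints]

theorem partialPoints_update {J : Finset (Fin n)} {i : Fin n} (hi : i ∉ J) (p : Fin n → X) (x : X) :
    partialPoints J (Function.update p i x) = (partialPoints (insert i J) p).add x := by
  refine Subtype.ext ?_
  simp only [partialPoints, Config.add]
  rw [← Finset.add_sum_erase _ _ (Finset.mem_compl.2 hi), Function.update_self, add_comm,
    Finset.compl_insert]
  congr 1
  exact Finset.sum_congr rfl fun j hj => by rw [Function.update_of_ne (Finset.ne_of_mem_erase hj)]

theorem measurable_partialPoints (J : Finset (Fin n)) :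
    Measurable (partialPoints J : (Fin n → X) → Config X) := by
  rw [measurable_config_iff]
  intro B hB
  have h : ∀ p : Fin n → X, (partialPoints J p).1 B = ∑ j ∈ Jᶜ, B.indicator 1 (p j) := fun p => by
    simp [partialPoints, Measure.finsetSum_apply, Measure.dirac_apply' _ hB]
  simp only [h]
  exact Finset.measurable_fun_sum _ fun j _ =>
    (measurable_one.indicator hB).comp (measurable_pi_apply j)

theorem measurable_ofPoints : Measurable (ofPoints : (Fin n → X) → Config X) := by
  have h : (partialPoints ∅ : (Fin n → X) → Config X) = ofPoints := funext partialPoints_empty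
  exact h ▸ measurable_partialPoints ∅

theorem ofPoints_update (p : Fin n → X) (i : Fin n) (x : X) :
    ofPoints (Function.update p i x) = (partialPoints {i} p).add x := by
  rw [← partialPoints_empty, partialPoints_update (Finset.notMem_empty i)]
  rfl

theorem ofPoints_update_update (p : Fin n → X) {i j : Fin n} (hij : i ≠ j) (x y : X) :
    ofPoints (Function.update (Function.update p i x) j y) =
      ((partialPoints {i, j} p).add x).add y := by
  rw [ofPoints_update, partialPoints_update (by simpa using hij)]

theorem ofPoints_update_update_update (p : Fin n → X) {i j k : Fin n} (hij : i ≠ j) (hik : i ≠ k)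
    (hjk : j ≠ k) (x y z : X) :
    ofPoints (Function.update (Function.update (Function.update p i x) j y) k z) =
      (((partialPoints {i, j, k} p).add x).add y).add z := by
  rw [ofPoints_update, partialPoints_update (by simpa using hjk), partialPoints_update]
  simp [hij, hik]

variable (Q : Measure X) [IsProbabilityMeasure Q]

instance (m : ℤ) : IsFiniteMeasure (binomialLaw Q m) := by
  rw [binomialLaw]
  split_ifs <;> infer_instance

/-- Omitting the points with index in `J` from `n` independent points leaves a binomial process. -/
theorem map_partialPoints (J : Finset (Fin n)) :
    (Measure.pi fun _ : Fin n => Q).map (partialPoints J) = binomialLaw Q (n - J.card) := by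
  have hcard : (Jᶜ : Finset (Fin n)).card = ((n : ℤ) - J.card).toNat := by
    rw [Finset.card_compl, Fintype.card_fin]; omega
  have hnn : 0 ≤ (n : ℤ) - J.card := by
    have := J.card_le_univ
    rw [Fintype.card_fin] at this
    omega
  rw [binomialLaw, if_pos hnn]
  let e := (Jᶜ : Finset (Fin n)).orderEmbOfFin hcard
  have hcoord : (Measure.pi fun _ : Fin n => Q).map (fun p j => p (e j)) =
      Measure.pi fun _ : Fin ((n : ℤ) - J.card).toNat => Q := by
    have hind : iIndepFun (fun (j : Fin n) (p : Fin n → X) => p j) (Measure.pi fun _ : Fin n => Q) :=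
      iIndepFun_pi (X := fun _ x => x) fun _ => aemeasurable_id
    have h := (iIndepFun_iff_map_fun_eq_pi_map (fun j => (measurable_pi_apply (e j)).aemeasurable)).1
      (hind.precomp e.injective)
    rw [h]
    congr 1
    funext j
    exact (measurePreserving_eval (fun _ : Fin n => Q) (e j)).map_eq
  rw [← hcoord, Measure.map_map measurable_ofPoints (by fun_prop)]
  congr 1
  funext p
  refine Subtype.ext ?_
  simp only [partialPoints, ofPoints, Function.comp]
  have hmap : (Jᶜ : Finset (Fin n)) = Finset.univ.map e.toEmbedding := by
    ext j
    simp only [Finset.mem_map, Finset.mem_univ, true_and]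
    have := Finset.range_orderEmbOfFin (Jᶜ : Finset (Fin n)) hcard
    rw [← Finset.mem_coe, ← this]
    rfl
  rw [hmap, Finset.sum_map]
  rfl

/-- Replacing one of `n` independent points by a further independent point does not change their
joint law. -/
theorem measurePreserving_update (i : Fin n) :
    MeasurePreserving (fun q : X × (Fin n → X) => Function.update q.2 i q.1)
      (Q.prod (Measure.pi fun _ : Fin n => Q)) (Measure.pi fun _ : Fin n => Q) := by
  have hm : Measurable fun q : X × (Fin n → X) => Function.update q.2 i q.1 := by
    refine measurable_pi_lambda _ fun j => ?_
    by_cases hj : j = i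
    · subst hj; simp only [Function.update_self]; exact measurable_fst
    · simp only [Function.update_of_ne hj]; exact (measurable_pi_apply j).comp measurable_snd
  refine ⟨hm, (Measure.pi_eq fun s hs => ?_).symm⟩
  rw [Measure.map_apply hm (MeasurableSet.univ_pi hs)]
  have : (fun q : X × (Fin n → X) => Function.update q.2 i q.1) ⁻¹' Set.univ.pi s =
      s i ×ˢ Set.univ.pi (Function.update s i Set.univ) := by
    ext q
    simp only [Set.mem_preimage, Set.mem_pi, Set.mem_univ, true_imp_iff, Set.mem_prod]
    constructor
    · intro h
      refine ⟨by simpa using h i, fun j => ?_⟩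
      by_cases hj : j = i
      · subst hj; simp
      · simpa [hj] using h j
    · rintro ⟨h1, h2⟩ j
      by_cases hj : j = i
      · subst hj; simpa using h1
      · simpa [hj] using h2 j
  rw [this, Measure.prod_prod, Measure.pi_pi, ← Finset.mul_prod_erase _ _ (Finset.mem_univ i),
    ← Finset.mul_prod_erase Finset.univ (fun j => Q (s j)) (Finset.mem_univ i)]
  simp only [Function.update_self, measure_univ, one_mul]
  congr 1
  exact Finset.prod_congr rfl fun j hj => by rw [Function.update_of_ne (Finset.ne_of_mem_erase hj)]

theorem lintegral_pi_update (i : Fin n) {Φ : (Fin n → X) → ℝ≥0∞} (hΦ : Measurable Φ) :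
    ∫⁻ p, Φ p ∂(Measure.pi fun _ : Fin n => Q) =
      ∫⁻ x, ∫⁻ p, Φ (Function.update p i x) ∂(Measure.pi fun _ : Fin n => Q) ∂Q := by
  rw [← (measurePreserving_update Q i).lintegral_comp hΦ]
  exact lintegral_prod _ (hΦ.comp (measurePreserving_update Q i).measurable).aemeasurable

theorem lintegral_partialPoints (J : Finset (Fin n)) {u : Config X → ℝ≥0∞} (hu : Measurable u) :
    ∫⁻ p, u (partialPoints J p) ∂(Measure.pi fun _ : Fin n => Q) =
      ∫⁻ β, u β ∂binomialLaw Q (n - J.card) := by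
  rw [← map_partialPoints, lintegral_map hu (measurable_partialPoints J)]

end Binomial

/-! ### Resampling the points inside a set -/

section Resampling

variable {X : Type*} {n : ℕ}

open Classical in
/-- The points of `p` outside `A`, with every point inside `A` replaced by the point of `z` with the
same index. -/
def resample (A : Set X) (p z : Fin n → X) : Fin n → X := fun j => if p j ∈ A then z j else p j

theorem resample_of_mem {A : Set X} {p z : Fin n → X} {j : Fin n} (h : p j ∈ A) :
    resample A p z j = z j := if_pos h

theorem resample_of_notMem {A : Set X} {p z : Fin n → X} {j : Fin n} (h : p j ∉ A) :
    resample A p z j = p j := if_neg h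

variable [MeasurableSpace X]

theorem measurable_resample {A : Set X} (hA : MeasurableSet A) :
    Measurable fun q : (Fin n → X) × (Fin n → X) => resample A q.1 q.2 :=
  measurable_pi_lambda _ fun j => Measurable.ite
    (((measurable_pi_apply j).comp measurable_fst) hA)
    ((measurable_pi_apply j).comp measurable_snd) ((measurable_pi_apply j).comp measurable_fst)

open Classical in
/-- Exchange the two coordinates if the first one is outside `A`. -/
def exchange (A : Set X) (q : X × X) : X × X := if q.1 ∈ A then q else q.swap

theorem measurable_exchange {A : Set X} (hA : MeasurableSet A) : Measurable (exchange A) :=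
  Measurable.ite (measurable_fst hA) measurable_id measurable_swap

variable {Q ν : Measure X} [IsProbabilityMeasure Q] [IsProbabilityMeasure ν]

/-- If `ν` is proportional to the restriction of `Q` to the complement of `A`, then the exchange
takes place only between two points with the same law `ν`. -/
theorem measurePreserving_exchange {A : Set X} (hA : MeasurableSet A) {a : ℝ≥0∞}
    (hν : Q.restrict Aᶜ = a • ν) :
    MeasurePreserving (exchange A) (Q.prod ν) (Q.prod ν) := by
  refine ⟨measurable_exchange hA, ?_⟩
  have hQ : Q.prod ν = (Q.restrict A).prod ν + (Q.restrict Aᶜ).prod ν := by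
    rw [← Measure.add_prod, Measure.restrict_add_restrict_compl hA]
  conv_lhs => rw [hQ]
  rw [Measure.map_add _ _ (measurable_exchange hA)]
  conv_rhs => rw [hQ]
  congr 1
  · have : exchange A =ᵐ[(Q.restrict A).prod ν] id := by
      have h : ∀ᵐ q ∂((Q.restrict A).prod ν), q.1 ∈ A :=
        Measure.quasiMeasurePreserving_fst.ae (ae_restrict_mem hA)
      filter_upwards [h] with q hq
      simp [exchange, hq]
    rw [Measure.map_congr this, Measure.map_id]
  · have : exchange A =ᵐ[(Q.restrict Aᶜ).prod ν] Prod.swap := by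
      have h : ∀ᵐ q ∂((Q.restrict Aᶜ).prod ν), q.1 ∈ Aᶜ :=
        Measure.quasiMeasurePreserving_fst.ae (ae_restrict_mem hA.compl)
      filter_upwards [h] with q hq
      have : q.1 ∉ A := hq
      simp [exchange, this]
    rw [Measure.map_congr this, hν, Measure.prod_smul_left, Measure.map_smul, Measure.prod_swap]

open Classical in
/-- The exchange of `q j` and `z j`, for all `j ∉ J` with `q j ∉ A`. -/
def exchangeAll (A : Set X) (J : Finset (Fin n)) (q : (Fin n → X) × (Fin n → X)) :
    (Fin n → X) × (Fin n → X) :=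
  (fun j => if j ∈ J ∨ q.1 j ∈ A then q.1 j else q.2 j,
    fun j => if j ∈ J ∨ q.1 j ∈ A then q.2 j else q.1 j)

theorem measurePreserving_exchangeAll {A : Set X} (hA : MeasurableSet A) {a : ℝ≥0∞}
    (hν : Q.restrict Aᶜ = a • ν) (J : Finset (Fin n)) :
    MeasurePreserving (exchangeAll A J)
      ((Measure.pi fun _ : Fin n => Q).prod (Measure.pi fun _ : Fin n => ν))
      ((Measure.pi fun _ : Fin n => Q).prod (Measure.pi fun _ : Fin n => ν)) := by
  classical
  have h1 := measurePreserving_arrowProdEquivProdArrow X X (Fin n) (fun _ => Q) (fun _ => ν)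
  have h2 : MeasurePreserving (fun (q : Fin n → X × X) j => if j ∈ J then q j else exchange A (q j))
      (Measure.pi fun _ : Fin n => Q.prod ν) (Measure.pi fun _ : Fin n => Q.prod ν) := by
    refine measurePreserving_pi (f := fun j (r : X × X) => if j ∈ J then r else exchange A r) _ _
      fun j => ?_
    by_cases hj : j ∈ J
    · simp only [hj, if_true]; exact MeasurePreserving.id _
    · simp only [hj, if_false]; exact measurePreserving_exchange hA hν
  have heq : exchangeAll A J = MeasurableEquiv.arrowProdEquivProdArrow X X (Fin n) ∘
      ((fun (q : Fin n → X × X) j => if j ∈ J then q j else exchange A (q j)) ∘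
        (MeasurableEquiv.arrowProdEquivProdArrow X X (Fin n)).symm) := by
    funext q
    refine Prod.ext (funext fun j => ?_) (funext fun j => ?_) <;>
    · by_cases hj : j ∈ J
      · simp [exchangeAll, MeasurableEquiv.arrowProdEquivProdArrow,
          Equiv.arrowProdEquivProdArrow, hj]
      · by_cases hq : q.1 j ∈ A <;>
        simp [exchangeAll, MeasurableEquiv.arrowProdEquivProdArrow,
          Equiv.arrowProdEquivProdArrow, hj, exchange, hq]
  rw [heq]
  exact h1.comp (h2.comp h1.symm)

/-- `W q` depends only on the points of `q` with index different from `i` that lie inside `A`. -/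
def DependsInside {E : Type*} (A : Set X) (i : Fin n) (W : (Fin n → X) → E) : Prop :=
  ∀ q q' : Fin n → X, (∀ j, j ≠ i → (q j ∈ A ↔ q' j ∈ A) ∧ (q j ∈ A → q j = q' j)) → W q = W q'

/-- The points inside `A` are independent of the resampled configuration, whose points all have the
law `ν`. The `i`-th point is replaced by a fixed point `x ∈ A` beforehand. -/
theorem measurePreserving_resample_update {E : Type*} [MeasurableSpace E] {A : Set X}
    (hA : MeasurableSet A) {a : ℝ≥0∞} (hν : Q.restrict Aᶜ = a • ν) (hνA : ν A = 0) {i : Fin n}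
    {x : X} (hx : x ∈ A)
    {W : (Fin n → X) → E} (hWm : Measurable W) (hW : DependsInside A i W) :
    MeasurePreserving (fun q : (Fin n → X) × (Fin n → X) =>
        (W q.1, resample A (Function.update q.1 i x) q.2))
      ((Measure.pi fun _ : Fin n => Q).prod (Measure.pi fun _ : Fin n => ν))
      (((Measure.pi fun _ : Fin n => Q).map W).prod (Measure.pi fun _ : Fin n => ν)) := by
  classical
  have : IsProbabilityMeasure ((Measure.pi fun _ : Fin n => Q).map W) :=
    Measure.isProbabilityMeasure_map hWm.aemeasurable
  have h1 : MeasurePreserving (Prod.map W (id : (Fin n → X) → (Fin n → X)))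
      ((Measure.pi fun _ : Fin n => Q).prod (Measure.pi fun _ : Fin n => ν))
      (((Measure.pi fun _ : Fin n => Q).map W).prod (Measure.pi fun _ : Fin n => ν)) :=
    (hWm.measurePreserving _).prod (MeasurePreserving.id _)
  have hae : ∀ᵐ q ∂((Measure.pi fun _ : Fin n => Q).prod (Measure.pi fun _ : Fin n => ν)),
      ∀ j, q.2 j ∉ A := by
    refine Measure.quasiMeasurePreserving_snd.ae (p := fun z : Fin n → X => ∀ j, z j ∉ A) ?_
    refine ae_all_iff.2 fun j => ?_
    exact (Measure.quasiMeasurePreserving_eval (fun _ : Fin n => ν) j).ae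
      (p := fun z => z ∉ A) (measure_eq_zero_iff_ae_notMem.1 hνA)
  have hum : Measurable fun q : Fin n → X => Function.update q i x := by
    refine measurable_pi_lambda _ fun j => ?_
    by_cases hj : j = i
    · subst hj; simp only [Function.update_self]; exact measurable_const
    · simp only [Function.update_of_ne hj]; exact measurable_pi_apply j
  refine (h1.comp (measurePreserving_exchangeAll hA hν {i})).congr
    ((hWm.comp measurable_fst).prodMk ((measurable_resample hA).comp
      ((hum.comp measurable_fst).prodMk measurable_snd))) ?_
  filter_upwards [hae] with q hq2
  refine Prod.ext (hW _ _ fun j hj => ?_) (funext fun j => ?_)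
  · by_cases hq : q.1 j ∈ A
    · simp [hq]
    · simp [hq, hj, hq2 j]
  · by_cases hj : j = i
    · subst hj; simp [exchangeAll, resample, hx]
    · simp [exchangeAll, resample, hj]

theorem measurePreserving_resample {A : Set X} (hA : MeasurableSet A) {a : ℝ≥0∞}
    (hν : Q.restrict Aᶜ = a • ν) :
    MeasurePreserving (fun q : (Fin n → X) × (Fin n → X) => resample A q.1 q.2)
      ((Measure.pi fun _ : Fin n => Q).prod (Measure.pi fun _ : Fin n => ν))
      (Measure.pi fun _ : Fin n => ν) := by
  refine (measurePreserving_snd.comp (measurePreserving_exchangeAll hA hν ∅)).congr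
    (measurable_resample hA) (Filter.Eventually.of_forall fun q => funext fun j => ?_)
  by_cases hq : q.1 j ∈ A <;> simp [exchangeAll, resample, hq]

end Resampling

/-! ### Expectations of functionals of independent points -/

section Expectations

variable {X : Type*} [MeasurableSpace X] {n : ℕ} (μ : Measure X) [IsProbabilityMeasure μ]

theorem lintegral_pi_eval (j : Fin n) {u : X → ℝ≥0∞} (hu : Measurable u) :
    ∫⁻ p, u (p j) ∂(Measure.pi fun _ : Fin n => μ) = ∫⁻ y, u y ∂μ :=
  (measurePreserving_eval (fun _ : Fin n => μ) j).lintegral_comp hu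

/-- In this and the following lemmas, one to three of `n` independent points are fixed, and the
remaining ones form a binomial process. -/
theorem lintegral_ofPoints_update (i : Fin n) (x : X) {u : Config X → ℝ≥0∞} (hu : Measurable u) :
    ∫⁻ q, u (ofPoints (Function.update q i x)) ∂(Measure.pi fun _ : Fin n => μ) =
      ∫⁻ β, u (β.add x) ∂binomialLaw μ (n - 1) := by
  simp only [ofPoints_update]
  rw [lintegral_partialPoints μ {i} (u := fun β => u (β.add x))
    (hu.comp (Measurable.config_add measurable_id measurable_const))]
  simp

theorem lintegral_ofPoints_eval (j : Fin n) {G : X → Config X → ℝ≥0∞}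
    (hG : Measurable fun q : X × Config X => G q.1 q.2) :
    ∫⁻ p, G (p j) (ofPoints p) ∂(Measure.pi fun _ : Fin n => μ) =
      ∫⁻ y, ∫⁻ β, G y (β.add y) ∂binomialLaw μ (n - 1) ∂μ := by
  refine (lintegral_pi_update μ j (Φ := fun p => G (p j) (ofPoints p))
    (hG.comp ((measurable_pi_apply j).prodMk measurable_ofPoints))).trans
    (lintegral_congr fun y => ?_)
  simp only [Function.update_self]
  exact lintegral_ofPoints_update μ j y (hG.comp (measurable_const.prodMk measurable_id))

theorem measurable_update_const (i : Fin n) (x : X) :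
    Measurable fun q : Fin n → X => Function.update q i x :=
  measurable_pi_lambda _ fun j => by
    by_cases hj : j = i
    · subst hj; simp only [Function.update_self]; exact measurable_const
    · simp only [Function.update_of_ne hj]; exact measurable_pi_apply j

theorem lintegral_ofPoints_update_eval {i j : Fin n} (hij : i ≠ j) (x : X)
    {G : X → Config X → ℝ≥0∞} (hG : Measurable fun q : X × Config X => G q.1 q.2) :
    ∫⁻ q, G (Function.update q i x j) (ofPoints (Function.update q i x))
        ∂(Measure.pi fun _ : Fin n => μ) =
      ∫⁻ y, ∫⁻ β, G y ((β.add x).add y) ∂binomialLaw μ (n - 2) ∂μ := by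
  have hm : Measurable fun q : Fin n → X =>
      G (Function.update q i x j) (ofPoints (Function.update q i x)) :=
    hG.comp (((measurable_pi_apply j).comp (measurable_update_const i x)).prodMk
      (measurable_ofPoints.comp (measurable_update_const i x)))
  rw [lintegral_pi_update μ j hm]
  refine lintegral_congr fun y => ?_
  have h : ∀ q : Fin n → X, G (Function.update (Function.update q j y) i x j)
      (ofPoints (Function.update (Function.update q j y) i x)) =
      G y (((partialPoints {i, j} q).add x).add y) := fun q => by
    rw [Function.update_comm hij.symm, ofPoints_update_update q hij, Function.update_self]
  simp only [h]
  rw [lintegral_partialPoints μ {i, j} (u := fun β => G y ((β.add x).add y))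
    (hG.comp (measurable_const.prodMk (Measurable.config_add
      (Measurable.config_add measurable_id measurable_const) measurable_const))),
    Finset.card_pair hij]
  rfl

theorem lintegral_ofPoints_eval_eval {j l : Fin n} (hjl : j ≠ l) {G : X → X → Config X → ℝ≥0∞}
    (hG : Measurable fun q : X × X × Config X => G q.1 q.2.1 q.2.2) :
    ∫⁻ p, G (p j) (p l) (ofPoints p) ∂(Measure.pi fun _ : Fin n => μ) =
      ∫⁻ y, ∫⁻ w, ∫⁻ β, G y w ((β.add y).add w) ∂binomialLaw μ (n - 2) ∂μ ∂μ := by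
  refine (lintegral_pi_update μ j (Φ := fun p => G (p j) (p l) (ofPoints p))
    (hG.comp ((measurable_pi_apply j).prodMk
      ((measurable_pi_apply l).prodMk measurable_ofPoints)))).trans (lintegral_congr fun y => ?_)
  simp only [Function.update_self]
  exact lintegral_ofPoints_update_eval μ hjl y (G := G y)
    (hG.comp (measurable_const.prodMk measurable_id))

theorem lintegral_ofPoints_update_eval_eval {i j l : Fin n} (hij : i ≠ j) (hil : i ≠ l)
    (hjl : j ≠ l) (x : X) {G : X → X → Config X → ℝ≥0∞}
    (hG : Measurable fun q : X × X × Config X => G q.1 q.2.1 q.2.2) :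
    ∫⁻ q, G (Function.update q i x j) (Function.update q i x l) (ofPoints (Function.update q i x))
        ∂(Measure.pi fun _ : Fin n => μ) =
      ∫⁻ y, ∫⁻ w, ∫⁻ β, G y w (((β.add x).add y).add w) ∂binomialLaw μ (n - 3) ∂μ ∂μ := by
  have hm : Measurable fun q : Fin n → X =>
      G (Function.update q i x j) (Function.update q i x l) (ofPoints (Function.update q i x)) :=
    hG.comp (((measurable_pi_apply j).comp (measurable_update_const i x)).prodMk
      (((measurable_pi_apply l).comp (measurable_update_const i x)).prodMk
      (measurable_ofPoints.comp (measurable_update_const i x))))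
  rw [lintegral_pi_update μ j hm]
  refine lintegral_congr fun y => ?_
  refine (lintegral_pi_update μ l (Φ := fun q => G (Function.update (Function.update q j y) i x j)
    (Function.update (Function.update q j y) i x l)
    (ofPoints (Function.update (Function.update q j y) i x)))
    (hm.comp (measurable_update_const j y))).trans (lintegral_congr fun w => ?_)
  have h : ∀ q : Fin n → X, G (Function.update (Function.update (Function.update q l w) j y) i x j)
      (Function.update (Function.update (Function.update q l w) j y) i x l)
      (ofPoints (Function.update (Function.update (Function.update q l w) j y) i x)) =
      G y w ((((partialPoints {i, j, l} q).add x).add y).add w) := fun q => by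
    rw [Function.update_comm hij.symm, Function.update_comm hil.symm, Function.update_comm hjl.symm,
      ofPoints_update_update_update q hij hil hjl]
    simp [hjl]
  simp only [h]
  rw [lintegral_partialPoints μ {i, j, l} (u := fun β => G y w (((β.add x).add y).add w))
    (hG.comp (measurable_const.prodMk (measurable_const.prodMk (Measurable.config_add
      (Measurable.config_add (Measurable.config_add measurable_id measurable_const)
        measurable_const) measurable_const)))),
    Finset.card_eq_three.2 ⟨i, j, l, hij, hil, hjl, rfl⟩]
  rfl

end Expectations

/-! ### Restrictions of configurations -/

section Restriction

variable {X : Type*} [MeasurableSpace X]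

theorem inter_add_of_notMem {ω : Config X} {A : Set X} (hA : MeasurableSet A) {y : X} (hy : y ∉ A) :
    (ω.add y).inter A = ω.inter A := by
  refine Subtype.ext (Measure.ext fun B hB => ?_)
  simp [Config.inter, Config.add, Measure.restrict_apply hB, Measure.dirac_apply' _ (hB.inter hA), hy]

theorem Config.add_right_comm (ω : Config X) (x y : X) : (ω.add x).add y = (ω.add y).add x :=
  Subtype.ext (_root_.add_right_comm ω.1 (Measure.dirac x) (Measure.dirac y))

theorem add_singleton_ne_zero (ω : Config X) (x : X) : (ω.add x).1 {x} ≠ 0 := by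
  have : (1 : ℝ≥0∞) ≤ (ω.add x).1 {x} := by
    refine le_trans ?_ (le_add_self : Measure.dirac x {x} ≤ ω.1 {x} + Measure.dirac x {x})
    rw [Measure.dirac_apply_of_mem (Set.mem_singleton x)]
  exact (zero_lt_one.trans_le this).ne'

theorem add_singleton_ne_zero_of_ne_zero {ω : Config X} {x : X} (h : ω.1 {x} ≠ 0) (y : X) :
    (ω.add y).1 {x} ≠ 0 := by
  have : ω.1 {x} ≤ (ω.add y).1 {x} := (le_self_add : ω.1 {x} ≤ ω.1 {x} + Measure.dirac y {x})
  exact fun h0 => h (le_antisymm (h0 ▸ this) zero_le)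

theorem ofPoints_singleton_ne_zero {n : ℕ} (p : Fin n → X) (j : Fin n) :
    (ofPoints p).1 {p j} ≠ 0 := by
  have h := ofPoints_update p j (p j)
  rw [Function.update_eq_self] at h
  rw [h]
  exact add_singleton_ne_zero _ _

theorem ofPoints_inter_congr {n : ℕ} {A : Set X} (hA : MeasurableSet A) {p p' : Fin n → X}
    (h : ∀ l, p l = p' l ∨ (p l ∉ A ∧ p' l ∉ A)) :
    (ofPoints p).inter A = (ofPoints p').inter A := by
  refine Subtype.ext (Measure.ext fun B hB => ?_)
  simp only [Config.inter, ofPoints, Measure.restrict_apply hB, Measure.finsetSum_apply,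
    Measure.dirac_apply' _ (hB.inter hA)]
  refine Finset.sum_congr rfl fun l _ => ?_
  rcases h l with h | ⟨h1, h2⟩
  · rw [h]
  · rw [Set.indicator_of_notMem fun h => h1 h.2, Set.indicator_of_notMem fun h => h2 h.2]

theorem measurable_config_inter {A : Set X} (hA : MeasurableSet A) :
    Measurable fun ω : Config X => ω.inter A := by
  refine measurable_config_iff.2 fun B hB => ?_
  have h : ∀ ω : Config X, (ω.inter A).1 B = ω.1 (B ∩ A) := fun ω => Measure.restrict_apply hB
  simp only [h]
  exact measurable_config_iff.1 measurable_id _ (hB.inter hA)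

theorem inter_singleton_ne_zero [MeasurableSingletonClass X] {ω : Config X} {A : Set X}
    {x : X} (hx : x ∈ A) (h : ω.1 {x} ≠ 0) : (ω.inter A).1 {x} ≠ 0 := by
  have h1 : (ω.inter A).1 {x} = ω.1 ({x} ∩ A) := Measure.restrict_apply (measurableSet_singleton x)
  rwa [h1, Set.inter_eq_left.2 (Set.singleton_subset_iff.2 hx)]

theorem inter_inter_self (ω : Config X) {A : Set X} (hA : MeasurableSet A) :
    (ω.inter A).inter A = ω.inter A := by
  refine Subtype.ext ?_
  have h : (ω.1.restrict A).restrict A = ω.1.restrict A := by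
    rw [Measure.restrict_restrict hA, Set.inter_self]
  exact h

theorem dependsInside_inter {n : ℕ} {A : Set X} (hA : MeasurableSet A) (i : Fin n) (x : X) :
    DependsInside A i fun p : Fin n → X => (ofPoints (Function.update p i x)).inter A := by
  intro p p' h
  refine ofPoints_inter_congr hA fun j => ?_
  by_cases hj : j = i
  · subst hj; simp
  · rw [Function.update_of_ne hj, Function.update_of_ne hj]
    by_cases hm : p j ∈ A
    · exact Or.inl ((h j hj).2 hm)
    · exact Or.inr ⟨hm, fun h' => hm ((h j hj).1.2 h')⟩

end Restriction

/-! ### Stopping sets and localization -/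

section Localized

variable {X Y : Type*} [TopologicalSpace X] [MeasurableSpace X]

open Classical in
/-- The truncated functional `g(x, ω) 1{𝒮(x, ω) ⊆ S_x}`, as a natural number. -/
def truncNat (g : X → Config X → ℕ) (𝒮 : X → Config X → Closeds X) (S : X → Closeds X)
    (x : X) (ω : Config X) : ℕ :=
  if (𝒮 x ω : Set X) ⊆ S x then g x ω else 0

variable {f : X → Config X → Y} {g : X → Config X → ℕ} {𝒮 : X → Config X → Closeds X}
  {S : X → Closeds X}

theorem trunc_eq_natCast (x : X) (ω : Config X) :
    trunc g 𝒮 S x ω = (truncNat g 𝒮 S x ω : ℝ≥0∞) := by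
  rw [trunc, truncNat]
  split_ifs <;> simp

theorem truncNat_le_one (hg01 : ∀ x ω, g x ω = 0 ∨ g x ω = 1) (x : X) (ω : Config X) :
    truncNat g 𝒮 S x ω ≤ 1 := by
  rw [truncNat]
  split_ifs
  · rcases hg01 x ω with h | h <;> simp [h]
  · exact zero_le_one

theorem ofReal_abs_truncNat (x : X) (ω : Config X) :
    ENNReal.ofReal |(truncNat g 𝒮 S x ω : ℝ)| = trunc g 𝒮 S x ω := by
  rw [trunc_eq_natCast, abs_of_nonneg (Nat.cast_nonneg _), ENNReal.ofReal_natCast]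

theorem abs_truncNat_le_one (hg01 : ∀ x ω, g x ω = 0 ∨ g x ω = 1) (x : X) (ω : Config X) :
    |(truncNat g 𝒮 S x ω : ℝ)| ≤ 1 := by
  rw [abs_of_nonneg (Nat.cast_nonneg _)]
  exact_mod_cast truncNat_le_one hg01 x ω

theorem truncNat_add_excess (x : X) (ω : Config X) :
    (truncNat g 𝒮 S x ω : ℝ≥0∞) + excess g 𝒮 S x ω = g x ω := by
  rw [truncNat, excess]
  split_ifs <;> simp

theorem truncNat_le (x : X) (ω : Config X) : truncNat g 𝒮 S x ω ≤ g x ω := by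
  rw [truncNat]
  split_ifs
  exacts [le_rfl, Nat.zero_le _]

/-- By the stopping property at `S_x`, the truncated functional and its mark are determined by the
points inside `S_x`. -/
theorem truncNat_congr (hloc : IsLocalized f g 𝒮) {x : X} (hst : StoppingAt 𝒮 x (S x))
    (hSm : MeasurableSet (S x : Set X)) {ω ω' : Config X} (hx : ω.1 {x} ≠ 0) (hx' : ω'.1 {x} ≠ 0)
    (h : ω.inter (S x) = ω'.inter (S x)) :
    truncNat g 𝒮 S x ω = truncNat g 𝒮 S x ω' ∧
      (truncNat g 𝒮 S x ω ≠ 0 → g x ω = 1 → f x ω = f x ω') := by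
  have h1 : ∀ η : Config X, (𝒮 x η : Set X) ⊆ S x ↔ (𝒮 x (η.inter (S x)) : Set X) ⊆ S x :=
    fun η => Set.ext_iff.1 hst η
  have hiff : (𝒮 x ω : Set X) ⊆ S x ↔ (𝒮 x ω' : Set X) ⊆ S x := by rw [h1 ω, h1 ω', h]
  by_cases hω : (𝒮 x ω : Set X) ⊆ S x
  · obtain ⟨h2, h3⟩ := hloc ω x hx (S x) hSm hω
    obtain ⟨h4, h5⟩ := hloc ω' x hx' (S x) hSm (hiff.1 hω)
    have hg : g x ω = g x ω' := by rw [h2, h4, h]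
    rw [truncNat, truncNat, if_pos hω, if_pos (hiff.1 hω)]
    exact ⟨hg, fun _ h6 => by rw [h3 h6, h5 (hg ▸ h6), h]⟩
  · rw [truncNat, truncNat, if_neg hω, if_neg fun h' => hω (hiff.2 h')]
    simp

theorem trunc_congr (hloc : IsLocalized f g 𝒮) {x : X} (hst : StoppingAt 𝒮 x (S x))
    (hSm : MeasurableSet (S x : Set X)) {ω ω' : Config X} (hx : ω.1 {x} ≠ 0) (hx' : ω'.1 {x} ≠ 0)
    (h : ω.inter (S x) = ω'.inter (S x)) : trunc g 𝒮 S x ω = trunc g 𝒮 S x ω' := by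
  rw [trunc_eq_natCast, trunc_eq_natCast, (truncNat_congr hloc hst hSm hx hx' h).1]

variable [LocallyCompactSpace X] [SecondCountableTopology X]

theorem measurable_truncNat (hg : Measurable fun p : X × Config X => g p.1 p.2)
    (h𝒮 : Measurable[inferInstance, fellSigma X] fun p : X × Config X => 𝒮 p.1 p.2)
    (hS : Measurable[inferInstance, fellSigma X] S) :
    Measurable fun p : X × Config X => truncNat g 𝒮 S p.1 p.2 :=
  Measurable.ite (measurableSet_closeds_subset h𝒮
    (@Measurable.comp _ _ _ _ _ (fellSigma X) _ _ hS measurable_fst)) hg measurable_const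

theorem measurable_trunc (hg : Measurable fun p : X × Config X => g p.1 p.2)
    (h𝒮 : Measurable[inferInstance, fellSigma X] fun p : X × Config X => 𝒮 p.1 p.2)
    (hS : Measurable[inferInstance, fellSigma X] S) :
    Measurable fun p : X × Config X => trunc g 𝒮 S p.1 p.2 := by
  simp only [trunc_eq_natCast]
  exact measurable_from_nat.comp (measurable_truncNat hg h𝒮 hS)

theorem measurable_excess (hg : Measurable fun p : X × Config X => g p.1 p.2)
    (h𝒮 : Measurable[inferInstance, fellSigma X] fun p : X × Config X => 𝒮 p.1 p.2)
    (hS : Measurable[inferInstance, fellSigma X] S) :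
    Measurable fun p : X × Config X => excess g 𝒮 S p.1 p.2 :=
  Measurable.ite (measurableSet_closeds_subset h𝒮
    (@Measurable.comp _ _ _ _ _ (fellSigma X) _ _ hS measurable_fst)) measurable_const
    (measurable_from_nat.comp hg)

theorem measurable_inside [BorelSpace X] (hS : Measurable[inferInstance, fellSigma X] S) :
    Measurable fun p : X × X => inside S p.1 p.2 :=
  Measurable.ite (measurableSet_mem_closeds
    (@Measurable.comp _ _ _ _ _ (fellSigma X) _ _ hS measurable_fst) measurable_snd)
    measurable_const measurable_const

variable [T2Space X]

theorem measurable_meet (hS : Measurable[inferInstance, fellSigma X] S) :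
    Measurable fun p : X × X => meet S p.1 p.2 :=
  Measurable.ite (measurableSet_closeds_meet
    (@Measurable.comp _ _ _ _ _ (fellSigma X) _ _ hS measurable_fst)
    (@Measurable.comp _ _ _ _ _ (fellSigma X) _ _ hS measurable_snd))
    measurable_const measurable_const

theorem measurable_apart (hS : Measurable[inferInstance, fellSigma X] S) :
    Measurable fun p : X × X => apart S p.1 p.2 :=
  Measurable.ite (measurableSet_closeds_meet
    (@Measurable.comp _ _ _ _ _ (fellSigma X) _ _ hS measurable_fst)
    (@Measurable.comp _ _ _ _ _ (fellSigma X) _ _ hS measurable_snd))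
    measurable_const measurable_const

end Localized

/-! ### Values of the indicator functions -/

section Indicators

variable {X : Type*} [TopologicalSpace X] {S : X → Closeds X}

theorem inside_of_mem {x y : X} (h : y ∈ (S x : Set X)) : inside S x y = 1 := if_pos h

theorem inside_of_notMem {x y : X} (h : y ∉ (S x : Set X)) : inside S x y = 0 := if_neg h

theorem apart_of_nonempty {x y : X} (h : ((S x : Set X) ∩ S y).Nonempty) : apart S x y = 0 :=
  if_pos h

theorem apart_of_not_nonempty {x y : X} (h : ¬((S x : Set X) ∩ S y).Nonempty) : apart S x y = 1 :=
  if_neg h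

theorem meet_of_nonempty {x y : X} (h : ((S x : Set X) ∩ S y).Nonempty) : meet S x y = 1 := if_pos h

end Indicators

/-! ### The effect of resampling on the truncated process -/

section Coupling

variable {X Y : Type*} [TopologicalSpace X] [MeasurableSpace X] [MeasurableSpace Y] {n : ℕ}

/-- The standing assumptions: `f` and `g` are localized to `𝒮`, and `𝒮(x, ·)` is stopping at the
truncation set `S_x`, which contains `x` and does not carry all the mass of `Q`. -/
structure IsTruncation (f : X → Config X → Y) (g : X → Config X → ℕ)
    (𝒮 : X → Config X → Closeds X) (S : X → Closeds X) (Q : Measure X) : Prop where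
  measurable_mark : Measurable fun p : X × Config X => f p.1 p.2
  measurable_weight : Measurable fun p : X × Config X => g p.1 p.2
  zero_or_one : ∀ x ω, g x ω = 0 ∨ g x ω = 1
  measurable_stopping : Measurable[inferInstance, fellSigma X] fun p : X × Config X => 𝒮 p.1 p.2
  localized : IsLocalized f g 𝒮
  measurable_set : Measurable[inferInstance, fellSigma X] S
  self_mem : ∀ x, x ∈ S x
  measure_lt_one : ∀ x, Q (S x) < 1
  stopping : ∀ x, StoppingAt 𝒮 x (S x)

variable (f : X → Config X → Y) (g : X → Config X → ℕ) (𝒮 : X → Config X → Closeds X)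
  (S : X → Closeds X)

/-- The weights of the truncated process `∑ g̃(x, ω) δ_{f(x, ω)}` over the points `x` of `ω`. -/
def weightAt (p : Fin n → X) (j : Fin n) : ℕ := truncNat g 𝒮 S (p j) (ofPoints p)

/-- The positions of the truncated process. -/
def markAt (p : Fin n → X) (j : Fin n) : Y := f (p j) (ofPoints p)

open Classical in
/-- The weights of the truncated process, without the points `y` for which `S_y` meets `S_x`. -/
def farWeightAt (x : X) (p : Fin n → X) (j : Fin n) : ℕ :=
  if ((S x : Set X) ∩ S (p j)).Nonempty then 0 else weightAt g 𝒮 S p j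

/-- Contribution of a point `p j` with `S_{p j}` meeting `S_x`. -/
def nearCost (x : X) (j : Fin n) (p : Fin n → X) : ℝ≥0∞ :=
  meet S x (p j) * trunc g 𝒮 S (p j) (ofPoints p)

/-- Contribution of a point `p j` with `S_{p j}` disjoint from `S_x`. -/
def farCost (x : X) (j : Fin n) (p : Fin n → X) : ℝ≥0∞ :=
  apart S x (p j) * trunc g 𝒮 S (p j) (ofPoints p)

/-- Contribution of a point `p j` with `S_{p j}` disjoint from `S_x` and containing `p l`. -/
def farPairCost (x : X) (j l : Fin n) (p : Fin n → X) : ℝ≥0∞ :=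
  apart S x (p j) * inside S (p j) (p l) * trunc g 𝒮 S (p j) (ofPoints p)

/-- Bound for the change at the index `j` when the points of `p` inside `S_x` are replaced by those
of `z`, except for the points close to `S_x`: the replacement `z l` of a point `p l` may lie in the
set `S_{p j}` of a point far from `S_x`, and it may itself contribute to the process or interfere
with a contributing point. -/
def resampleCost (x : X) (p z : Fin n → X) (j : Fin n) : ℝ≥0∞ :=
  ∑ l ∈ Finset.univ.erase j, inside S x (p l) * (inside S (p j) (z l) * farCost g 𝒮 S x j p)
    + (inside S x (p j) * farCost g 𝒮 S x j (resample (S x) p z)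
      + ∑ l ∈ Finset.univ.erase j,
          inside S x (p l) * farPairCost g 𝒮 S x j l (resample (S x) p z))

variable {f g 𝒮 S} {Q : Measure X}

theorem IsTruncation.trunc_eq_one (H : IsTruncation f g 𝒮 S Q) {p : Fin n → X} {j : Fin n}
    (h : weightAt g 𝒮 S p j ≠ 0) : trunc g 𝒮 S (p j) (ofPoints p) = 1 := by
  have h1 : truncNat g 𝒮 S (p j) (ofPoints p) ≤ 1 := truncNat_le_one H.zero_or_one _ _
  have h2 : truncNat g 𝒮 S (p j) (ofPoints p) = 1 := le_antisymm h1 (Nat.one_le_iff_ne_zero.2 h)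
  rw [trunc_eq_natCast, h2, Nat.cast_one]

theorem weight_eq_one_of_truncNat_ne_zero (hg01 : ∀ x ω, g x ω = 0 ∨ g x ω = 1) {x : X}
    {ω : Config X} (h : truncNat g 𝒮 S x ω ≠ 0) : g x ω = 1 := by
  rw [truncNat] at h
  split_ifs at h
  · exact (hg01 x ω).resolve_left h
  · exact absurd rfl h

theorem one_le_resampleCost_of_mem (H : IsTruncation f g 𝒮 S Q) {x : X} {p z : Fin n → X}
    {j : Fin n} (hj : p j ∈ (S x : Set X))
    (h : farWeightAt g 𝒮 S x (resample (S x) p z) j ≠ 0) : 1 ≤ resampleCost g 𝒮 S x p z j := by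
  rw [farWeightAt] at h
  split_ifs at h with hm
  · exact absurd rfl h
  have : inside S x (p j) * farCost g 𝒮 S x j (resample (S x) p z) = 1 := by
    rw [inside_of_mem hj, farCost, apart_of_not_nonempty hm, H.trunc_eq_one h, one_mul, one_mul]
  rw [resampleCost, this]
  exact le_add_left le_self_add

/-- A point whose weight or mark is changed by resampling inside `S_x` is accounted for. -/
theorem one_le_cost_of_mismatch [BorelSpace X] (H : IsTruncation f g 𝒮 S Q) {x : X}
    {p z : Fin n → X} {j : Fin n}
    (h : Mismatch (weightAt g 𝒮 S p) (markAt f p) (farWeightAt g 𝒮 S x (resample (S x) p z))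
      (markAt f (resample (S x) p z)) j) :
    1 ≤ nearCost g 𝒮 S x j p + resampleCost g 𝒮 S x p z j := by
  by_cases hm : ((S x : Set X) ∩ S (p j)).Nonempty
  · by_cases hc : weightAt g 𝒮 S p j = 0
    · have hfar : farWeightAt g 𝒮 S x (resample (S x) p z) j ≠ 0 := fun h0 =>
        h ⟨hc.trans h0.symm, Or.inl hc⟩
      refine le_add_left (one_le_resampleCost_of_mem H ?_ hfar)
      by_contra hj
      rw [farWeightAt, resample_of_notMem hj, if_pos hm] at hfar
      exact hfar rfl
    · refine le_add_right ?_
      rw [nearCost, meet_of_nonempty hm, H.trunc_eq_one hc, one_mul]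
  have hdisj : ∀ y, y ∈ (S x : Set X) → y ∉ (S (p j) : Set X) := fun y h1 h2 => hm ⟨y, h1, h2⟩
  have hj : p j ∉ (S x : Set X) := fun h1 => hdisj _ h1 (H.self_mem _)
  have hpj : resample (S x) p z j = p j := resample_of_notMem hj
  refine le_add_left ?_
  by_cases hl : ∃ l, p l ∈ (S x : Set X) ∧ z l ∈ (S (p j) : Set X)
  · obtain ⟨l, hl1, hl2⟩ := hl
    have hlj : l ∈ Finset.univ.erase j :=
      Finset.mem_erase.2 ⟨fun e => hj (e ▸ hl1), Finset.mem_univ l⟩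
    by_cases hc : weightAt g 𝒮 S p j = 0
    · have hfar : farWeightAt g 𝒮 S x (resample (S x) p z) j ≠ 0 := fun h0 =>
        h ⟨hc.trans h0.symm, Or.inl hc⟩
      rw [farWeightAt] at hfar
      split_ifs at hfar with hm'
      · exact absurd rfl hfar
      have : inside S x (p l) * farPairCost g 𝒮 S x j l (resample (S x) p z) = 1 := by
        rw [inside_of_mem hl1, farPairCost, apart_of_not_nonempty hm', H.trunc_eq_one hfar,
          hpj, resample_of_mem hl1, inside_of_mem hl2, one_mul, one_mul, one_mul]
      refine le_add_left (le_add_left ?_)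
      rw [← this]
      exact Finset.single_le_sum (f := fun l => inside S x (p l) *
        farPairCost g 𝒮 S x j l (resample (S x) p z)) (fun _ _ => zero_le) hlj
    · have : inside S x (p l) * (inside S (p j) (z l) * farCost g 𝒮 S x j p) = 1 := by
        rw [inside_of_mem hl1, farCost, apart_of_not_nonempty hm, H.trunc_eq_one hc,
          inside_of_mem hl2, one_mul, one_mul, one_mul]
      refine le_add_right ?_
      rw [← this]
      exact Finset.single_le_sum (f := fun l => inside S x (p l) *
        (inside S (p j) (z l) * farCost g 𝒮 S x j p)) (fun _ _ => zero_le) hlj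
  · -- no point enters or leaves `S_{p j}`, hence nothing changes at `p j`
    exfalso
    have hinter : (ofPoints p).inter (S (p j)) =
        (ofPoints (resample (S x) p z)).inter (S (p j)) := by
      refine ofPoints_inter_congr (S (p j)).isClosed.measurableSet fun l => ?_
      by_cases h1 : p l ∈ (S x : Set X)
      · refine Or.inr ⟨hdisj _ h1, ?_⟩
        rw [resample_of_mem h1]
        exact fun h2 => hl ⟨l, h1, h2⟩
      · exact Or.inl (resample_of_notMem h1).symm
    have h2 : (ofPoints (resample (S x) p z)).1 {p j} ≠ 0 := by
      have := ofPoints_singleton_ne_zero (resample (S x) p z) j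
      rwa [hpj] at this
    obtain ⟨h3, h4⟩ := truncNat_congr H.localized (H.stopping (p j))
      (S (p j)).isClosed.measurableSet (ofPoints_singleton_ne_zero p j) h2 hinter
    refine h ⟨?_, ?_⟩
    · rw [farWeightAt, hpj, if_neg hm, weightAt, weightAt, hpj]
      exact h3
    · by_cases h0 : weightAt g 𝒮 S p j = 0
      · exact Or.inl h0
      · refine Or.inr ?_
        rw [markAt, markAt, hpj]
        exact h4 h0 (weight_eq_one_of_truncNat_ne_zero H.zero_or_one h0)

/-- The variant of the previous bound for the process without the contribution of a point
`p i ∈ S_x`. -/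
theorem one_le_cost_of_mismatch_update [BorelSpace X] (H : IsTruncation f g 𝒮 S Q) {x : X}
    {p z : Fin n → X} {i j : Fin n} (hi : p i ∈ (S x : Set X))
    (h : Mismatch (Function.update (weightAt g 𝒮 S p) i 0) (markAt f p)
      (farWeightAt g 𝒮 S x (resample (S x) p z)) (markAt f (resample (S x) p z)) j) :
    1 ≤ (if j = i then 0 else nearCost g 𝒮 S x j p) + resampleCost g 𝒮 S x p z j := by
  by_cases hj : j = i
  · subst hj
    refine le_add_left (one_le_resampleCost_of_mem H hi fun h0 => h ?_)
    rw [Function.update_self]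
    exact ⟨h0.symm, Or.inl rfl⟩
  · rw [if_neg hj]
    refine one_le_cost_of_mismatch H fun h' => h ?_
    rwa [Function.update_of_ne hj]

end Coupling

/-! ### Integrals of indicators and of functionals -/

section Integrals

variable {X : Type*} [MeasurableSpace X]

theorem measurable_lintegral_config {T : Type*} [MeasurableSpace T]
    {G : T → Config X → ℝ≥0∞}
    (hG : Measurable fun q : T × Config X => G q.1 q.2) (μ : Measure X) [IsProbabilityMeasure μ]
    (m : ℤ) : Measurable fun t => ∫⁻ β, G t β ∂binomialLaw μ m :=
  hG.lintegral_prod_right'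

variable [TopologicalSpace X] [BorelSpace X] {S : X → Closeds X}

theorem lintegral_inside (μ : Measure X) (x : X) : ∫⁻ z, inside S x z ∂μ = μ (S x) := by
  have h : (fun z => inside S x z) = (S x : Set X).indicator 1 := by
    funext z
    by_cases hz : z ∈ (S x : Set X)
    · rw [inside_of_mem hz, Set.indicator_of_mem hz]; rfl
    · rw [inside_of_notMem hz, Set.indicator_of_notMem hz]
  rw [h, lintegral_indicator_one (S x).isClosed.measurableSet]

theorem lintegral_inside_mul (μ : Measure X) (x : X) {u : X → ℝ≥0∞} :
    ∫⁻ z, inside S x z * u z ∂μ = ∫⁻ z in (S x : Set X), u z ∂μ := by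
  rw [← lintegral_indicator (S x).isClosed.measurableSet]
  refine lintegral_congr fun z => ?_
  by_cases hz : z ∈ (S x : Set X)
  · rw [inside_of_mem hz, Set.indicator_of_mem hz, one_mul]
  · rw [inside_of_notMem hz, Set.indicator_of_notMem hz, zero_mul]

end Integrals

/-! ### The conditional law outside a truncation set -/

section OffLaw

variable {X : Type*} [TopologicalSpace X] [MeasurableSpace X] [BorelSpace X]
  {Q : Measure X} [IsProbabilityMeasure Q] {S : X → Closeds X} {x : X}

theorem measure_compl_ne_zero (h : Q (S x) < 1) : Q (S x : Set X)ᶜ ≠ 0 := fun h0 =>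
  h.ne ((prob_compl_eq_zero_iff (S x).isClosed.measurableSet).1 h0)

theorem isProbabilityMeasure_offLaw (h : Q (S x) < 1) : IsProbabilityMeasure (offLaw Q S x) :=
  ⟨by
    rw [offLaw, Measure.smul_apply, Measure.restrict_apply MeasurableSet.univ, Set.univ_inter,
      smul_eq_mul, ENNReal.inv_mul_cancel (measure_compl_ne_zero h) (measure_ne_top _ _)]⟩

theorem restrict_compl_eq_smul_offLaw (h : Q (S x) < 1) :
    Q.restrict (S x : Set X)ᶜ = Q (S x : Set X)ᶜ • offLaw Q S x := by
  rw [offLaw, smul_smul, ENNReal.mul_inv_cancel (measure_compl_ne_zero h) (measure_ne_top _ _),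
    one_smul]

theorem offLaw_self : offLaw Q S x (S x) = 0 := by
  rw [offLaw, Measure.smul_apply, Measure.restrict_apply (S x).isClosed.measurableSet,
    Set.inter_compl_self, measure_empty, smul_zero]

end OffLaw

/-! ### Measurability of the costs -/

section CostMeasurability

variable {X Y : Type*} [TopologicalSpace X] [LocallyCompactSpace X] [SecondCountableTopology X]
  [T2Space X] [MeasurableSpace X] [BorelSpace X] [MeasurableSpace Y] {n : ℕ}
  {f : X → Config X → Y} {g : X → Config X → ℕ} {𝒮 : X → Config X → Closeds X}
  {S : X → Closeds X} {Q : Measure X} {T : Type*} [MeasurableSpace T]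

theorem IsTruncation.trunc_comp (H : IsTruncation f g 𝒮 S Q) {a : T → X} {b : T → Config X}
    (ha : Measurable a) (hb : Measurable b) : Measurable fun t => trunc g 𝒮 S (a t) (b t) :=
  (measurable_trunc H.measurable_weight H.measurable_stopping H.measurable_set).comp (ha.prodMk hb)

theorem IsTruncation.inside_comp (H : IsTruncation f g 𝒮 S Q) {a b : T → X}
    (ha : Measurable a) (hb : Measurable b) : Measurable fun t => inside S (a t) (b t) :=
  (measurable_inside H.measurable_set).comp (ha.prodMk hb)

theorem IsTruncation.meet_comp (H : IsTruncation f g 𝒮 S Q) {a b : T → X}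
    (ha : Measurable a) (hb : Measurable b) : Measurable fun t => meet S (a t) (b t) :=
  (measurable_meet H.measurable_set).comp (ha.prodMk hb)

theorem IsTruncation.apart_comp (H : IsTruncation f g 𝒮 S Q) {a b : T → X}
    (ha : Measurable a) (hb : Measurable b) : Measurable fun t => apart S (a t) (b t) :=
  (measurable_apart H.measurable_set).comp (ha.prodMk hb)

theorem IsTruncation.measurable_nearCost (H : IsTruncation f g 𝒮 S Q) (x : X) (j : Fin n) :
    Measurable (nearCost g 𝒮 S x j : (Fin n → X) → ℝ≥0∞) :=
  (H.meet_comp measurable_const (measurable_pi_apply j)).mul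
    (H.trunc_comp (measurable_pi_apply j) measurable_ofPoints)

theorem IsTruncation.measurable_farCost (H : IsTruncation f g 𝒮 S Q) (x : X) (j : Fin n) :
    Measurable (farCost g 𝒮 S x j : (Fin n → X) → ℝ≥0∞) :=
  (H.apart_comp measurable_const (measurable_pi_apply j)).mul
    (H.trunc_comp (measurable_pi_apply j) measurable_ofPoints)

theorem IsTruncation.measurable_farPairCost (H : IsTruncation f g 𝒮 S Q) (x : X) (j l : Fin n) :
    Measurable (farPairCost g 𝒮 S x j l : (Fin n → X) → ℝ≥0∞) :=
  ((H.apart_comp measurable_const (measurable_pi_apply j)).mul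
    (H.inside_comp (measurable_pi_apply j) (measurable_pi_apply l))).mul
    (H.trunc_comp (measurable_pi_apply j) measurable_ofPoints)

theorem IsTruncation.measurable_measure (H : IsTruncation f g 𝒮 S Q) (μ : Measure X) [SFinite μ] :
    Measurable fun x => μ (S x) := by
  simp only [← lintegral_inside]
  exact (measurable_inside H.measurable_set).lintegral_prod_right'

end CostMeasurability

/-! ### Expected costs -/

section ExpectedCost

variable {X Y : Type*} [TopologicalSpace X] [LocallyCompactSpace X] [SecondCountableTopology X]
  [T2Space X] [MeasurableSpace X] [BorelSpace X] [MeasurableSpace Y] {n : ℕ}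
  {f : X → Config X → Y} {g : X → Config X → ℕ} {𝒮 : X → Config X → Closeds X}
  {S : X → Closeds X} {Q : Measure X} [IsProbabilityMeasure Q]

theorem lintegral_nearCost (H : IsTruncation f g 𝒮 S Q) (x : X) (j : Fin n) :
    ∫⁻ p, nearCost g 𝒮 S x j p ∂(Measure.pi fun _ : Fin n => Q) =
      ∫⁻ y, meet S x y * (∫⁻ β, trunc g 𝒮 S y (β.add y) ∂binomialLaw Q (n - 1)) ∂Q := by
  refine (lintegral_ofPoints_eval Q j (G := fun y ω => meet S x y * trunc g 𝒮 S y ω)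
    ((H.meet_comp measurable_const measurable_fst).mul
      (H.trunc_comp measurable_fst measurable_snd))).trans (lintegral_congr fun y => ?_)
  exact lintegral_const_mul _ (H.trunc_comp measurable_const
    (Measurable.config_add measurable_id measurable_const))

theorem lintegral_farCost (H : IsTruncation f g 𝒮 S Q) (ν : Measure X) [IsProbabilityMeasure ν]
    (x : X) (j : Fin n) :
    ∫⁻ p, farCost g 𝒮 S x j p ∂(Measure.pi fun _ : Fin n => ν) =
      ∫⁻ y, apart S x y * (∫⁻ β, trunc g 𝒮 S y (β.add y) ∂binomialLaw ν (n - 1)) ∂ν := by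
  refine (lintegral_ofPoints_eval ν j (G := fun y ω => apart S x y * trunc g 𝒮 S y ω)
    ((H.apart_comp measurable_const measurable_fst).mul
      (H.trunc_comp measurable_fst measurable_snd))).trans (lintegral_congr fun y => ?_)
  exact lintegral_const_mul _ (H.trunc_comp measurable_const
    (Measurable.config_add measurable_id measurable_const))

theorem lintegral_farPairCost (H : IsTruncation f g 𝒮 S Q) (ν : Measure X) [IsProbabilityMeasure ν]
    (x : X) {j l : Fin n} (hjl : j ≠ l) :
    ∫⁻ p, farPairCost g 𝒮 S x j l p ∂(Measure.pi fun _ : Fin n => ν) =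
      ∫⁻ y : X × X, apart S x y.1 * inside S y.1 y.2
        * (∫⁻ β, trunc g 𝒮 S y.1 ((β.add y.1).add y.2) ∂binomialLaw ν (n - 2)) ∂(ν.prod ν) := by
  have hT : Measurable fun q : (X × X) × Config X =>
      trunc g 𝒮 S q.1.1 ((q.2.add q.1.1).add q.1.2) :=
    H.trunc_comp (measurable_fst.comp measurable_fst) (Measurable.config_add
      (Measurable.config_add measurable_snd (measurable_fst.comp measurable_fst))
      (measurable_snd.comp measurable_fst))
  have hm : Measurable fun y : X × X => apart S x y.1 * inside S y.1 y.2
      * (∫⁻ β, trunc g 𝒮 S y.1 ((β.add y.1).add y.2) ∂binomialLaw ν (n - 2)) :=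
    ((H.apart_comp measurable_const measurable_fst).mul
      (H.inside_comp measurable_fst measurable_snd)).mul (measurable_lintegral_config hT ν _)
  rw [lintegral_prod _ hm.aemeasurable]
  refine (lintegral_ofPoints_eval_eval ν hjl
    (G := fun y w ω => apart S x y * inside S y w * trunc g 𝒮 S y ω)
    (((H.apart_comp measurable_const measurable_fst).mul
      (H.inside_comp measurable_fst (measurable_fst.comp measurable_snd))).mul
      (H.trunc_comp measurable_fst (measurable_snd.comp measurable_snd)))).trans
    (lintegral_congr fun y => lintegral_congr fun w => ?_)
  exact lintegral_const_mul _ (hT.comp (measurable_prodMk_left (x := (y, w))))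

/-- The second factor of the term `E₄`. -/
def farMean (Q : Measure X) (n : ℕ) (g : X → Config X → ℕ) (𝒮 : X → Config X → Closeds X)
    (S : X → Closeds X) (x : X) : ℝ≥0∞ :=
  (∫⁻ y, apart S x y
      * (∫⁻ β, trunc g 𝒮 S y (β.add y) ∂binomialLaw (offLaw Q S x) (n - 1)) ∂offLaw Q S x)
    + n * ∫⁻ y : X × X, apart S x y.1 * inside S y.1 y.2
        * (∫⁻ β, trunc g 𝒮 S y.1 ((β.add y.1).add y.2) ∂binomialLaw (offLaw Q S x) (n - 2))
      ∂((offLaw Q S x).prod (offLaw Q S x))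

end ExpectedCost

/-! ### Adding points outside the truncation set -/

section AddPoint

variable {X Y : Type*} [TopologicalSpace X] [MeasurableSpace X] [BorelSpace X] [MeasurableSpace Y]
  {f : X → Config X → Y} {g : X → Config X → ℕ} {𝒮 : X → Config X → Closeds X}
  {S : X → Closeds X} {Q : Measure X}

theorem IsTruncation.trunc_add (H : IsTruncation f g 𝒮 S Q) {ω : Config X} {y w : X}
    (hy : ω.1 {y} ≠ 0) (hw : w ∉ (S y : Set X)) : trunc g 𝒮 S y (ω.add w) = trunc g 𝒮 S y ω :=
  trunc_congr H.localized (H.stopping y) (S y).isClosed.measurableSet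
    (add_singleton_ne_zero_of_ne_zero hy w) hy
    (inter_add_of_notMem (S y).isClosed.measurableSet hw)

/-- Points of `S_x` are invisible to a point `y` whose truncation set is disjoint from `S_x`. -/
theorem IsTruncation.inside_mul_far (H : IsTruncation f g 𝒮 S Q) (ω : Config X) (x y w : X)
    (r : ℝ≥0∞) :
    inside S x w * (r * (apart S x y * trunc g 𝒮 S y ((ω.add y).add w))) =
      inside S x w * (apart S x y * trunc g 𝒮 S y (ω.add y) * r) := by
  by_cases hw : w ∈ (S x : Set X)
  · by_cases hm : ((S x : Set X) ∩ S y).Nonempty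
    · simp [apart_of_nonempty hm]
    · rw [H.trunc_add (add_singleton_ne_zero ω y) fun h => hm ⟨w, hw, h⟩, mul_comm r]
  · simp [inside_of_notMem hw]

/-- If `S_x` and `S_y` are disjoint, then `x` and `y` do not see each other. -/
theorem IsTruncation.far_mul_far (H : IsTruncation f g 𝒮 S Q) (ω : Config X) (x y : X) (r : ℝ≥0∞) :
    trunc g 𝒮 S x ((ω.add x).add y) *
        (1 * (r * (apart S x y * trunc g 𝒮 S y ((ω.add x).add y)))) =
      (apart S x y * r) * (trunc g 𝒮 S x (ω.add x) * trunc g 𝒮 S y (ω.add y)) := by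
  by_cases hm : ((S x : Set X) ∩ S y).Nonempty
  · simp [apart_of_nonempty hm]
  · rw [H.trunc_add (add_singleton_ne_zero ω x) fun h => hm ⟨y, h, H.self_mem y⟩,
      Config.add_right_comm ω x y,
      H.trunc_add (add_singleton_ne_zero ω y) fun h => hm ⟨x, H.self_mem x, h⟩]
    ring

theorem IsTruncation.inside_mul_far_mul_far (H : IsTruncation f g 𝒮 S Q) (ω : Config X) (x y w : X)
    (r : ℝ≥0∞) :
    trunc g 𝒮 S x (((ω.add x).add y).add w) *
        (inside S x w * (r * (apart S x y * trunc g 𝒮 S y (((ω.add x).add y).add w)))) =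
      (inside S x w * (apart S x y * r)) *
        (trunc g 𝒮 S x ((ω.add x).add w) * trunc g 𝒮 S y (ω.add y)) := by
  by_cases hw : w ∈ (S x : Set X)
  · by_cases hm : ((S x : Set X) ∩ S y).Nonempty
    · simp [apart_of_nonempty hm]
    · have h1 : trunc g 𝒮 S x (((ω.add x).add y).add w) = trunc g 𝒮 S x ((ω.add x).add w) := by
        rw [Config.add_right_comm (ω.add x) y w]
        exact H.trunc_add (add_singleton_ne_zero_of_ne_zero (add_singleton_ne_zero ω x) w)
          fun h => hm ⟨y, h, H.self_mem y⟩
      have h2 : trunc g 𝒮 S y (((ω.add x).add y).add w) = trunc g 𝒮 S y (ω.add y) := by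
        rw [H.trunc_add (add_singleton_ne_zero (ω.add x) y) fun h => hm ⟨w, hw, h⟩,
          Config.add_right_comm ω x y,
          H.trunc_add (add_singleton_ne_zero ω y) fun h => hm ⟨x, H.self_mem x, h⟩]
      rw [h1, h2]
      ring
  · simp [inside_of_notMem hw]

end AddPoint

/-! ### Expected cost of resampling -/

section ExpectedResampleCost

variable {X Y : Type*} [TopologicalSpace X] [LocallyCompactSpace X] [SecondCountableTopology X]
  [T2Space X] [MeasurableSpace X] [BorelSpace X] [MeasurableSpace Y] {n : ℕ}
  {f : X → Config X → Y} {g : X → Config X → ℕ} {𝒮 : X → Config X → Closeds X}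
  {S : X → Closeds X} {Q : Measure X} [IsProbabilityMeasure Q]

/-- The position of a point relative to `S_x` is independent of the resampled configuration. -/
theorem lintegral_inside_mul_resample (H : IsTruncation f g 𝒮 S Q) (x : X) (j : Fin n)
    {U : (Fin n → X) → ℝ≥0∞} (hU : Measurable U) :
    ∫⁻ q, inside S x (q.1 j) * U (resample (S x) q.1 q.2)
        ∂((Measure.pi fun _ : Fin n => Q).prod (Measure.pi fun _ : Fin n => offLaw Q S x)) =
      (∫⁻ p, inside S x (p j) ∂(Measure.pi fun _ : Fin n => Q)) *
        ∫⁻ z, U z ∂(Measure.pi fun _ : Fin n => offLaw Q S x) := by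
  have := isProbabilityMeasure_offLaw (H.measure_lt_one x)
  have hm : Measurable fun p : Fin n → X => inside S x (p j) :=
    H.inside_comp measurable_const (measurable_pi_apply j)
  have hmp := measurePreserving_exchangeAll (S x).isClosed.measurableSet
    (restrict_compl_eq_smul_offLaw (H.measure_lt_one x)) (∅ : Finset (Fin n))
  rw [← lintegral_prod_mul hm.aemeasurable hU.aemeasurable]
  refine Eq.trans (lintegral_congr_ae ?_)
    (hmp.lintegral_comp ((hm.comp measurable_fst).mul (hU.comp measurable_snd)))
  have hae : ∀ᵐ q ∂((Measure.pi fun _ : Fin n => Q).prod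
      (Measure.pi fun _ : Fin n => offLaw Q S x)), q.2 j ∉ (S x : Set X) :=
    Measure.quasiMeasurePreserving_snd.ae (p := fun z : Fin n → X => z j ∉ (S x : Set X))
      ((Measure.quasiMeasurePreserving_eval (fun _ : Fin n => offLaw Q S x) j).ae
        (p := fun z => z ∉ (S x : Set X)) (measure_eq_zero_iff_ae_notMem.1 offLaw_self))
  filter_upwards [hae] with q hq
  have h1 : (exchangeAll (S x : Set X) ∅ q).2 = resample (S x) q.1 q.2 := by
    funext l
    by_cases hl : q.1 l ∈ (S x : Set X)
    · rw [resample_of_mem hl]; simp [exchangeAll, hl]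
    · rw [resample_of_notMem hl]; simp [exchangeAll, hl]
  have h2 : inside S x ((exchangeAll (S x : Set X) ∅ q).1 j) = inside S x (q.1 j) := by
    by_cases hl : q.1 j ∈ (S x : Set X)
    · simp [exchangeAll, hl]
    · have : (exchangeAll (S x : Set X) ∅ q).1 j = q.2 j := by simp [exchangeAll, hl]
      rw [this, inside_of_notMem hl, inside_of_notMem hq]
  simp only [h1, h2]

theorem lintegral_mul_resample_update (H : IsTruncation f g 𝒮 S Q) (x : X) (i : Fin n)
    {u U : (Fin n → X) → ℝ≥0∞} (hu : Measurable u) (hdep : DependsInside (S x : Set X) i u)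
    (hU : Measurable U) :
    ∫⁻ q, u q.1 * U (resample (S x) (Function.update q.1 i x) q.2)
        ∂((Measure.pi fun _ : Fin n => Q).prod (Measure.pi fun _ : Fin n => offLaw Q S x)) =
      (∫⁻ p, u p ∂(Measure.pi fun _ : Fin n => Q)) *
        ∫⁻ z, U z ∂(Measure.pi fun _ : Fin n => offLaw Q S x) := by
  have := isProbabilityMeasure_offLaw (H.measure_lt_one x)
  have hmp := measurePreserving_resample_update (S x).isClosed.measurableSet
    (restrict_compl_eq_smul_offLaw (H.measure_lt_one x)) offLaw_self (H.self_mem x) hu hdep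
  have : IsProbabilityMeasure ((Measure.pi fun _ : Fin n => Q).map u) :=
    Measure.isProbabilityMeasure_map hu.aemeasurable
  have h := hmp.lintegral_comp (f := fun r => r.1 * U r.2)
    (measurable_fst.mul (hU.comp measurable_snd))
  rw [lintegral_prod_mul aemeasurable_id' hU.aemeasurable, lintegral_map measurable_id' hu] at h
  exact h

/-- The expected cost of resampling the points of `ρ p`, weighted by `u p`, when the weights and the
pattern of points inside `S_x` are independent of the resampled configuration. -/
theorem sum_lintegral_resampleCost_le (H : IsTruncation f g 𝒮 S Q) (x : X)
    {ρ : (Fin n → X) → Fin n → X} (hρ : Measurable ρ) {u : (Fin n → X) → ℝ≥0∞} (hu : Measurable u)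
    (hind : ∀ (l : Fin n) (U : (Fin n → X) → ℝ≥0∞), Measurable U →
      ∫⁻ q, u q.1 * inside S x (ρ q.1 l) * U (resample (S x) (ρ q.1) q.2)
        ∂((Measure.pi fun _ : Fin n => Q).prod (Measure.pi fun _ : Fin n => offLaw Q S x)) =
      (∫⁻ p, u p * inside S x (ρ p l) ∂(Measure.pi fun _ : Fin n => Q)) *
        ∫⁻ z, U z ∂(Measure.pi fun _ : Fin n => offLaw Q S x)) :
    ∑ j, ∫⁻ q, u q.1 * resampleCost g 𝒮 S x (ρ q.1) q.2 j
        ∂((Measure.pi fun _ : Fin n => Q).prod (Measure.pi fun _ : Fin n => offLaw Q S x)) ≤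
      ∑ j, ∑ l ∈ Finset.univ.erase j, ∫⁻ p, u p * (inside S x (ρ p l) *
          (offLaw Q S x (S (ρ p j)) * farCost g 𝒮 S x j (ρ p))) ∂(Measure.pi fun _ : Fin n => Q)
        + (∑ l, ∫⁻ p, u p * inside S x (ρ p l) ∂(Measure.pi fun _ : Fin n => Q)) *
          farMean Q n g 𝒮 S x := by
  have := isProbabilityMeasure_offLaw (H.measure_lt_one x)
  have hρj : ∀ j, Measurable fun p : Fin n → X => ρ p j := fun j => (measurable_pi_apply j).comp hρ
  have hin : ∀ l, Measurable fun p : Fin n → X => inside S x (ρ p l) := fun l =>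
    H.inside_comp measurable_const (hρj l)
  have hres : Measurable fun q : (Fin n → X) × (Fin n → X) => resample (S x) (ρ q.1) q.2 :=
    (measurable_resample (S x).isClosed.measurableSet).comp
      ((hρ.comp measurable_fst).prodMk measurable_snd)
  set B : Fin n → ℝ≥0∞ := fun l => ∫⁻ p, u p * inside S x (ρ p l) ∂(Measure.pi fun _ : Fin n => Q)
    with hB
  set V₁ := ∫⁻ y, apart S x y
      * (∫⁻ β, trunc g 𝒮 S y (β.add y) ∂binomialLaw (offLaw Q S x) (n - 1)) ∂offLaw Q S x with hV₁
  set V₂ := ∫⁻ y : X × X, apart S x y.1 * inside S y.1 y.2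
        * (∫⁻ β, trunc g 𝒮 S y.1 ((β.add y.1).add y.2) ∂binomialLaw (offLaw Q S x) (n - 2))
      ∂((offLaw Q S x).prod (offLaw Q S x)) with hV₂
  have key : ∀ j, ∫⁻ q, u q.1 * resampleCost g 𝒮 S x (ρ q.1) q.2 j
        ∂((Measure.pi fun _ : Fin n => Q).prod (Measure.pi fun _ : Fin n => offLaw Q S x)) =
      ∑ l ∈ Finset.univ.erase j, ∫⁻ p, u p * (inside S x (ρ p l) *
          (offLaw Q S x (S (ρ p j)) * farCost g 𝒮 S x j (ρ p))) ∂(Measure.pi fun _ : Fin n => Q)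
        + (B j * V₁ + ∑ l ∈ Finset.univ.erase j, B l * V₂) := by
    intro j
    have hexp : ∀ q : (Fin n → X) × (Fin n → X), u q.1 * resampleCost g 𝒮 S x (ρ q.1) q.2 j =
        ∑ l ∈ Finset.univ.erase j, u q.1 * (inside S x (ρ q.1 l) *
            (inside S (ρ q.1 j) (q.2 l) * farCost g 𝒮 S x j (ρ q.1)))
          + (u q.1 * inside S x (ρ q.1 j) * farCost g 𝒮 S x j (resample (S x) (ρ q.1) q.2)
          + ∑ l ∈ Finset.univ.erase j, u q.1 * inside S x (ρ q.1 l) *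
              farPairCost g 𝒮 S x j l (resample (S x) (ρ q.1) q.2)) := fun q => by
      simp only [resampleCost, mul_add, Finset.mul_sum, mul_assoc]
    have hm1 : ∀ l, Measurable fun q : (Fin n → X) × (Fin n → X) => u q.1 * (inside S x (ρ q.1 l) *
            (inside S (ρ q.1 j) (q.2 l) * farCost g 𝒮 S x j (ρ q.1))) := fun l =>
      (hu.comp measurable_fst).mul (((hin l).comp measurable_fst).mul
        ((H.inside_comp ((hρj j).comp measurable_fst)
          ((measurable_pi_apply l).comp measurable_snd)).mul
          ((H.measurable_farCost x j).comp (hρ.comp measurable_fst))))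
    have hm2 : Measurable fun q : (Fin n → X) × (Fin n → X) =>
        u q.1 * inside S x (ρ q.1 j) * farCost g 𝒮 S x j (resample (S x) (ρ q.1) q.2) :=
      ((hu.comp measurable_fst).mul ((hin j).comp measurable_fst)).mul
        ((H.measurable_farCost x j).comp hres)
    have hm3 : ∀ l, Measurable fun q : (Fin n → X) × (Fin n → X) =>
        u q.1 * inside S x (ρ q.1 l) * farPairCost g 𝒮 S x j l (resample (S x) (ρ q.1) q.2) :=
      fun l => ((hu.comp measurable_fst).mul ((hin l).comp measurable_fst)).mul
        ((H.measurable_farPairCost x j l).comp hres)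
    simp only [hexp]
    rw [lintegral_add_left (Finset.measurable_fun_sum _ fun l _ => hm1 l), lintegral_add_left hm2,
      lintegral_finsetSum _ fun l _ => hm1 l, lintegral_finsetSum _ fun l _ => hm3 l]
    congr 1
    · refine Finset.sum_congr rfl fun l _ => ?_
      rw [lintegral_prod _ (hm1 l).aemeasurable]
      refine lintegral_congr fun p => ?_
      have hml : Measurable fun z : Fin n → X => inside S (ρ p j) (z l) :=
        H.inside_comp measurable_const (measurable_pi_apply l)
      dsimp only
      rw [lintegral_const_mul _ ((hml.mul_const _).const_mul _),
        lintegral_const_mul _ (hml.mul_const _), lintegral_mul_const _ hml,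
        lintegral_pi_eval (offLaw Q S x) l (u := fun z => inside S (ρ p j) z)
          (H.inside_comp measurable_const measurable_id), lintegral_inside]
    · congr 1
      · rw [hind j _ (H.measurable_farCost x j), lintegral_farCost H (offLaw Q S x) x j]
      · refine Finset.sum_congr rfl fun l hl => ?_
        rw [hind l _ (H.measurable_farPairCost x j l),
          lintegral_farPairCost H (offLaw Q S x) x (Finset.ne_of_mem_erase hl).symm]
  rw [Finset.sum_congr rfl fun j _ => key j, Finset.sum_add_distrib]
  refine add_le_add le_rfl ?_
  have hfar : farMean Q n g 𝒮 S x = V₁ + n * V₂ := rfl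
  rw [Finset.sum_add_distrib, hfar, mul_add, Finset.sum_mul]
  refine add_le_add le_rfl ?_
  calc ∑ j, ∑ l ∈ Finset.univ.erase j, B l * V₂ ≤ ∑ _j : Fin n, ∑ l, B l * V₂ :=
        Finset.sum_le_sum fun j _ => Finset.sum_le_sum_of_subset (Finset.erase_subset _ _)
    _ = (∑ l, B l) * (n * V₂) := by
        rw [Finset.sum_const, Finset.card_univ, Fintype.card_fin, nsmul_eq_mul, ← Finset.sum_mul]
        ring

end ExpectedResampleCost

/-! ### Expected cost for the process and for its reduced Palm version -/

section TotalCost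

variable {X Y : Type*} [TopologicalSpace X] [LocallyCompactSpace X] [SecondCountableTopology X]
  [T2Space X] [MeasurableSpace X] [BorelSpace X] [MeasurableSpace Y] {n : ℕ}
  {f : X → Config X → Y} {g : X → Config X → ℕ} {𝒮 : X → Config X → Closeds X}
  {S : X → Closeds X} {Q : Measure X} [IsProbabilityMeasure Q]

theorem IsTruncation.measurable_resampleCost (H : IsTruncation f g 𝒮 S Q) (x : X) (j : Fin n) :
    Measurable fun q : (Fin n → X) × (Fin n → X) => resampleCost g 𝒮 S x q.1 q.2 j := by
  have hin : ∀ l, Measurable fun q : (Fin n → X) × (Fin n → X) => inside S x (q.1 l) := fun l =>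
    H.inside_comp measurable_const ((measurable_pi_apply l).comp measurable_fst)
  have hres := measurable_resample (n := n) (S x).isClosed.measurableSet
  exact (Finset.measurable_fun_sum _ fun l _ => (hin l).mul
    ((H.inside_comp ((measurable_pi_apply j).comp measurable_fst)
      ((measurable_pi_apply l).comp measurable_snd)).mul
      ((H.measurable_farCost x j).comp measurable_fst))).add
    (((hin j).mul ((H.measurable_farCost x j).comp hres)).add
      (Finset.measurable_fun_sum _ fun l _ =>
        (hin l).mul ((H.measurable_farPairCost x j l).comp hres)))

theorem sum_le_card_mul {F : Fin n → ℝ≥0∞} {r : ℝ≥0∞} (s : Finset (Fin n)) (h : ∀ j ∈ s, F j ≤ r) :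
    ∑ j ∈ s, F j ≤ n * r :=
  calc ∑ j ∈ s, F j ≤ ∑ _j ∈ s, r := Finset.sum_le_sum h
    _ ≤ ∑ _j : Fin n, r := Finset.sum_le_sum_of_subset (Finset.subset_univ s)
    _ = n * r := by rw [Finset.sum_const, Finset.card_univ, Fintype.card_fin, nsmul_eq_mul]

theorem measurable_farMul (H : IsTruncation f g 𝒮 S Q) (x : X) (ν : Measure X) [SFinite ν] :
    Measurable fun q : X × X × Config X =>
      inside S x q.2.1 * (ν (S q.1) * (apart S x q.1 * trunc g 𝒮 S q.1 q.2.2)) :=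
  (H.inside_comp measurable_const (measurable_fst.comp measurable_snd)).mul
    (((H.measurable_measure ν).comp measurable_fst).mul
      ((H.apart_comp measurable_const measurable_fst).mul
        (H.trunc_comp measurable_fst (measurable_snd.comp measurable_snd))))

theorem lintegral_inside_farCost (H : IsTruncation f g 𝒮 S Q) (x : X) (ν : Measure X) [SFinite ν]
    {j l : Fin n} (hjl : j ≠ l) :
    ∫⁻ p, inside S x (p l) * (ν (S (p j)) * farCost g 𝒮 S x j p) ∂(Measure.pi fun _ : Fin n => Q) =
      Q (S x) * ∫⁻ y, apart S x y
        * (∫⁻ β, trunc g 𝒮 S y (β.add y) ∂binomialLaw Q (n - 2)) * ν (S y) ∂Q := by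
  refine (lintegral_ofPoints_eval_eval Q hjl (G := fun y w ω =>
    inside S x w * (ν (S y) * (apart S x y * trunc g 𝒮 S y ω))) (measurable_farMul H x ν)).trans ?_
  have hT : Measurable fun q : X × Config X => trunc g 𝒮 S q.1 (q.2.add q.1) :=
    H.trunc_comp measurable_fst (Measurable.config_add measurable_snd measurable_fst)
  have hm : Measurable fun y => apart S x y
      * (∫⁻ β, trunc g 𝒮 S y (β.add y) ∂binomialLaw Q (n - 2)) * ν (S y) :=
    ((H.apart_comp measurable_const measurable_id).mul (measurable_lintegral_config hT Q _)).mul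
      (H.measurable_measure ν)
  have hin : Measurable fun w => inside S x w := H.inside_comp measurable_const measurable_id
  rw [← lintegral_const_mul _ hm]
  refine lintegral_congr fun y => ?_
  have hTy : Measurable fun β : Config X => trunc g 𝒮 S y (β.add y) :=
    hT.comp (measurable_const.prodMk measurable_id)
  have h : ∀ w, ∫⁻ β, inside S x w * (ν (S y) * (apart S x y *
      trunc g 𝒮 S y ((β.add y).add w))) ∂binomialLaw Q (n - 2) =
      inside S x w * (apart S x y
        * (∫⁻ β, trunc g 𝒮 S y (β.add y) ∂binomialLaw Q (n - 2)) * ν (S y)) := fun w => by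
    simp only [H.inside_mul_far]
    rw [lintegral_const_mul _ ((hTy.const_mul _).mul_const _),
      lintegral_mul_const _ (hTy.const_mul _), lintegral_const_mul _ hTy]
  simp only [h]
  rw [lintegral_mul_const _ hin, lintegral_inside]

/-- Expected cost of comparing the truncated process with the process resampled inside `S_x`. -/
theorem lintegral_cost_le (H : IsTruncation f g 𝒮 S Q) (x : X) :
    ∫⁻ q, ∑ j, (nearCost g 𝒮 S x j q.1 + resampleCost g 𝒮 S x q.1 q.2 j)
        ∂((Measure.pi fun _ : Fin n => Q).prod (Measure.pi fun _ : Fin n => offLaw Q S x)) ≤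
      n * (∫⁻ y, meet S x y * (∫⁻ β, trunc g 𝒮 S y (β.add y) ∂binomialLaw Q (n - 1)) ∂Q)
      + n ^ 2 * (Q (S x) * ∫⁻ y, apart S x y
        * (∫⁻ β, trunc g 𝒮 S y (β.add y) ∂binomialLaw Q (n - 2)) * offLaw Q S x (S y) ∂Q)
      + n * Q (S x) * farMean Q n g 𝒮 S x := by
  have := isProbabilityMeasure_offLaw (H.measure_lt_one x)
  have hnear : ∀ j, Measurable fun q : (Fin n → X) × (Fin n → X) => nearCost g 𝒮 S x j q.1 :=
    fun j => (H.measurable_nearCost x j).comp measurable_fst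
  have hB : ∀ l : Fin n, ∫⁻ p, inside S x (p l) ∂(Measure.pi fun _ : Fin n => Q) = Q (S x) :=
    fun l => by
      rw [lintegral_pi_eval Q l (u := fun z => inside S x z)
        (H.inside_comp measurable_const measurable_id), lintegral_inside]
  have hres := sum_lintegral_resampleCost_le H x (n := n) (ρ := id) measurable_id (u := fun _ => 1)
    measurable_const (fun l U hU => by
      simpa only [one_mul, id] using lintegral_inside_mul_resample H x l hU)
  simp only [one_mul, id, hB] at hres
  rw [lintegral_finsetSum _ fun j _ => (hnear j).fun_add (H.measurable_resampleCost x j),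
    Finset.sum_congr rfl fun j _ => lintegral_add_left (hnear j) _, Finset.sum_add_distrib, add_assoc]
  refine add_le_add (sum_le_card_mul _ fun j _ => ?_) (hres.trans (add_le_add ?_ (le_of_eq ?_)))
  · rw [lintegral_prod _ (hnear j).aemeasurable]
    simp only [lintegral_const, measure_univ, mul_one]
    exact (lintegral_nearCost H x j).le
  · rw [sq, mul_assoc]
    exact sum_le_card_mul _ fun j _ => sum_le_card_mul _ fun l hl =>
      (lintegral_inside_farCost H x (offLaw Q S x) (Finset.ne_of_mem_erase hl).symm).le
  · simp

theorem dependsInside_trunc_mul_inside (H : IsTruncation f g 𝒮 S Q) (x : X) (i l : Fin n) :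
    DependsInside (S x : Set X) i fun p : Fin n → X =>
      trunc g 𝒮 S x (ofPoints (Function.update p i x)) * inside S x (Function.update p i x l) := by
  intro p p' h
  have hx : ∀ p : Fin n → X, (ofPoints (Function.update p i x)).1 {x} ≠ 0 := fun p => by
    simpa using ofPoints_singleton_ne_zero (Function.update p i x) i
  have h1 : trunc g 𝒮 S x (ofPoints (Function.update p i x)) =
      trunc g 𝒮 S x (ofPoints (Function.update p' i x)) := by
    refine trunc_congr H.localized (H.stopping x) (S x).isClosed.measurableSet (hx p) (hx p')
      (ofPoints_inter_congr (S x).isClosed.measurableSet fun j => ?_)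
    by_cases hj : j = i
    · subst hj; simp
    · rw [Function.update_of_ne hj, Function.update_of_ne hj]
      by_cases hm : p j ∈ (S x : Set X)
      · exact Or.inl ((h j hj).2 hm)
      · exact Or.inr ⟨hm, fun h' => hm ((h j hj).1.2 h')⟩
  have h2 : inside S x (Function.update p i x l) = inside S x (Function.update p' i x l) := by
    by_cases hl : l = i
    · subst hl; simp
    · rw [Function.update_of_ne hl, Function.update_of_ne hl]
      by_cases hm : p l ∈ (S x : Set X)
      · rw [(h l hl).2 hm]
      · rw [inside_of_notMem hm, inside_of_notMem fun h' => hm ((h l hl).1.2 h')]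
  exact congrArg₂ _ h1 h2

theorem lintegral_trunc_mul_farCost (H : IsTruncation f g 𝒮 S Q) (x : X) (ν : Measure X) [SFinite ν]
    {i j : Fin n} (hij : i ≠ j) :
    ∫⁻ p, trunc g 𝒮 S x (ofPoints (Function.update p i x)) *
        (inside S x (Function.update p i x i) * (ν (S (Function.update p i x j)) *
          farCost g 𝒮 S x j (Function.update p i x))) ∂(Measure.pi fun _ : Fin n => Q) =
      ∫⁻ y, apart S x y
      * (∫⁻ β, trunc g 𝒮 S x (β.add x) * trunc g 𝒮 S y (β.add y) ∂binomialLaw Q (n - 2))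
      * ν (S y) ∂Q := by
  simp only [Function.update_self, inside_of_mem (H.self_mem x)]
  refine (lintegral_ofPoints_update_eval Q hij x (G := fun y ω => trunc g 𝒮 S x ω *
    (1 * (ν (S y) * (apart S x y * trunc g 𝒮 S y ω)))) ?_).trans (lintegral_congr fun y => ?_)
  · exact (H.trunc_comp measurable_const measurable_snd).mul (measurable_const.mul
      (((H.measurable_measure ν).comp measurable_fst).mul
      ((H.apart_comp measurable_const measurable_fst).mul
        (H.trunc_comp measurable_fst measurable_snd))))
  · have hm : ∀ z : X, Measurable fun β : Config X => trunc g 𝒮 S z (β.add z) := fun z =>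
      H.trunc_comp measurable_const (Measurable.config_add measurable_id measurable_const)
    simp only [H.far_mul_far]
    rw [lintegral_const_mul _ ((hm x).fun_mul (hm y))]
    ring

theorem lintegral_trunc_mul_inside_farCost (H : IsTruncation f g 𝒮 S Q) (x : X) (ν : Measure X)
    [SFinite ν] {i j l : Fin n} (hij : i ≠ j) (hil : i ≠ l) (hjl : j ≠ l) :
    ∫⁻ p, trunc g 𝒮 S x (ofPoints (Function.update p i x)) *
        (inside S x (Function.update p i x l) * (ν (S (Function.update p i x j)) *
          farCost g 𝒮 S x j (Function.update p i x))) ∂(Measure.pi fun _ : Fin n => Q) =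
      ∫⁻ y, (∫⁻ w in (S x : Set X), apart S x y
      * (∫⁻ β, trunc g 𝒮 S x ((β.add x).add w) * trunc g 𝒮 S y (β.add y)
          ∂binomialLaw Q (n - 3))
      * ν (S y) ∂Q) ∂Q := by
  refine (lintegral_ofPoints_update_eval_eval Q hij hil hjl x (G := fun y w ω =>
    trunc g 𝒮 S x ω * (inside S x w * (ν (S y) * (apart S x y * trunc g 𝒮 S y ω)))) ?_).trans
    (lintegral_congr fun y => ?_)
  · exact (H.trunc_comp measurable_const (measurable_snd.comp measurable_snd)).mul
      (measurable_farMul H x ν)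
  · rw [← lintegral_inside_mul]
    refine lintegral_congr fun w => ?_
    have hm : Measurable fun β : Config X =>
        trunc g 𝒮 S x ((β.add x).add w) * trunc g 𝒮 S y (β.add y) :=
      (H.trunc_comp measurable_const (Measurable.config_add
        (Measurable.config_add measurable_id measurable_const) measurable_const)).mul
      (H.trunc_comp measurable_const (Measurable.config_add measurable_id measurable_const))
    simp only [H.inside_mul_far_mul_far]
    rw [lintegral_const_mul _ hm]
    ring

theorem sum_lintegral_trunc_mul_inside_le (H : IsTruncation f g 𝒮 S Q) (x : X) (i : Fin n) :
    ∑ l, ∫⁻ p, trunc g 𝒮 S x (ofPoints (Function.update p i x)) *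
        inside S x (Function.update p i x l) ∂(Measure.pi fun _ : Fin n => Q) ≤
      (∫⁻ β, trunc g 𝒮 S x (β.add x) ∂binomialLaw Q (n - 1))
          + n * ∫⁻ z in (S x : Set X),
            (∫⁻ β, trunc g 𝒮 S x ((β.add x).add z) ∂binomialLaw Q (n - 2)) ∂Q := by
  rw [← Finset.add_sum_erase _ _ (Finset.mem_univ i)]
  refine add_le_add (le_of_eq ?_) (sum_le_card_mul _ fun l hl => le_of_eq ?_)
  · simp only [Function.update_self, inside_of_mem (H.self_mem x), mul_one]
    exact lintegral_ofPoints_update Q i x (H.trunc_comp measurable_const measurable_id)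
  · rw [← lintegral_inside_mul]
    refine (lintegral_ofPoints_update_eval Q (Finset.ne_of_mem_erase hl).symm x
      (G := fun z ω => trunc g 𝒮 S x ω * inside S x z)
      ((H.trunc_comp measurable_const measurable_snd).mul
        (H.inside_comp measurable_const measurable_fst))).trans (lintegral_congr fun z => ?_)
    have hm : Measurable fun β : Config X => trunc g 𝒮 S x ((β.add x).add z) :=
      H.trunc_comp measurable_const (Measurable.config_add
        (Measurable.config_add measurable_id measurable_const) measurable_const)
    rw [lintegral_mul_const _ hm, mul_comm]

theorem lintegral_trunc_mul_nearCost (H : IsTruncation f g 𝒮 S Q) (x : X) {i j : Fin n}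
    (hij : i ≠ j) :
    ∫⁻ p, trunc g 𝒮 S x (ofPoints (Function.update p i x)) *
        nearCost g 𝒮 S x j (Function.update p i x) ∂(Measure.pi fun _ : Fin n => Q) =
      ∫⁻ y, meet S x y
        * (∫⁻ β, trunc g 𝒮 S x ((β.add x).add y) * trunc g 𝒮 S y ((β.add x).add y)
          ∂binomialLaw Q (n - 2)) ∂Q := by
  refine (lintegral_ofPoints_update_eval Q hij x (G := fun y ω =>
    trunc g 𝒮 S x ω * (meet S x y * trunc g 𝒮 S y ω))
    ((H.trunc_comp measurable_const measurable_snd).mul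
      ((H.meet_comp measurable_const measurable_fst).mul
        (H.trunc_comp measurable_fst measurable_snd)))).trans (lintegral_congr fun y => ?_)
  have hm : ∀ z : X, Measurable fun β : Config X => trunc g 𝒮 S z ((β.add x).add y) := fun z =>
    H.trunc_comp measurable_const (Measurable.config_add
      (Measurable.config_add measurable_id measurable_const) measurable_const)
  rw [← lintegral_const_mul _ ((hm x).fun_mul (hm y))]
  exact lintegral_congr fun β => by ring

theorem sum_lintegral_trunc_mul_farCost_le (H : IsTruncation f g 𝒮 S Q) (x : X) (ν : Measure X)
    [SFinite ν] (i j : Fin n) :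
    ∑ l ∈ Finset.univ.erase j, ∫⁻ p,
        trunc g 𝒮 S x (ofPoints (Function.update p i x)) * (inside S x (Function.update p i x l) *
          (ν (S (Function.update p i x j)) * farCost g 𝒮 S x j (Function.update p i x)))
          ∂(Measure.pi fun _ : Fin n => Q) ≤
      (∫⁻ y, apart S x y
        * (∫⁻ β, trunc g 𝒮 S x (β.add x) * trunc g 𝒮 S y (β.add y) ∂binomialLaw Q (n - 2))
        * ν (S y) ∂Q)
      + n * (∫⁻ y, (∫⁻ w in (S x : Set X), apart S x y
        * (∫⁻ β, trunc g 𝒮 S x ((β.add x).add w) * trunc g 𝒮 S y (β.add y)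
          ∂binomialLaw Q (n - 3)) * ν (S y) ∂Q) ∂Q) := by
  by_cases hj : j = i
  · -- `S_x` meets itself
    subst hj
    have h0 : apart S x x = 0 := apart_of_nonempty ⟨x, H.self_mem x, H.self_mem x⟩
    simp [farCost, h0]
  · rw [← Finset.add_sum_erase _ _ (Finset.mem_erase.2 ⟨Ne.symm hj, Finset.mem_univ i⟩)]
    refine add_le_add (lintegral_trunc_mul_farCost H x ν (Ne.symm hj)).le
      (sum_le_card_mul _ fun l hl => ?_)
    obtain ⟨hli, hl'⟩ := Finset.mem_erase.1 hl
    exact (lintegral_trunc_mul_inside_farCost H x ν (Ne.symm hj) (Ne.symm hli)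
      (Finset.ne_of_mem_erase hl').symm).le

/-- Expected cost of comparing the truncated process given a point at `x`, without the contribution
of that point, with the process resampled inside `S_x`. -/
theorem lintegral_cost_update_le (H : IsTruncation f g 𝒮 S Q) (x : X) (i : Fin n) :
    ∫⁻ q, trunc g 𝒮 S x (ofPoints (Function.update q.1 i x)) *
        ∑ j, ((if j = i then 0 else nearCost g 𝒮 S x j (Function.update q.1 i x))
          + resampleCost g 𝒮 S x (Function.update q.1 i x) q.2 j)
        ∂((Measure.pi fun _ : Fin n => Q).prod (Measure.pi fun _ : Fin n => offLaw Q S x)) ≤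
      n * (∫⁻ y, meet S x y
        * (∫⁻ β, trunc g 𝒮 S x ((β.add x).add y) * trunc g 𝒮 S y ((β.add x).add y)
          ∂binomialLaw Q (n - 2)) ∂Q)
      + (n * (∫⁻ y, apart S x y
        * (∫⁻ β, trunc g 𝒮 S x (β.add x) * trunc g 𝒮 S y (β.add y) ∂binomialLaw Q (n - 2))
        * offLaw Q S x (S y) ∂Q)
      + n ^ 2 * (∫⁻ y, (∫⁻ w in (S x : Set X), apart S x y
        * (∫⁻ β, trunc g 𝒮 S x ((β.add x).add w) * trunc g 𝒮 S y (β.add y)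
          ∂binomialLaw Q (n - 3))
        * offLaw Q S x (S y) ∂Q) ∂Q)
      + ((∫⁻ β, trunc g 𝒮 S x (β.add x) ∂binomialLaw Q (n - 1))
          + n * ∫⁻ z in (S x : Set X),
            (∫⁻ β, trunc g 𝒮 S x ((β.add x).add z) ∂binomialLaw Q (n - 2)) ∂Q)
        * farMean Q n g 𝒮 S x) := by
  have := isProbabilityMeasure_offLaw (H.measure_lt_one x)
  have hup : Measurable fun p : Fin n → X => Function.update p i x := measurable_update_const i x
  have htr : Measurable fun p : Fin n → X => trunc g 𝒮 S x (ofPoints (Function.update p i x)) :=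
    H.trunc_comp measurable_const (measurable_ofPoints.comp hup)
  have hin : ∀ l, Measurable fun p : Fin n → X => inside S x (Function.update p i x l) := fun l =>
    H.inside_comp measurable_const ((measurable_pi_apply l).comp hup)
  have hnear : ∀ j, Measurable fun q : (Fin n → X) × (Fin n → X) =>
      trunc g 𝒮 S x (ofPoints (Function.update q.1 i x)) *
        (if j = i then 0 else nearCost g 𝒮 S x j (Function.update q.1 i x)) := fun j => by
    by_cases hj : j = i
    · simp only [hj, if_true, mul_zero]; exact measurable_const
    · simp only [hj, if_false]
      exact (htr.mul ((H.measurable_nearCost x j).comp hup)).comp measurable_fst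
  have hrm : ∀ j, Measurable fun q : (Fin n → X) × (Fin n → X) =>
      trunc g 𝒮 S x (ofPoints (Function.update q.1 i x)) *
        resampleCost g 𝒮 S x (Function.update q.1 i x) q.2 j := fun j => by
    have h := (H.measurable_resampleCost x j).comp ((hup.comp measurable_fst).prodMk measurable_snd)
    exact (htr.comp measurable_fst).mul h
  have hres := sum_lintegral_resampleCost_le H x hup htr (fun l U hU =>
      lintegral_mul_resample_update H x i (htr.mul (hin l))
        (dependsInside_trunc_mul_inside H x i l) hU)
  simp only [Finset.mul_sum, mul_add (trunc g 𝒮 S x _)]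
  rw [lintegral_finsetSum _ fun j _ => (hnear j).fun_add (hrm j),
    Finset.sum_congr rfl fun j _ => lintegral_add_left (hnear j) _, Finset.sum_add_distrib]
  refine add_le_add (sum_le_card_mul _ fun j _ => ?_) (hres.trans (add_le_add ?_
    (mul_le_mul_left (sum_lintegral_trunc_mul_inside_le H x i) _)))
  · by_cases hj : j = i
    · simp [hj]
    · rw [lintegral_prod _ (hnear j).aemeasurable]
      simp only [hj, if_false, lintegral_const, measure_univ, mul_one]
      exact (lintegral_trunc_mul_nearCost H x (Ne.symm hj)).le
  · refine (sum_le_card_mul _ fun j _ =>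
      sum_lintegral_trunc_mul_farCost_le H x (offLaw Q S x) i j).trans_eq ?_
    rw [mul_add, ← mul_assoc, sq]

end TotalCost

/-! ### Integrals of products of bounded functions -/

section BoundedProducts

theorem ofReal_abs_integral_le {T : Type*} [MeasurableSpace T] (μ : Measure T) (u : T → ℝ) :
    ENNReal.ofReal |∫ t, u t ∂μ| ≤ ∫⁻ t, ENNReal.ofReal |u t| ∂μ := by
  simp only [← Real.enorm_eq_ofReal_abs]
  exact enorm_integral_le_lintegral_enorm u

theorem ofReal_abs_integral_mul_sub_le {A B : Type*} [MeasurableSpace A] [MeasurableSpace B]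
    (μ : Measure A) [IsProbabilityMeasure μ] (κ : Measure B) [IsProbabilityMeasure κ]
    {t u w : A → ℝ} {v : A × B → ℝ} (ht : Measurable t) (hu : Measurable u) (hw : Measurable w)
    (hv : Measurable v) (ht1 : ∀ a, |t a| ≤ 1) (hu1 : ∀ a, |u a| ≤ 1) (hw1 : ∀ a, |w a| ≤ 1)
    (hv1 : ∀ r, |v r| ≤ 1) :
    ENNReal.ofReal |∫ a, t a * (u a - w a) ∂μ| ≤
      ∫⁻ r, ENNReal.ofReal |t r.1| * ENNReal.ofReal |u r.1 - v r| ∂(μ.prod κ)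
        + ENNReal.ofReal |∫ r, t r.1 * (v r - w r.1) ∂(μ.prod κ)| := by
  have hb : ∀ {r s q : ℝ}, |r| ≤ 1 → |s| ≤ 1 → |q| ≤ 1 → ‖r * (s - q)‖ ≤ 2 := by
    intro r s q hr hs hq
    rw [Real.norm_eq_abs, abs_mul]
    nlinarith [abs_sub s q, abs_nonneg (s - q), abs_nonneg r]
  have hsplit : ∫ a, t a * (u a - w a) ∂μ = ∫ r, t r.1 * (u r.1 - v r) ∂(μ.prod κ)
      + ∫ r, t r.1 * (v r - w r.1) ∂(μ.prod κ) := by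
    rw [← integral_add]
    · have h := integral_fun_fst (μ := μ) (ν := κ) (fun a => t a * (u a - w a))
      rw [probReal_univ, one_smul] at h
      rw [← h]
      exact integral_congr_ae (ae_of_all _ fun r => by ring)
    · exact Integrable.of_bound ((ht.comp measurable_fst).mul
        ((hu.comp measurable_fst).sub hv)).aestronglyMeasurable 2
        (ae_of_all _ fun r => hb (ht1 _) (hu1 _) (hv1 _))
    · exact Integrable.of_bound ((ht.comp measurable_fst).mul
        (hv.sub (hw.comp measurable_fst))).aestronglyMeasurable 2
        (ae_of_all _ fun r => hb (ht1 _) (hv1 _) (hw1 _))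
  rw [hsplit]
  refine (ENNReal.ofReal_le_ofReal (abs_add_le _ _)).trans (ENNReal.ofReal_add_le.trans
    (add_le_add ((ofReal_abs_integral_le _ _).trans_eq (lintegral_congr fun r => ?_)) le_rfl))
  rw [abs_mul, ENNReal.ofReal_mul (abs_nonneg _)]

theorem abs_integral_le_one {T : Type*} [MeasurableSpace T] (μ : Measure T) [IsProbabilityMeasure μ]
    {u : T → ℝ} (hu : ∀ t, |u t| ≤ 1) : |∫ t, u t ∂μ| ≤ 1 := by
  have := norm_integral_le_of_norm_le_const (μ := μ) (C := 1) (f := u) (ae_of_all _ fun p => hu p)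
  simpa using this

theorem integral_comp_mul_sub {T A B : Type*} [MeasurableSpace T] [MeasurableSpace A]
    [MeasurableSpace B] {ρ : Measure T} {Λ : Measure A} [IsProbabilityMeasure Λ] {κ : Measure B}
    [IsProbabilityMeasure κ] {φ : T → A × B} (hφ : MeasurePreserving φ ρ (Λ.prod κ))
    {t w : A → ℝ} {u : A × B → ℝ} (ht : Measurable t) (hw : Measurable w) (hu : Measurable u)
    (ht1 : ∀ a, |t a| ≤ 1) (hw1 : ∀ a, |w a| ≤ 1) (hu1 : ∀ r, |u r| ≤ 1) :
    ∫ r, t (φ r).1 * (u (φ r) - w (φ r).1) ∂ρ =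
      ∫ a, t a * (∫ b, u (a, b) ∂κ - w a) ∂Λ := by
  have hΨm : Measurable fun r : A × B => t r.1 * (u r - w r.1) :=
    (ht.comp measurable_fst).mul (hu.sub (hw.comp measurable_fst))
  have h1 := integral_map (μ := ρ) (f := fun r : A × B => t r.1 * (u r - w r.1))
    hφ.measurable.aemeasurable hΨm.aestronglyMeasurable
  rw [hφ.map_eq] at h1
  rw [← h1, integral_prod _ (Integrable.of_bound hΨm.aestronglyMeasurable 2
    (ae_of_all _ fun r => ?_))]
  · refine integral_congr_ae (ae_of_all _ fun a => ?_)
    have hi : Integrable (fun b => u (a, b)) κ := Integrable.of_bound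
      (hu.comp measurable_prodMk_left).aestronglyMeasurable 1 (ae_of_all _ fun b => hu1 _)
    simp only [integral_const_mul]
    rw [integral_sub hi (integrable_const _), integral_const, probReal_univ, one_smul]
  · rw [Real.norm_eq_abs, abs_mul]
    nlinarith [abs_sub (u r) (w r.1), abs_nonneg (u r - w r.1), abs_nonneg (t r.1), hu1 r,
      hw1 r.1, ht1 r.1]

end BoundedProducts

/-! ### Comparison of a point with the whole process -/

section Shift

variable {X Y : Type*} [TopologicalSpace X] [LocallyCompactSpace X] [SecondCountableTopology X]
  [T2Space X] [MeasurableSpace X] [BorelSpace X] [MeasurableSpace Y] {n : ℕ}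
  {f : X → Config X → Y} {g : X → Config X → ℕ} {𝒮 : X → Config X → Closeds X}
  {S : X → Closeds X} {Q : Measure X} [IsProbabilityMeasure Q]

theorem IsTruncation.measurable_truncNat_comp (H : IsTruncation f g 𝒮 S Q) {T : Type*}
    [MeasurableSpace T] {a : T → X} {b : T → Config X} (ha : Measurable a) (hb : Measurable b) :
    Measurable fun t => truncNat g 𝒮 S (a t) (b t) :=
  (measurable_truncNat H.measurable_weight H.measurable_stopping H.measurable_set).comp
    (ha.prodMk hb)

theorem IsTruncation.measurable_weightAt (H : IsTruncation f g 𝒮 S Q) :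
    Measurable (weightAt g 𝒮 S : (Fin n → X) → Fin n → ℕ) :=
  measurable_pi_lambda _ fun j =>
    H.measurable_truncNat_comp (measurable_pi_apply j) measurable_ofPoints

theorem IsTruncation.measurable_markAt (H : IsTruncation f g 𝒮 S Q) :
    Measurable (markAt f : (Fin n → X) → Fin n → Y) :=
  measurable_pi_lambda _ fun j => H.measurable_mark.comp
    ((measurable_pi_apply j).prodMk measurable_ofPoints)

theorem IsTruncation.measurable_farWeightAt (H : IsTruncation f g 𝒮 S Q) (x : X) :
    Measurable (farWeightAt g 𝒮 S x : (Fin n → X) → Fin n → ℕ) :=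
  measurable_pi_lambda _ fun j => Measurable.ite
    (measurableSet_closeds_meet (@measurable_const _ _ (fellSigma X) _ (S x))
      (@Measurable.comp _ _ _ _ _ (fellSigma X) _ _ H.measurable_set (measurable_pi_apply j)))
    measurable_const ((measurable_pi_apply j).comp H.measurable_weightAt)

theorem IsTruncation.weightAt_le_one (H : IsTruncation f g 𝒮 S Q) (p : Fin n → X) (j : Fin n) :
    weightAt g 𝒮 S p j ≤ 1 := truncNat_le_one H.zero_or_one _ _

theorem IsTruncation.farWeightAt_le_one (H : IsTruncation f g 𝒮 S Q) (x : X) (p : Fin n → X)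
    (j : Fin n) : farWeightAt g 𝒮 S x p j ≤ 1 := by
  rw [farWeightAt]
  split_ifs
  exacts [zero_le_one, H.weightAt_le_one p j]

variable {F : Y → (Fin n → ℕ) → (Fin n → Y) → ℝ}

/-- The mean of `F` over the whole process is compared with its mean over independent points with
the law `Q_x`, of which only those far from `S_x` are retained. -/
theorem ofReal_abs_integral_far_sub_le (H : IsTruncation f g 𝒮 S Q)
    (hFm : Measurable fun p : Y × (Fin n → ℕ) × (Fin n → Y) => F p.1 p.2.1 p.2.2)
    (hF1 : ∀ z c y, |F z c y| ≤ 1)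
    (hFl : ∀ (z : Y) (c c' : Fin n → ℕ) (y y' : Fin n → Y) (d : Fin n → ℝ≥0∞), (∀ i, c i ≤ 1) →
      (∀ i, c' i ≤ 1) → (∀ i, Mismatch c y c' y' i → 1 ≤ d i) →
      ENNReal.ofReal |F z c y - F z c' y'| ≤ 2 * ∑ i, d i) (x : X) (b : Y) :
    ENNReal.ofReal |∫ z, F b (farWeightAt g 𝒮 S x z) (markAt f z)
          ∂(Measure.pi fun _ : Fin n => offLaw Q S x)
        - ∫ p, F b (weightAt g 𝒮 S p) (markAt f p) ∂(Measure.pi fun _ : Fin n => Q)| ≤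
      2 * ∫⁻ q, ∑ j, (nearCost g 𝒮 S x j q.1 + resampleCost g 𝒮 S x q.1 q.2 j)
        ∂((Measure.pi fun _ : Fin n => Q).prod (Measure.pi fun _ : Fin n => offLaw Q S x)) := by
  have := isProbabilityMeasure_offLaw (H.measure_lt_one x)
  have hmp := measurePreserving_resample (n := n) (S x).isClosed.measurableSet
    (restrict_compl_eq_smul_offLaw (H.measure_lt_one x))
  have hm1 : Measurable fun z : Fin n → X => F b (farWeightAt g 𝒮 S x z) (markAt f z) :=
    hFm.comp (measurable_const.prodMk ((H.measurable_farWeightAt x).prodMk H.measurable_markAt))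
  have hm2 : Measurable fun p : Fin n → X => F b (weightAt g 𝒮 S p) (markAt f p) :=
    hFm.comp (measurable_const.prodMk (H.measurable_weightAt.prodMk H.measurable_markAt))
  have h1 : ∫ z, F b (farWeightAt g 𝒮 S x z) (markAt f z)
          ∂(Measure.pi fun _ : Fin n => offLaw Q S x) =
      ∫ q : (Fin n → X) × (Fin n → X), F b (farWeightAt g 𝒮 S x (resample (S x) q.1 q.2))
        (markAt f (resample (S x) q.1 q.2))
        ∂((Measure.pi fun _ : Fin n => Q).prod (Measure.pi fun _ : Fin n => offLaw Q S x)) := by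
    rw [← integral_map hmp.measurable.aemeasurable hm1.aestronglyMeasurable, hmp.map_eq]
  have h2 : ∫ p, F b (weightAt g 𝒮 S p) (markAt f p) ∂(Measure.pi fun _ : Fin n => Q) =
      ∫ q : (Fin n → X) × (Fin n → X), F b (weightAt g 𝒮 S q.1) (markAt f q.1)
        ∂((Measure.pi fun _ : Fin n => Q).prod (Measure.pi fun _ : Fin n => offLaw Q S x)) := by
    rw [integral_fun_fst (fun p => F b (weightAt g 𝒮 S p) (markAt f p))]
    simp
  rw [h1, h2, ← integral_sub]
  · refine (ofReal_abs_integral_le _ _).trans ?_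
    rw [← lintegral_const_mul' _ _ ENNReal.ofNat_ne_top]
    refine lintegral_mono fun q => ?_
    rw [abs_sub_comm]
    exact hFl b _ _ _ _ _ (H.weightAt_le_one q.1) (H.farWeightAt_le_one x _)
      fun j hj => one_le_cost_of_mismatch H hj
  · exact Integrable.of_bound (hm1.comp hmp.measurable).aestronglyMeasurable 1
      (ae_of_all _ fun q => hF1 _ _ _)
  · exact Integrable.of_bound (hm2.comp measurable_fst).aestronglyMeasurable 1
      (ae_of_all _ fun q => hF1 _ _ _)

theorem IsTruncation.measurable_integral_process (H : IsTruncation f g 𝒮 S Q)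
    (hFm : Measurable fun p : Y × (Fin n → ℕ) × (Fin n → Y) => F p.1 p.2.1 p.2.2) :
    Measurable fun b => ∫ p, F b (weightAt g 𝒮 S p) (markAt f p)
      ∂(Measure.pi fun _ : Fin n => Q) := by
  have h : Measurable fun r : Y × (Fin n → X) => F r.1 (weightAt g 𝒮 S r.2) (markAt f r.2) :=
    hFm.comp (measurable_fst.prodMk ((H.measurable_weightAt.comp measurable_snd).prodMk
      (H.measurable_markAt.comp measurable_snd)))
  exact (h.stronglyMeasurable.integral_prod_right
    (ν := Measure.pi fun _ : Fin n => Q)).measurable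

/-- The weight and the mark of `x` depend only on the points inside `S_x`, hence they are
independent of the resampled configuration. -/
theorem integral_truncNat_mul_resample (H : IsTruncation f g 𝒮 S Q) (x : X) (i : Fin n)
    {u : Y → (Fin n → X) → ℝ} {w : Y → ℝ} (hu : Measurable fun r : Y × (Fin n → X) => u r.1 r.2)
    (hw : Measurable w) (hu1 : ∀ b z, |u b z| ≤ 1) (hw1 : ∀ b, |w b| ≤ 1) :
    ∃ Λ : Measure (Config X), (∀ v : Config X → ℝ≥0∞, Measurable v →
        (∀ ω : Config X, ω.1 {x} ≠ 0 → v (ω.inter (S x)) = v ω) →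
        ∫⁻ ω, v ω ∂Λ = ∫⁻ β, v (β.add x) ∂binomialLaw Q (n - 1)) ∧
      ∫ r, (truncNat g 𝒮 S x (ofPoints (Function.update r.1 i x)) : ℝ) *
          (u (f x (ofPoints (Function.update r.1 i x)))
            (resample (S x) (Function.update r.1 i x) r.2)
            - w (f x (ofPoints (Function.update r.1 i x))))
          ∂((Measure.pi fun _ : Fin n => Q).prod (Measure.pi fun _ : Fin n => offLaw Q S x)) =
        ∫ ω, (truncNat g 𝒮 S x ω : ℝ) * (∫ z, u (f x ω) z
          ∂(Measure.pi fun _ : Fin n => offLaw Q S x) - w (f x ω)) ∂Λ := by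
  have hν := isProbabilityMeasure_offLaw (H.measure_lt_one x)
  have hAm : MeasurableSet (S x : Set X) := (S x).isClosed.measurableSet
  have hCm : Measurable fun q : Fin n → X => ofPoints (Function.update q i x) :=
    measurable_ofPoints.comp (measurable_update_const i x)
  have hCx : ∀ q : Fin n → X, (ofPoints (Function.update q i x)).1 {x} ≠ 0 := fun q => by
    simpa using ofPoints_singleton_ne_zero (Function.update q i x) i
  have hWm : Measurable fun q : Fin n → X => (ofPoints (Function.update q i x)).inter (S x) :=
    (measurable_config_inter hAm).comp hCm
  have hWprob : IsProbabilityMeasure ((Measure.pi fun _ : Fin n => Q).map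
    fun q : Fin n → X => (ofPoints (Function.update q i x)).inter (S x)) :=
      Measure.isProbabilityMeasure_map hWm.aemeasurable
  have hmp := measurePreserving_resample_update (Q := Q) hAm
    (restrict_compl_eq_smul_offLaw (H.measure_lt_one x)) offLaw_self (H.self_mem x) hWm
    (dependsInside_inter hAm i x)
  have hfx : Measurable fun ω : Config X => f x ω :=
    H.measurable_mark.comp (measurable_const.prodMk measurable_id)
  have htm : Measurable fun ω : Config X => (truncNat g 𝒮 S x ω : ℝ) :=
    measurable_from_nat.comp (H.measurable_truncNat_comp measurable_const measurable_id)
  have hum : Measurable fun r : Config X × (Fin n → X) => u (f x r.1) r.2 :=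
    hu.comp ((hfx.comp measurable_fst).prodMk measurable_snd)
  refine ⟨(Measure.pi fun _ : Fin n => Q).map
    fun q : Fin n → X => (ofPoints (Function.update q i x)).inter (S x), fun v hv hv' => ?_, ?_⟩
  · rw [lintegral_map hv hWm]
    simp only [hv' _ (hCx _)]
    exact lintegral_ofPoints_update Q i x hv
  have hloc : ∀ (q z : Fin n → X), (truncNat g 𝒮 S x (ofPoints (Function.update q i x)) : ℝ) *
          (u (f x (ofPoints (Function.update q i x))) z
            - w (f x (ofPoints (Function.update q i x)))) =
      (truncNat g 𝒮 S x ((ofPoints (Function.update q i x)).inter (S x)) : ℝ) *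
          (u (f x ((ofPoints (Function.update q i x)).inter (S x))) z
            - w (f x ((ofPoints (Function.update q i x)).inter (S x)))) := fun q z => by
    obtain ⟨h1, h2⟩ := truncNat_congr H.localized (H.stopping x) hAm (hCx q)
      (inter_singleton_ne_zero (H.self_mem x) (hCx q)) (inter_inter_self _ hAm).symm
    by_cases h0 : truncNat g 𝒮 S x (ofPoints (Function.update q i x)) = 0
    · rw [← h1, h0, Nat.cast_zero, zero_mul, zero_mul]
    · rw [← h1, h2 h0 (weight_eq_one_of_truncNat_ne_zero H.zero_or_one h0)]
  have h := integral_comp_mul_sub hmp (t := fun ω => (truncNat g 𝒮 S x ω : ℝ))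
    (w := fun ω => w (f x ω)) (u := fun r => u (f x r.1) r.2) htm (hw.comp hfx) hum
    (abs_truncNat_le_one H.zero_or_one x) (fun ω => hw1 _) (fun r => hu1 _ _)
  simp only [hloc]
  exact h

/-- Comparison of `F` at a point `x` of the truncated process, the process being reduced by that
point, with the mean of `F` at the mark of `x` over the whole process. -/
theorem ofReal_abs_integral_shift_le (H : IsTruncation f g 𝒮 S Q)
    (hFm : Measurable fun p : Y × (Fin n → ℕ) × (Fin n → Y) => F p.1 p.2.1 p.2.2)
    (hF1 : ∀ z c y, |F z c y| ≤ 1)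
    (hFl : ∀ (z : Y) (c c' : Fin n → ℕ) (y y' : Fin n → Y) (d : Fin n → ℝ≥0∞), (∀ i, c i ≤ 1) →
      (∀ i, c' i ≤ 1) → (∀ i, Mismatch c y c' y' i → 1 ≤ d i) →
      ENNReal.ofReal |F z c y - F z c' y'| ≤ 2 * ∑ i, d i) (x : X) (i : Fin n) :
    ENNReal.ofReal |∫ q, (truncNat g 𝒮 S x (ofPoints (Function.update q i x)) : ℝ) *
        (F (f x (ofPoints (Function.update q i x)))
            (Function.update (weightAt g 𝒮 S (Function.update q i x)) i 0)
            (markAt f (Function.update q i x))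
          - ∫ p, F (f x (ofPoints (Function.update q i x))) (weightAt g 𝒮 S p) (markAt f p)
              ∂(Measure.pi fun _ : Fin n => Q)) ∂(Measure.pi fun _ : Fin n => Q)| ≤
      2 * (∫⁻ q, trunc g 𝒮 S x (ofPoints (Function.update q.1 i x)) *
          ∑ j, ((if j = i then 0 else nearCost g 𝒮 S x j (Function.update q.1 i x))
            + resampleCost g 𝒮 S x (Function.update q.1 i x) q.2 j)
          ∂((Measure.pi fun _ : Fin n => Q).prod (Measure.pi fun _ : Fin n => offLaw Q S x))
        + (∫⁻ β, trunc g 𝒮 S x (β.add x) ∂binomialLaw Q (n - 1)) *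
          ∫⁻ q, ∑ j, (nearCost g 𝒮 S x j q.1 + resampleCost g 𝒮 S x q.1 q.2 j)
          ∂((Measure.pi fun _ : Fin n => Q).prod (Measure.pi fun _ : Fin n => offLaw Q S x))) := by
  have hν := isProbabilityMeasure_offLaw (H.measure_lt_one x)
  have hup : Measurable fun p : Fin n → X => Function.update p i x := measurable_update_const i x
  have hCm : Measurable fun q : Fin n → X => ofPoints (Function.update q i x) :=
    measurable_ofPoints.comp hup
  have htm : Measurable fun ω : Config X => (truncNat g 𝒮 S x ω : ℝ) :=
    measurable_from_nat.comp (H.measurable_truncNat_comp measurable_const measurable_id)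
  have hfx : Measurable fun ω : Config X => f x ω :=
    H.measurable_mark.comp (measurable_const.prodMk measurable_id)
  have hGm := H.measurable_integral_process hFm
  have hG1 : ∀ b, |∫ p, F b (weightAt g 𝒮 S p) (markAt f p) ∂(Measure.pi fun _ : Fin n => Q)| ≤ 1 :=
    fun b => abs_integral_le_one _ fun p => hF1 _ _ _
  have hum : Measurable fun q : Fin n → X => F (f x (ofPoints (Function.update q i x)))
      (Function.update (weightAt g 𝒮 S (Function.update q i x)) i 0)
      (markAt f (Function.update q i x)) :=
    hFm.comp ((hfx.comp hCm).prodMk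
      (((measurable_update_const i 0).comp (H.measurable_weightAt.comp hup)).prodMk
        (H.measurable_markAt.comp hup)))
  have hvm : Measurable fun r : Y × (Fin n → X) =>
      F r.1 (farWeightAt g 𝒮 S x r.2) (markAt f r.2) :=
    hFm.comp (measurable_fst.prodMk
      (((H.measurable_farWeightAt x).comp measurable_snd).prodMk
        (H.measurable_markAt.comp measurable_snd)))
  have hres : Measurable fun r : (Fin n → X) × (Fin n → X) =>
      resample (S x) (Function.update r.1 i x) r.2 :=
    (measurable_resample (S x).isClosed.measurableSet).comp
      ((hup.comp measurable_fst).prodMk measurable_snd)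
  have hvr : Measurable fun r : (Fin n → X) × (Fin n → X) =>
      F (f x (ofPoints (Function.update r.1 i x)))
        (farWeightAt g 𝒮 S x (resample (S x) (Function.update r.1 i x) r.2))
        (markAt f (resample (S x) (Function.update r.1 i x) r.2)) :=
    hvm.comp (((hfx.comp hCm).comp measurable_fst).prodMk hres)
  refine (ofReal_abs_integral_mul_sub_le (Measure.pi fun _ : Fin n => Q)
    (Measure.pi fun _ : Fin n => offLaw Q S x) (htm.comp hCm) hum ((hGm.comp hfx).comp hCm) hvr
    (fun q => abs_truncNat_le_one H.zero_or_one x _) (fun q => hF1 _ _ _) (fun q => hG1 _)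
    (fun r => hF1 _ _ _)).trans ?_
  rw [mul_add]
  refine add_le_add ?_ ?_
  · rw [← lintegral_const_mul' _ _ ENNReal.ofNat_ne_top]
    refine lintegral_mono fun r => ?_
    have hb := hFl (f x (ofPoints (Function.update r.1 i x)))
      (Function.update (weightAt g 𝒮 S (Function.update r.1 i x)) i 0)
      (farWeightAt g 𝒮 S x (resample (S x) (Function.update r.1 i x) r.2))
      (markAt f (Function.update r.1 i x))
      (markAt f (resample (S x) (Function.update r.1 i x) r.2))
      (fun j => (if j = i then 0 else nearCost g 𝒮 S x j (Function.update r.1 i x))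
            + resampleCost g 𝒮 S x (Function.update r.1 i x) r.2 j) (fun j => by
        by_cases hj : j = i
        · subst hj; simp
        · rw [Function.update_of_ne hj]; exact H.weightAt_le_one _ _) (H.farWeightAt_le_one x _)
      fun j hj => one_le_cost_of_mismatch_update H (by simpa using H.self_mem x) hj
    have ha : ENNReal.ofReal |(truncNat g 𝒮 S x (ofPoints (Function.update r.1 i x)) : ℝ)| =
      trunc g 𝒮 S x (ofPoints (Function.update r.1 i x)) := ofReal_abs_truncNat _ _
    rw [mul_left_comm, ← ha]
    exact mul_le_mul_right hb _
  · obtain ⟨Λ, hΛ, hint⟩ := integral_truncNat_mul_resample H x i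
      (u := fun b z => F b (farWeightAt g 𝒮 S x z) (markAt f z)) hvm hGm
      (fun b z => hF1 _ _ _) hG1
    have htrm : Measurable fun ω : Config X => trunc g 𝒮 S x ω :=
      H.trunc_comp measurable_const measurable_id
    have htr := hΛ _ htrm fun ω hω => trunc_congr H.localized (H.stopping x)
      (S x).isClosed.measurableSet (inter_singleton_ne_zero (H.self_mem x) hω) hω
      (inter_inter_self ω (S x).isClosed.measurableSet)
    refine (congrArg (fun r : ℝ => ENNReal.ofReal |r|) hint).le.trans
      ((ofReal_abs_integral_le _ _).trans ?_)
    refine (lintegral_mono fun ω => ?_).trans_eq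
      ((lintegral_mul_const (2 * ∫⁻ q, ∑ j, (nearCost g 𝒮 S x j q.1 + resampleCost g 𝒮 S x q.1 q.2 j)
        ∂((Measure.pi fun _ : Fin n => Q).prod (Measure.pi fun _ : Fin n => offLaw Q S x)))
        htrm).trans ?_)
    · rw [abs_mul, ENNReal.ofReal_mul (abs_nonneg _), ofReal_abs_truncNat]
      exact mul_le_mul_right (ofReal_abs_integral_far_sub_le H hFm hF1 hFl x (f x ω)) _
    · rw [htr, mul_left_comm]

end Shift

/-! ### Intensity measures and comparison with the Poisson process -/

section Intensity

variable {T Y : Type*} [MeasurableSpace T] [MeasurableSpace Y] {n : ℕ} (μ : Measure T)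

/-- The intensity measure of the point process `∑ i, c i • δ_{y i}` with weights `c i ∈ {0, 1}`. -/
def intensity (c : T → Fin n → ℕ) (y : T → Fin n → Y) : Measure Y :=
  ∑ i, (μ.restrict {t | c t i = 1}).map fun t => y t i

instance [IsFiniteMeasure μ] (c : T → Fin n → ℕ) (y : T → Fin n → Y) :
    IsFiniteMeasure (intensity μ c y) := by
  unfold intensity
  infer_instance

variable {μ} {c : T → Fin n → ℕ} {y : T → Fin n → Y}

theorem intensity_apply (hcm : Measurable c) (hym : Measurable y) (hc : ∀ t i, c t i ≤ 1)
    {B : Set Y} (hB : MeasurableSet B) :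
    intensity μ c y B = ∫⁻ t, (weighted (c t) (y t)).1 B ∂μ := by
  have hyi : ∀ i, Measurable fun t => y t i := fun i => (measurable_pi_apply i).comp hym
  have hci : ∀ i, MeasurableSet {t | c t i = 1} := fun i =>
    ((measurable_pi_apply i).comp hcm) (measurableSet_singleton 1)
  have h : ∀ t, (weighted (c t) (y t)).1 B =
      ∑ i, ({t | c t i = 1} ∩ (fun t => y t i) ⁻¹' B).indicator 1 t := fun t => by
    rw [weighted_apply _ _ hB]
    refine Finset.sum_congr rfl fun i _ => ?_
    rcases Nat.le_one_iff_eq_zero_or_eq_one.1 (hc t i) with h0 | h0 <;>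
      by_cases hy : y t i ∈ B <;> simp [h0, hy]
  have hms : ∀ i, MeasurableSet ({t | c t i = 1} ∩ (fun t => y t i) ⁻¹' B) := fun i =>
    (hci i).inter (hyi i hB)
  simp only [h]
  rw [lintegral_finsetSum _ fun i _ => measurable_one.indicator (hms i), intensity,
    Measure.finsetSum_apply]
  refine Finset.sum_congr rfl fun i _ => ?_
  rw [lintegral_indicator_one (hms i), Measure.map_apply (hyi i) hB,
    Measure.restrict_apply (hyi i hB), Set.inter_comm]

theorem integral_intensity [IsProbabilityMeasure μ] (hcm : Measurable c) (hym : Measurable y)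
    (hc : ∀ t i, c t i ≤ 1) {G : Y → ℝ} (hG : Measurable G) (hG1 : ∀ z, |G z| ≤ 1) :
    ∫ z, G z ∂intensity μ c y = ∑ i, ∫ t, (c t i : ℝ) * G (y t i) ∂μ := by
  have hyi : ∀ i, Measurable fun t => y t i := fun i => (measurable_pi_apply i).comp hym
  have hci : ∀ i, MeasurableSet {t | c t i = 1} := fun i =>
    ((measurable_pi_apply i).comp hcm) (measurableSet_singleton 1)
  rw [intensity, integral_finsetSum_measure fun i _ => Integrable.of_bound
    hG.aestronglyMeasurable 1 (ae_of_all _ hG1)]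
  refine Finset.sum_congr rfl fun i _ => ?_
  rw [integral_map (hyi i).aemeasurable hG.aestronglyMeasurable, ← integral_indicator (hci i)]
  refine integral_congr_ae (ae_of_all _ fun t => ?_)
  rcases Nat.le_one_iff_eq_zero_or_eq_one.1 (hc t i) with h0 | h0 <;>
    simp [Set.indicator, h0]

/-- Comparison of a finite point process with a Poisson process: besides the distance of the
intensity measures, there is one error term for each point, which compares the values of a function
`F` at the process reduced by that point and at the whole process. -/
theorem exists_ofReal_abs_integral_sub_poissonLaw_le [IsProbabilityMeasure μ] (M : Measure Y)
    [IsFiniteMeasure M] (hcm : Measurable c) (hym : Measurable y) (hc : ∀ t i, c t i ≤ 1)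
    {h : FinConfig Y → ℝ} (hh : IsLip h) :
    ∃ F : Y → (Fin n → ℕ) → (Fin n → Y) → ℝ,
      (Measurable fun p : Y × (Fin n → ℕ) × (Fin n → Y) => F p.1 p.2.1 p.2.2) ∧
      (∀ z c y, |F z c y| ≤ 1) ∧
      (∀ (z : Y) (c c' : Fin n → ℕ) (y y' : Fin n → Y) (d : Fin n → ℝ≥0∞), (∀ i, c i ≤ 1) →
        (∀ i, c' i ≤ 1) → (∀ i, Mismatch c y c' y' i → 1 ≤ d i) →
        ENNReal.ofReal |F z c y - F z c' y'| ≤ 2 * ∑ i, d i) ∧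
      ENNReal.ofReal |∫ t, h (weighted (c t) (y t)) ∂μ - ∫ η, h η ∂poissonLaw M| ≤
        dTV (intensity μ c y) M + ∑ i, ENNReal.ofReal |∫ t, (c t i : ℝ) *
          (F (y t i) (Function.update (c t) i 0) (y t) - ∫ t', F (y t i) (c t') (y t') ∂μ) ∂μ| := by
  obtain ⟨F, hFm, hF1, hFo, hFl, hF⟩ := exists_stein_function (M := M) μ hcm hym hc hh
  refine ⟨F, hFm, hF1, hFl, ?_⟩
  have hjoint : Measurable fun r : Y × T => F r.1 (c r.2) (y r.2) :=
    hFm.comp (measurable_fst.prodMk ((hcm.comp measurable_snd).prodMk (hym.comp measurable_snd)))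
  have hGm : Measurable fun z => ∫ t, F z (c t) (y t) ∂μ :=
    (hjoint.stronglyMeasurable.integral_prod_right (ν := μ)).measurable
  have hG1 : ∀ z, |∫ t, F z (c t) (y t) ∂μ| ≤ 1 := fun z =>
    abs_integral_le_one μ fun t => hF1 _ _ _
  have hFi : ∀ z, Integrable (fun t => F z (c t) (y t)) μ := fun z =>
    Integrable.of_bound (hjoint.comp measurable_prodMk_left).aestronglyMeasurable 1
      (ae_of_all _ fun t => hF1 _ _ _)
  have hG2 : ∀ z z', |∫ t, F z (c t) (y t) ∂μ - ∫ t, F z' (c t) (y t) ∂μ| ≤ 1 := fun z z' => by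
    rw [← integral_sub (hFi z) (hFi z')]
    exact abs_integral_le_one μ fun t => hFo _ _ _ _
  have hyi : ∀ i, Measurable fun t => y t i := fun i => (measurable_pi_apply i).comp hym
  have hcR : ∀ i, Measurable fun t => (c t i : ℝ) := fun i =>
    measurable_from_nat.comp ((measurable_pi_apply i).comp hcm)
  have hc1 : ∀ t i, |(c t i : ℝ)| ≤ 1 := fun t i => by
    rw [abs_of_nonneg (Nat.cast_nonneg _)]
    exact_mod_cast hc t i
  have hb : ∀ {r s : ℝ}, |r| ≤ 1 → |s| ≤ 1 → ‖r * s‖ ≤ 1 := fun hr hs => by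
    rw [Real.norm_eq_abs, abs_mul]
    exact mul_le_one₀ hr (abs_nonneg _) hs
  have hi1 : ∀ i, Integrable (fun t => (c t i : ℝ) *
      F (y t i) (Function.update (c t) i 0) (y t)) μ := fun i =>
    Integrable.of_bound ((hcR i).mul (hFm.comp ((hyi i).prodMk
      (((measurable_update_const i 0).comp hcm).prodMk hym)))).aestronglyMeasurable 1
      (ae_of_all _ fun t => hb (hc1 t i) (hF1 _ _ _))
  have hi2 : ∀ i, Integrable (fun t => (c t i : ℝ) * ∫ t', F (y t i) (c t') (y t') ∂μ) μ := fun i =>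
    Integrable.of_bound ((hcR i).mul (hGm.comp (hyi i))).aestronglyMeasurable 1
      (ae_of_all _ fun t => hb (hc1 t i) (hG1 _))
  have hi3 : Integrable (fun r : T × Y => F r.2 (c r.1) (y r.1)) (μ.prod M) :=
    Integrable.of_bound (hjoint.comp measurable_swap).aestronglyMeasurable 1
      (ae_of_all _ fun t => hF1 _ _ _)
  have hsum : Integrable (fun t => ∑ i, (c t i : ℝ) *
      F (y t i) (Function.update (c t) i 0) (y t)) μ := integrable_finsetSum _ fun i _ => hi1 i
  have hdec : ∫ t, h (weighted (c t) (y t)) ∂μ - ∫ η, h η ∂poissonLaw M =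
      (∫ z, ∫ t, F z (c t) (y t) ∂μ ∂intensity μ c y - ∫ z, ∫ t, F z (c t) (y t) ∂μ ∂M) +
      ∑ i, ∫ t, (c t i : ℝ) *
          (F (y t i) (Function.update (c t) i 0) (y t) - ∫ t', F (y t i) (c t') (y t') ∂μ) ∂μ := by
    rw [hF, integral_sub hsum hi3.integral_prod_left, integral_finsetSum _ fun i _ => hi1 i,
      integral_intensity hcm hym hc hGm hG1,
      integral_integral_swap (f := fun t z => F z (c t) (y t)) hi3]
    simp only [mul_sub]
    rw [Finset.sum_congr rfl fun i _ => integral_sub (hi1 i) (hi2 i), Finset.sum_sub_distrib]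
    ring
  rw [hdec]
  refine (ENNReal.ofReal_le_ofReal (abs_add_le _ _)).trans (ENNReal.ofReal_add_le.trans
    (add_le_add (ofReal_abs_integral_sub_le_dTV _ _ hGm hG1 hG2) ?_))
  refine (ENNReal.ofReal_le_ofReal (Finset.abs_sum_le_sum_abs _ _)).trans_eq ?_
  exact ENNReal.ofReal_sum_of_nonneg fun i _ => abs_nonneg _

theorem ofReal_abs_toReal_sub_le {a b e : ℝ≥0∞} (ha : a ≠ ∞) (hb : b ≠ ∞) (h1 : a ≤ b)
    (h2 : b ≤ a + e) : ENNReal.ofReal |a.toReal - b.toReal| ≤ e := by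
  by_cases he : e = ∞
  · rw [he]; exact le_top
  have h3 := ENNReal.toReal_mono hb h1
  have h4 := ENNReal.toReal_mono (ENNReal.add_ne_top.2 ⟨ha, he⟩) h2
  rw [ENNReal.toReal_add ha he] at h4
  rw [ENNReal.ofReal_le_iff_le_toReal he, abs_sub_comm, abs_of_nonneg (sub_nonneg.2 h3)]
  linarith

theorem dTV_le_of_le_of_le {K L : Measure Y} {e : ℝ≥0∞}
    (h1 : ∀ A, MeasurableSet A → K A ≤ L A) (h2 : ∀ A, MeasurableSet A → L A ≤ K A + e) :
    dTV K L ≤ e :=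
  iSup₂_le fun A hA => ofReal_abs_toReal_sub_le hA.2.1.ne hA.2.2.ne (h1 A hA.1) (h2 A hA.1)

end Intensity

/-! ### The error of truncation -/

section Truncation

variable {X Y : Type*} [TopologicalSpace X] [LocallyCompactSpace X] [SecondCountableTopology X]
  [T2Space X] [MeasurableSpace X] [BorelSpace X] [MeasurableSpace Y] {n : ℕ}
  {f : X → Config X → Y} {g : X → Config X → ℕ} {𝒮 : X → Config X → Closeds X}
  {S : X → Closeds X} {Q : Measure X} [IsProbabilityMeasure Q]

theorem xi_apply (p : Fin n → X) {B : Set Y} (hB : MeasurableSet B) :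
    (xi f g p).1 B = ∑ i, (g (p i) (ofPoints p) : ℝ≥0∞) * B.indicator 1 (f (p i) (ofPoints p)) :=
  weighted_apply (fun i => g (p i) (ofPoints p)) (fun i => f (p i) (ofPoints p)) hB

theorem weighted_le_xi (p : Fin n → X) {B : Set Y} (hB : MeasurableSet B) :
    (weighted (weightAt g 𝒮 S p) (markAt f p)).1 B ≤ (xi f g p).1 B := by
  rw [weighted_apply _ _ hB, xi_apply p hB]
  refine Finset.sum_le_sum fun i _ => mul_le_mul_left ?_ _
  exact_mod_cast truncNat_le (p i) (ofPoints p)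

theorem xi_le_weighted_add (p : Fin n → X) {B : Set Y} (hB : MeasurableSet B) :
    (xi f g p).1 B ≤ (weighted (weightAt g 𝒮 S p) (markAt f p)).1 B
      + ∑ i, excess g 𝒮 S (p i) (ofPoints p) := by
  rw [weighted_apply _ _ hB, xi_apply p hB, ← Finset.sum_add_distrib]
  refine Finset.sum_le_sum fun i _ => ?_
  rw [← truncNat_add_excess (g := g) (𝒮 := 𝒮) (S := S) (p i) (ofPoints p), add_mul]
  refine add_le_add le_rfl ((mul_le_mul_right ?_ _).trans_eq (mul_one _))
  exact Set.indicator_le_self' (fun _ _ => zero_le) _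

theorem lintegral_sum_excess (H : IsTruncation f g 𝒮 S Q) :
    ∫⁻ p, ∑ i, excess g 𝒮 S (p i) (ofPoints p) ∂(Measure.pi fun _ : Fin n => Q) =
      n * ∫⁻ x, (∫⁻ β, excess g 𝒮 S x (β.add x) ∂binomialLaw Q (n - 1)) ∂Q := by
  have hm := measurable_excess H.measurable_weight H.measurable_stopping H.measurable_set
  have hmi : ∀ i, Measurable fun p : Fin n → X => excess g 𝒮 S (p i) (ofPoints p) := fun i =>
    hm.comp ((measurable_pi_apply i).prodMk measurable_ofPoints)
  rw [lintegral_finsetSum _ fun i _ => hmi i,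
    Finset.sum_congr rfl fun i _ => lintegral_ofPoints_eval Q i hm, Finset.sum_const,
    Finset.card_univ, Fintype.card_fin, nsmul_eq_mul]

theorem IsTruncation.measurable_xi (H : IsTruncation f g 𝒮 S Q) :
    Measurable (xi f g : (Fin n → X) → FinConfig Y) :=
  Measurable.weighted
    (measurable_pi_lambda _ fun i => H.measurable_weight.comp
      ((measurable_pi_apply i).prodMk measurable_ofPoints))
    H.measurable_markAt

/-- Truncation changes the expectation of a Lipschitz functional by at most the expected number of
points whose stopping set is not contained in the truncation set. -/
theorem ofReal_abs_integral_xi_sub_le (H : IsTruncation f g 𝒮 S Q) {h : FinConfig Y → ℝ}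
    (hh : IsLip h) (hi : Integrable (fun p => h (xi f g p)) (Measure.pi fun _ : Fin n => Q))
    (hi' : Integrable (fun p => h (weighted (weightAt g 𝒮 S p) (markAt f p)))
      (Measure.pi fun _ : Fin n => Q)) :
    ENNReal.ofReal |∫ p, h (xi f g p) ∂(Measure.pi fun _ : Fin n => Q)
        - ∫ p, h (weighted (weightAt g 𝒮 S p) (markAt f p)) ∂(Measure.pi fun _ : Fin n => Q)| ≤
      n * ∫⁻ x, (∫⁻ β, excess g 𝒮 S x (β.add x) ∂binomialLaw Q (n - 1)) ∂Q := by
  rw [← integral_sub hi hi', ← lintegral_sum_excess H]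
  refine (ofReal_abs_integral_le _ _).trans (lintegral_mono fun p => ?_)
  rw [abs_sub_comm]
  exact (hh.2 _ _).trans (dTV_le_of_le_of_le (fun A hA => weighted_le_xi p hA)
    fun A hA => xi_le_weighted_add p hA)

theorem integrable_lip_weighted {T : Type*} [MeasurableSpace T] (μ : Measure T) [IsFiniteMeasure μ]
    {c : T → Fin n → ℕ} {y : T → Fin n → Y} (hcm : Measurable c) (hym : Measurable y)
    (hc : ∀ t i, c t i ≤ 1) {h : FinConfig Y → ℝ} (hh : IsLip h) :
    Integrable (fun t => h (weighted (c t) (y t))) μ := by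
  have h0 : ∀ t, |h (weighted (c t) (y t)) - h ⟨0, inferInstance, fun _ _ => ⟨0, by simp⟩⟩| ≤ n :=
    fun t => hh.abs_sub_le (Nat.cast_nonneg n) fun B hB => by
      have h1 : ((0 : Measure Y) B).toReal = 0 := by simp
      rw [h1, sub_zero, abs_of_nonneg ENNReal.toReal_nonneg, toReal_weighted_apply _ _ hB]
      calc ∑ i, (c t i : ℝ) * B.indicator 1 (y t i) ≤ ∑ _i : Fin n, (1 : ℝ) :=
            Finset.sum_le_sum fun i _ => mul_le_one₀ (by exact_mod_cast hc t i)
              (indicator_one_mem_Icc B _).1 (indicator_one_mem_Icc B _).2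
        _ = n := by simp
  refine Integrable.of_bound (hh.1.comp (Measurable.weighted hcm hym)).aestronglyMeasurable
    (n + |h ⟨0, inferInstance, fun _ _ => ⟨0, by simp⟩⟩|) (ae_of_all _ fun t => ?_)
  rw [Real.norm_eq_abs]
  exact (abs_sub_abs_le_abs_sub _ _ |>.trans (h0 t) |> sub_le_iff_le_add.1)

theorem dTV_intensity_le (H : IsTruncation f g 𝒮 S Q) {L : Measure Y}
    (hL : ∀ B, MeasurableSet B → L B = ∫⁻ p, (xi f g p).1 B ∂(Measure.pi fun _ : Fin n => Q))
    (M : Measure Y) :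
    dTV (intensity (Measure.pi fun _ : Fin n => Q) (weightAt g 𝒮 S) (markAt f)) M ≤
      n * (∫⁻ x, (∫⁻ β, excess g 𝒮 S x (β.add x) ∂binomialLaw Q (n - 1)) ∂Q) + dTV L M := by
  have hap : ∀ A : Set Y, MeasurableSet A →
      intensity (Measure.pi fun _ : Fin n => Q) (weightAt g 𝒮 S) (markAt f) A =
        ∫⁻ p, (weighted (weightAt g 𝒮 S p) (markAt f p)).1 A ∂(Measure.pi fun _ : Fin n => Q) :=
    fun A hA => intensity_apply H.measurable_weightAt H.measurable_markAt H.weightAt_le_one hA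
  have hfin : IsFiniteMeasure L := ⟨by
    rw [hL _ MeasurableSet.univ]
    refine (lintegral_mono (g := fun _ => (n : ℝ≥0∞)) fun p => ?_).trans_lt (by simp)
    rw [xi_apply p MeasurableSet.univ]
    refine (Finset.sum_le_sum (g := fun _ => (1 : ℝ≥0∞)) fun i _ => ?_).trans_eq (by simp)
    rcases H.zero_or_one (p i) (ofPoints p) with h | h <;> simp [h]⟩
  refine (dTV_triangle _ L M).trans (add_le_add (dTV_le_of_le_of_le (fun A hA => ?_)
    fun A hA => ?_) le_rfl)
  · rw [hap A hA, hL A hA]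
    exact lintegral_mono fun p => weighted_le_xi p hA
  · rw [hap A hA, hL A hA, ← lintegral_sum_excess H, ← lintegral_add_left]
    · exact lintegral_mono fun p => xi_le_weighted_add p hA
    · exact (measurable_finConfig_apply hA).comp 
        (Measurable.weighted H.measurable_weightAt H.measurable_markAt)

end Truncation

/-! ### The sum of the error terms -/

section ErrorTerms

variable {X Y : Type*} [TopologicalSpace X] [LocallyCompactSpace X] [SecondCountableTopology X]
  [T2Space X] [MeasurableSpace X] [BorelSpace X] [MeasurableSpace Y] {n : ℕ}
  {f : X → Config X → Y} {g : X → Config X → ℕ} {𝒮 : X → Config X → Closeds X}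
  {S : X → Closeds X} {Q : Measure X} [IsProbabilityMeasure Q]

theorem ofReal_abs_integral_pi_le (i : Fin n) {Φ : (Fin n → X) → ℝ} (hΦ : Measurable Φ) {C : ℝ}
    (hC : ∀ p, |Φ p| ≤ C) :
    ENNReal.ofReal |∫ p, Φ p ∂(Measure.pi fun _ : Fin n => Q)| ≤
      ∫⁻ x, ENNReal.ofReal |∫ p, Φ (Function.update p i x) ∂(Measure.pi fun _ : Fin n => Q)| ∂Q := by
  have hmp := measurePreserving_update (n := n) Q i
  have h : ∫ p, Φ p ∂(Measure.pi fun _ : Fin n => Q) =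
      ∫ x, ∫ p, Φ (Function.update p i x) ∂(Measure.pi fun _ : Fin n => Q) ∂Q := by
    rw [← hmp.map_eq, integral_map hmp.measurable.aemeasurable hΦ.aestronglyMeasurable, hmp.map_eq]
    exact integral_prod _ (Integrable.of_bound (hΦ.comp hmp.measurable).aestronglyMeasurable C
      (ae_of_all _ fun q => hC _))
  rw [h]
  exact ofReal_abs_integral_le _ _

theorem IsTruncation.measurable_offLaw (H : IsTruncation f g 𝒮 S Q) :
    Measurable fun z : X × X => offLaw Q S z.1 (S z.2) := by
  have h1 : ∀ z : X × X, offLaw Q S z.1 (S z.2) =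
      (1 - Q (S z.1))⁻¹ * ∫⁻ w, inside S z.2 w * (1 - inside S z.1 w) ∂Q := fun z => by
    have h2 : ∀ w, inside S z.2 w * (1 - inside S z.1 w) =
        ((S z.2 : Set X) ∩ (S z.1 : Set X)ᶜ).indicator 1 w := fun w => by
      by_cases hw : w ∈ (S z.2 : Set X) <;> by_cases hw' : w ∈ (S z.1 : Set X)
      · rw [inside_of_mem hw', Set.indicator_of_notMem fun h => h.2 hw', tsub_self, mul_zero]
      · rw [inside_of_mem hw, inside_of_notMem hw', Set.indicator_of_mem (Set.mem_inter hw hw')]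
        simp
      · rw [inside_of_notMem hw, Set.indicator_of_notMem fun h => hw h.1, zero_mul]
      · rw [inside_of_notMem hw, Set.indicator_of_notMem fun h => hw h.1, zero_mul]
    simp only [h2]
    rw [lintegral_indicator_one ((S z.2).isClosed.measurableSet.inter
      (S z.1).isClosed.measurableSet.compl), offLaw, Measure.smul_apply,
      Measure.restrict_apply (S z.2).isClosed.measurableSet, smul_eq_mul,
      prob_compl_eq_one_sub (S z.1).isClosed.measurableSet]
  simp only [h1]
  have h3 : Measurable fun r : (X × X) × X => inside S r.1.2 r.2 * (1 - inside S r.1.1 r.2) :=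
    (H.inside_comp (measurable_snd.comp measurable_fst) measurable_snd).mul
      ((H.inside_comp (measurable_fst.comp measurable_fst) measurable_snd).const_sub 1)
  exact ((((H.measurable_measure Q).comp measurable_fst).const_sub 1).inv).mul
    h3.lintegral_prod_right'

theorem two_mul_lintegral_le {α : Type*} [MeasurableSpace α] (μ : Measure α) {k : ℝ≥0∞}
    {A₂ A₃ A₅ A₆ A₇ B : α → ℝ≥0∞} (h₂ : Measurable A₂) (h₃ : Measurable A₃) (h₅ : Measurable A₅)
    (h₆ : Measurable A₆) (h₇ : Measurable A₇) :
    k * ∫⁻ x, 2 * (k * A₂ x + (k * A₃ x + (k ^ 2 * A₅ x + (k * A₆ x + (k ^ 2 * A₇ x + B x))))) ∂μ =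
      2 * k ^ 2 * ∫⁻ x, A₂ x ∂μ + 2 * k ^ 2 * ∫⁻ x, A₃ x ∂μ + 2 * k * ∫⁻ x, B x ∂μ
        + 2 * k ^ 3 * ∫⁻ x, A₅ x ∂μ
        + (2 * k ^ 2 * ∫⁻ x, A₆ x ∂μ + 2 * k ^ 3 * ∫⁻ x, A₇ x ∂μ) := by
  rw [lintegral_const_mul' _ _ ENNReal.ofNat_ne_top, lintegral_add_left (h₂.const_mul _),
    lintegral_add_left (h₃.const_mul _), lintegral_add_left (h₅.const_mul _),
    lintegral_add_left (h₆.const_mul _), lintegral_add_left (h₇.const_mul _),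
    lintegral_const_mul _ h₂, lintegral_const_mul _ h₃, lintegral_const_mul _ h₅,
    lintegral_const_mul _ h₆, lintegral_const_mul _ h₇]
  ring

/-- The sum over the `n` points of the bounds for the errors is `E₂ + E₃ + E₄ + E₅ + E₆`. -/
theorem lintegral_errors_eq (H : IsTruncation f g 𝒮 S Q) :
    n * ∫⁻ x, 2 * (
      (n * (∫⁻ y, meet S x y
        * (∫⁻ β, trunc g 𝒮 S x ((β.add x).add y) * trunc g 𝒮 S y ((β.add x).add y)
          ∂binomialLaw Q (n - 2)) ∂Q)
      + (n * (∫⁻ y, apart S x y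
        * (∫⁻ β, trunc g 𝒮 S x (β.add x) * trunc g 𝒮 S y (β.add y) ∂binomialLaw Q (n - 2))
        * offLaw Q S x (S y) ∂Q)
      + n ^ 2 * (∫⁻ y, (∫⁻ w in (S x : Set X), apart S x y
        * (∫⁻ β, trunc g 𝒮 S x ((β.add x).add w) * trunc g 𝒮 S y (β.add y)
          ∂binomialLaw Q (n - 3))
        * offLaw Q S x (S y) ∂Q) ∂Q)
      + ((∫⁻ β, trunc g 𝒮 S x (β.add x) ∂binomialLaw Q (n - 1))
          + n * ∫⁻ z in (S x : Set X),
            (∫⁻ β, trunc g 𝒮 S x ((β.add x).add z) ∂binomialLaw Q (n - 2)) ∂Q)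
        * farMean Q n g 𝒮 S x))
      + (∫⁻ β, trunc g 𝒮 S x (β.add x) ∂binomialLaw Q (n - 1)) *
      (n * (∫⁻ y, meet S x y * (∫⁻ β, trunc g 𝒮 S y (β.add y) ∂binomialLaw Q (n - 1)) ∂Q)
      + n ^ 2 * (Q (S x) * ∫⁻ y, apart S x y
        * (∫⁻ β, trunc g 𝒮 S y (β.add y) ∂binomialLaw Q (n - 2)) * offLaw Q S x (S y) ∂Q)
      + n * Q (S x) * farMean Q n g 𝒮 S x)) ∂Q =
    E₂ Q n g 𝒮 S + E₃ Q n g 𝒮 S + E₄ Q n g 𝒮 S + E₅ Q n g 𝒮 S + E₆ Q n g 𝒮 S := by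
  have ht : ∀ m : ℤ, Measurable fun x =>
      ∫⁻ β, trunc g 𝒮 S x (β.add x) ∂binomialLaw Q m := fun m => by
    have h : Measurable fun q : X × Config X => trunc g 𝒮 S q.1 (q.2.add q.1) :=
      H.trunc_comp measurable_fst (Measurable.config_add measurable_snd measurable_fst)
    exact measurable_lintegral_config h Q m
  have hoff := H.measurable_offLaw
  have hmeet : Measurable fun z : X × X => meet S z.1 z.2 :=
    H.meet_comp measurable_fst measurable_snd
  have hapart : Measurable fun z : X × X => apart S z.1 z.2 :=
    H.apart_comp measurable_fst measurable_snd
  have hQS : Measurable fun z : X × X => Q (S z.1) := (H.measurable_measure Q).comp measurable_fst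
  have m₂ : Measurable fun z : X × X => meet S z.1 z.2
      * (∫⁻ β, trunc g 𝒮 S z.1 (β.add z.1) ∂binomialLaw Q (n - 1))
      * (∫⁻ β, trunc g 𝒮 S z.2 (β.add z.2) ∂binomialLaw Q (n - 1)) :=
    (hmeet.mul ((ht _).comp measurable_fst)).mul ((ht _).comp measurable_snd)
  have m₃ : Measurable fun z : X × X => meet S z.1 z.2
      * (∫⁻ β, trunc g 𝒮 S z.1 ((β.add z.1).add z.2) * trunc g 𝒮 S z.2 ((β.add z.1).add z.2)
          ∂binomialLaw Q (n - 2)) := by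
    have h1 : Measurable fun q : (X × X) × Config X => (q.2.add q.1.1).add q.1.2 :=
      Measurable.config_add (Measurable.config_add measurable_snd
        (measurable_fst.comp measurable_fst)) (measurable_snd.comp measurable_fst)
    have h2 : Measurable fun q : (X × X) × Config X => trunc g 𝒮 S q.1.1 ((q.2.add q.1.1).add q.1.2)
        * trunc g 𝒮 S q.1.2 ((q.2.add q.1.1).add q.1.2) :=
      (H.trunc_comp (measurable_fst.comp measurable_fst) h1).mul
        (H.trunc_comp (measurable_snd.comp measurable_fst) h1)
    exact hmeet.mul (measurable_lintegral_config h2 Q _)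
  have m₅ : Measurable fun z : X × X => apart S z.1 z.2
      * (∫⁻ β, trunc g 𝒮 S z.1 (β.add z.1) ∂binomialLaw Q (n - 1))
      * (∫⁻ β, trunc g 𝒮 S z.2 (β.add z.2) ∂binomialLaw Q (n - 2))
      * Q (S z.1) * offLaw Q S z.1 (S z.2) :=
    (((hapart.mul ((ht _).comp measurable_fst)).mul ((ht _).comp measurable_snd)).mul hQS).mul hoff
  have m₆ : Measurable fun z : X × X => apart S z.1 z.2
      * (∫⁻ β, trunc g 𝒮 S z.1 (β.add z.1) * trunc g 𝒮 S z.2 (β.add z.2)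
          ∂binomialLaw Q (n - 2))
      * offLaw Q S z.1 (S z.2) := by
    have h2 : Measurable fun q : (X × X) × Config X => trunc g 𝒮 S q.1.1 (q.2.add q.1.1)
        * trunc g 𝒮 S q.1.2 (q.2.add q.1.2) :=
      (H.trunc_comp (measurable_fst.comp measurable_fst) (Measurable.config_add measurable_snd
        (measurable_fst.comp measurable_fst))).mul
      (H.trunc_comp (measurable_snd.comp measurable_fst) (Measurable.config_add measurable_snd
        (measurable_snd.comp measurable_fst)))
    exact (hapart.mul (measurable_lintegral_config h2 Q _)).mul hoff
  have m₇ : Measurable fun z : X × X => ∫⁻ w in (S z.1 : Set X), apart S z.1 z.2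
      * (∫⁻ β, trunc g 𝒮 S z.1 ((β.add z.1).add w) * trunc g 𝒮 S z.2 (β.add z.2)
          ∂binomialLaw Q (n - 3))
      * offLaw Q S z.1 (S z.2) ∂Q := by
    have f1 : Measurable fun r : ((X × X) × X) × Config X => r.1.1.1 :=
      measurable_fst.comp (measurable_fst.comp measurable_fst)
    have f2 : Measurable fun r : ((X × X) × X) × Config X => r.1.1.2 :=
      measurable_snd.comp (measurable_fst.comp measurable_fst)
    have f3 : Measurable fun r : ((X × X) × X) × Config X => r.1.2 :=
      measurable_snd.comp measurable_fst
    have h2 : Measurable fun r : ((X × X) × X) × Config X =>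
        trunc g 𝒮 S r.1.1.1 ((r.2.add r.1.1.1).add r.1.2) * trunc g 𝒮 S r.1.1.2 (r.2.add r.1.1.2) :=
      (H.trunc_comp f1 (Measurable.config_add (Measurable.config_add measurable_snd f1) f3)).mul
      (H.trunc_comp f2 (Measurable.config_add measurable_snd f2))
    have h3 : Measurable fun r : (X × X) × X => inside S r.1.1 r.2 * (apart S r.1.1 r.1.2
        * (∫⁻ β, trunc g 𝒮 S r.1.1 ((β.add r.1.1).add r.2) * trunc g 𝒮 S r.1.2 (β.add r.1.2)
          ∂binomialLaw Q (n - 3)) * offLaw Q S r.1.1 (S r.1.2)) :=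
      (H.inside_comp (measurable_fst.comp measurable_fst) measurable_snd).mul
        (((hapart.comp measurable_fst).mul (measurable_lintegral_config h2 Q _)).mul
          (hoff.comp measurable_fst))
    simp only [← lintegral_inside_mul]
    exact h3.lintegral_prod_right'
  have hsec : ∀ (x : X) {K : X × X → ℝ≥0∞}, Measurable K → Measurable fun y => K (x, y) :=
    fun x K hK => hK.comp measurable_prodMk_left
  rw [E₂, E₃, E₄, E₅, E₆, lintegral_prod _ m₂.aemeasurable, lintegral_prod _ m₃.aemeasurable,
    lintegral_prod _ m₅.aemeasurable, lintegral_prod _ m₆.aemeasurable,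
    lintegral_prod _ m₇.aemeasurable]
  rw [← two_mul_lintegral_le Q m₂.lintegral_prod_right' m₃.lintegral_prod_right'
    m₅.lintegral_prod_right' m₆.lintegral_prod_right' m₇.lintegral_prod_right']
  congr 1
  refine lintegral_congr fun x => ?_
  congr 1
  have a₂ : ∫⁻ y, meet S x y * (∫⁻ β, trunc g 𝒮 S x (β.add x) ∂binomialLaw Q (n - 1))
      * (∫⁻ β, trunc g 𝒮 S y (β.add y) ∂binomialLaw Q (n - 1)) ∂Q =
      (∫⁻ β, trunc g 𝒮 S x (β.add x) ∂binomialLaw Q (n - 1)) *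
        ∫⁻ y, meet S x y * (∫⁻ β, trunc g 𝒮 S y (β.add y) ∂binomialLaw Q (n - 1)) ∂Q := by
    rw [← lintegral_const_mul _ ((hsec x hmeet).fun_mul (ht _))]
    exact lintegral_congr fun y => by ring
  have a₅ : ∫⁻ y, apart S x y * (∫⁻ β, trunc g 𝒮 S x (β.add x) ∂binomialLaw Q (n - 1))
      * (∫⁻ β, trunc g 𝒮 S y (β.add y) ∂binomialLaw Q (n - 2))
      * Q (S x) * offLaw Q S x (S y) ∂Q =
      (∫⁻ β, trunc g 𝒮 S x (β.add x) ∂binomialLaw Q (n - 1)) * Q (S x) *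
        ∫⁻ y, apart S x y * (∫⁻ β, trunc g 𝒮 S y (β.add y) ∂binomialLaw Q (n - 2))
          * offLaw Q S x (S y) ∂Q := by
    rw [← lintegral_const_mul _ (((hsec x hapart).fun_mul (ht _)).fun_mul (hsec x hoff))]
    exact lintegral_congr fun y => by ring
  dsimp only
  rw [a₂, a₅]
  unfold farMean
  ring

end ErrorTerms

/-! ### The bound for functionals of independent points -/

section Canonical

variable {X Y : Type*} [TopologicalSpace X] [LocallyCompactSpace X] [SecondCountableTopology X]
  [T2Space X] [MeasurableSpace X] [BorelSpace X] [MeasurableSpace Y] {n : ℕ}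
  {f : X → Config X → Y} {g : X → Config X → ℕ} {𝒮 : X → Config X → Closeds X}
  {S : X → Closeds X} {Q : Measure X} [IsProbabilityMeasure Q]

/-- The error terms of all points, each of them conditioned on the position of the point. -/
theorem sum_ofReal_abs_integral_le (H : IsTruncation f g 𝒮 S Q)
    {F : Y → (Fin n → ℕ) → (Fin n → Y) → ℝ}
    (hFm : Measurable fun p : Y × (Fin n → ℕ) × (Fin n → Y) => F p.1 p.2.1 p.2.2)
    (hF1 : ∀ z c y, |F z c y| ≤ 1)
    (hFl : ∀ (z : Y) (c c' : Fin n → ℕ) (y y' : Fin n → Y) (d : Fin n → ℝ≥0∞), (∀ i, c i ≤ 1) →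
      (∀ i, c' i ≤ 1) → (∀ i, Mismatch c y c' y' i → 1 ≤ d i) →
      ENNReal.ofReal |F z c y - F z c' y'| ≤ 2 * ∑ i, d i) :
    ∑ i, ENNReal.ofReal |∫ p, (weightAt g 𝒮 S p i : ℝ) *
        (F (markAt f p i) (Function.update (weightAt g 𝒮 S p) i 0) (markAt f p)
          - ∫ p', F (markAt f p i) (weightAt g 𝒮 S p') (markAt f p')
              ∂(Measure.pi fun _ : Fin n => Q)) ∂(Measure.pi fun _ : Fin n => Q)| ≤
      E₂ Q n g 𝒮 S + E₃ Q n g 𝒮 S + E₄ Q n g 𝒮 S + E₅ Q n g 𝒮 S + E₆ Q n g 𝒮 S := by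
  rw [← lintegral_errors_eq H]
  refine sum_le_card_mul _ fun i _ => ?_
  have hmi : Measurable fun p : Fin n → X => (markAt f p i : Y) :=
    (measurable_pi_apply i).comp H.measurable_markAt
  have hci : Measurable fun p : Fin n → X => (weightAt g 𝒮 S p i : ℝ) :=
    measurable_from_nat.comp ((measurable_pi_apply i).comp H.measurable_weightAt)
  have hΦ : Measurable fun p : Fin n → X => (weightAt g 𝒮 S p i : ℝ) *
        (F (markAt f p i) (Function.update (weightAt g 𝒮 S p) i 0) (markAt f p)
          - ∫ p', F (markAt f p i) (weightAt g 𝒮 S p') (markAt f p')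
              ∂(Measure.pi fun _ : Fin n => Q)) :=
    hci.mul ((hFm.comp (hmi.prodMk (((measurable_update_const i 0).comp
      H.measurable_weightAt).prodMk H.measurable_markAt))).sub
      ((H.measurable_integral_process hFm).comp hmi))
  refine (ofReal_abs_integral_pi_le i hΦ (C := 2) fun p => ?_).trans (lintegral_mono fun x => ?_)
  · rw [abs_mul]
    have h1 : |(weightAt g 𝒮 S p i : ℝ)| ≤ 1 := abs_truncNat_le_one H.zero_or_one _ _
    have h2 := abs_integral_le_one (Measure.pi fun _ : Fin n => Q)
      (u := fun p' => F (markAt f p i) (weightAt g 𝒮 S p') (markAt f p')) fun p' => hF1 _ _ _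
    have h3 := hF1 (markAt f p i) (Function.update (weightAt g 𝒮 S p) i 0) (markAt f p)
    have h4 := abs_sub (F (markAt f p i) (Function.update (weightAt g 𝒮 S p) i 0) (markAt f p))
      (∫ p', F (markAt f p i) (weightAt g 𝒮 S p') (markAt f p') ∂(Measure.pi fun _ : Fin n => Q))
    calc _ ≤ (1 : ℝ) * 2 := mul_le_mul h1 (by linarith) (abs_nonneg _) zero_le_one
      _ = 2 := one_mul 2
  · have h := ofReal_abs_integral_shift_le H hFm hF1 hFl x i
    have hw : ∀ q : Fin n → X, weightAt g 𝒮 S (Function.update q i x) i =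
        truncNat g 𝒮 S x (ofPoints (Function.update q i x)) := fun q => by
      rw [weightAt, Function.update_self]
    have hm : ∀ q : Fin n → X, markAt f (Function.update q i x) i =
        f x (ofPoints (Function.update q i x)) := fun q => by
      rw [markAt, Function.update_self]
    simp only [hw, hm]
    exact h.trans (mul_le_mul_right (add_le_add (lintegral_cost_update_le H x i)
      (mul_le_mul_right (lintegral_cost_le H x) _)) _)

/-- The bound for the expectation of a single Lipschitz functional. -/
theorem ofReal_abs_integral_xi_sub_poissonLaw_le (H : IsTruncation f g 𝒮 S Q) {L : Measure Y}
    (hL : ∀ B, MeasurableSet B → L B = ∫⁻ p, (xi f g p).1 B ∂(Measure.pi fun _ : Fin n => Q))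
    (M : Measure Y) [IsFiniteMeasure M] {h : FinConfig Y → ℝ} (hh : IsLip h) :
    ENNReal.ofReal |∫ p, h (xi f g p) ∂(Measure.pi fun _ : Fin n => Q) - ∫ η, h η ∂poissonLaw M| ≤
      dTV L M + E₁ Q n g 𝒮 S + E₂ Q n g 𝒮 S + E₃ Q n g 𝒮 S + E₄ Q n g 𝒮 S
        + E₅ Q n g 𝒮 S + E₆ Q n g 𝒮 S := by
  obtain ⟨F, hFm, hF1, hFl, hF⟩ := exists_ofReal_abs_integral_sub_poissonLaw_le
    (μ := Measure.pi fun _ : Fin n => Q) M (H.measurable_weightAt (n := n)) H.measurable_markAt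
    H.weightAt_le_one hh
  have hi : Integrable (fun p => h (xi f g p)) (Measure.pi fun _ : Fin n => Q) :=
    integrable_lip_weighted _ (measurable_pi_lambda _ fun i => H.measurable_weight.comp
      ((measurable_pi_apply i).prodMk measurable_ofPoints)) H.measurable_markAt
      (fun p i => by rcases H.zero_or_one (p i) (ofPoints p) with h | h <;> simp [h]) hh
  have hi' := integrable_lip_weighted (Measure.pi fun _ : Fin n => Q)
    (H.measurable_weightAt (n := n)) H.measurable_markAt H.weightAt_le_one hh
  have hE₁ : E₁ Q n g 𝒮 S =
      n * (∫⁻ x, (∫⁻ β, excess g 𝒮 S x (β.add x) ∂binomialLaw Q (n - 1)) ∂Q)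
        + n * ∫⁻ x, (∫⁻ β, excess g 𝒮 S x (β.add x) ∂binomialLaw Q (n - 1)) ∂Q := by
    rw [E₁]; ring
  calc _ ≤ _ := ENNReal.ofReal_le_ofReal (abs_sub_le _
          (∫ p, h (weighted (weightAt g 𝒮 S p) (markAt f p)) ∂(Measure.pi fun _ : Fin n => Q)) _)
    _ ≤ _ := ENNReal.ofReal_add_le
    _ ≤ _ := add_le_add (ofReal_abs_integral_xi_sub_le H hh hi hi')
        (hF.trans (add_le_add (dTV_intensity_le H hL M) (sum_ofReal_abs_integral_le H hFm hF1 hFl)))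
    _ = _ := by rw [hE₁]; ring

end Canonical

end PoissonApprox

end

open PoissonApprox

theorem theorem5p1
    {X Y Ω Ω' : Type*}
    [TopologicalSpace X] [LocallyCompactSpace X] [SecondCountableTopology X] [T2Space X]
    [MeasurableSpace X] [BorelSpace X]
    [TopologicalSpace Y] [LocallyCompactSpace Y] [SecondCountableTopology Y] [T2Space Y]
    [MeasurableSpace Y] [BorelSpace Y]
    [MeasurableSpace Ω] (P : Measure Ω) [IsProbabilityMeasure P]
    [MeasurableSpace Ω'] (P' : Measure Ω') [IsProbabilityMeasure P']
    -- the functionals `f`, `g` and the stopping set `𝒮`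
    (f : X → Config X → Y) (g : X → Config X → ℕ) (𝒮 : X → Config X → Closeds X)
    (hf : Measurable fun p : X × Config X => f p.1 p.2)
    (hg : Measurable fun p : X × Config X => g p.1 p.2)
    (hg01 : ∀ x ω, g x ω = 0 ∨ g x ω = 1)
    (h𝒮 : Measurable[inferInstance, fellSigma X] fun p : X × Config X => 𝒮 p.1 p.2)
    (hloc : IsLocalized f g 𝒮)
    -- the truncation sets `S_x`
    (Q : Measure X) [IsProbabilityMeasure Q]
    (S : X → Closeds X) (hS : Measurable[inferInstance, fellSigma X] S)
    (hxS : ∀ x, x ∈ S x) (hQS : ∀ x, Q (S x) < 1)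
    (hstopping : ∀ (x : X) (B : Set X), IsCompact B ∨ B = S x → StoppingAt 𝒮 x B)
    -- the binomial process `β_n = ∑ i, δ_{pts i}`
    (n : ℕ) (pts : Fin n → Ω → X) (hpts : ∀ i, Measurable (pts i))
    (hindep : iIndepFun pts P) (hlaw : ∀ i, P.map (pts i) = Q)
    -- the intensity measure of `ξ[β_n]`
    (L : Measure Y) (hL : HasIntensity P (fun ω => xi f g fun i => pts i ω) L)
    -- the Poisson process
    (M : Measure Y) [IsFiniteMeasure M] (ζ : Ω' → FinConfig Y) (hζ : IsPoissonProcess P' ζ M) :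
    dKR P (fun ω => xi f g fun i => pts i ω) P' ζ ≤
      dTV L M + E₁ Q n g 𝒮 S + E₂ Q n g 𝒮 S + E₃ Q n g 𝒮 S + E₄ Q n g 𝒮 S
        + E₅ Q n g 𝒮 S + E₆ Q n g 𝒮 S := by
  have H : IsTruncation f g 𝒮 S Q :=
    ⟨hf, hg, hg01, h𝒮, hloc, hS, hxS, hQS, fun x => hstopping x _ (Or.inr rfl)⟩
  have hptsm : Measurable fun ω i => pts i ω := measurable_pi_lambda _ hpts
  have hmap : P.map (fun ω i => pts i ω) = Measure.pi fun _ : Fin n => Q := by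
    rw [(iIndepFun_iff_map_fun_eq_pi_map fun i => (hpts i).aemeasurable).1 hindep]
    simp only [hlaw]
  have hL' : ∀ B, MeasurableSet B →
      L B = ∫⁻ p, (xi f g p).1 B ∂(Measure.pi fun _ : Fin n => Q) := fun B hB => by
    have hm := (measurable_finConfig_apply hB).comp (H.measurable_xi (n := n))
    have h := lintegral_map (μ := P) hm hptsm
    rw [hmap] at h
    exact (hL B hB).trans h.symm
  refine iSup₂_le fun h hh => ?_
  have h1 : ∫ ω, h (xi f g fun i => pts i ω) ∂P =
      ∫ p, h (xi f g p) ∂(Measure.pi fun _ : Fin n => Q) := by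
    have hm := hh.1.comp (H.measurable_xi (n := n))
    have h := integral_map (μ := P) hptsm.aemeasurable hm.aestronglyMeasurable
    rw [hmap] at h
    exact h.symm
  have h2 : ∫ ω, h (ζ ω) ∂P' = ∫ η, h η ∂poissonLaw M := by
    rw [← hζ.map_eq M, integral_map hζ.measurable.aemeasurable hh.1.aestronglyMeasurable]
  rw [h1, h2]
  exact ofReal_abs_integral_xi_sub_poissonLaw_le H hL' M hh
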